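/- Let $\Phi=(V_0,R,V_0^\vee,R^\vee)$ be a finite reduced root system over $\mathbb R$, not necessarily crystallographic: $R$ spans $V_0$, $R^\vee$ spans $V_0^\vee$, $(\cdot,\cdot):V_0\times V_0^\vee\to\mathbb R$ is a perfect pairing, $\alpha\mapsto\alpha^\vee$ is a bijection $R\to R^\vee$ with $(\alpha,\alpha^\vee)=2$, the reflections $s_\alpha(v)=v-(v,\alpha^\vee)\alpha$ and $s_\alpha(v')=v'-(\alpha,v')\alpha^\vee$ preserve $R$ and $R^\vee$, and $R\cap\mathbb R\alpha=\{\pm\alpha\}$ for all $\alpha\in R$. Let $W$ be the finite reflection group generated by the $s_\alpha$, acting on $V_0$ and $V_0^\vee$. Fix positive roots $R^+\subset R$ (the roots on which some linear functional on $V_0$ that vanishes on no root is positive), with simple roots $\Pi$ (the positive roots that are not nonnegative real combinations of the other positive roots); fix a $W$-invariant inner product $\langle\cdot,\cdot\rangle$ on $V_0^\vee$ and a $W$-invariant function $c:R\to\mathbb R$. Put $V^\vee=V_0^\vee\otimes_{\mathbb R}\mathbb C$ and extend $(\cdot,\cdot)$ and $\langle\cdot,\cdot\rangle$ complex bilinearly.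 Let $\mathbb H$ be the graded affine Hecke algebra: the unital associative $\mathbb C$-algebra generated by $t_w$ ($w\in W$) and $t_f$ ($f\in S(V^\vee)$) such that $w\mapsto t_w$ and $f\mapsto t_f$ extend to algebra maps on $\mathbb C[W]$ and $S(V^\vee)$, and $$\omega\, t_{s_\alpha}-t_{s_\alpha}s_\alpha(\omega)=c_\alpha(\alpha,\omega)\qquad(\alpha\in\Pi,\ \omega\in V^\vee),$$ where $\omega$ is written for $t_\omega$. Let $C(V^\vee)$ be the complex Clifford algebra generated by $V^\vee$ with $\omega\omega'+\omega'\omega=-2\langle\omega,\omega'\rangle$, let $\varepsilon$ be its automorphism with $\varepsilon(\omega)=-\omega$, and let $a\mapsto a^t$ be its antiautomorphism with $\omega^t=-\omega$. Let $\widetilde W\subset \mathsf{Pin}(V^\vee)$ be the group of invertible $a\in C(V^\vee)$ with $a^t=a^{-1}$ for which $p(a):\omega\mapsto\varepsilon(a)\omega a^{-1}$ is the action on $V^\vee$ of an element of $W$, so that $p:\widetilde W\to W$; let $\mathrm{sgn}(\widetilde w)=\det p(\widetilde w)$, and let $\rho:\mathbb C[\widetilde W]\to\mathbb H\otimes C(V^\vee)$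 be the algebra homomorphism $\rho(\widetilde w)=t_{p(\widetilde w)}\otimes\widetilde w$. For $\omega\in V^\vee$ set $\widetilde\omega=\omega-\tfrac12\sum_{\beta\in R^+}c_\beta(\beta,\omega)t_{s_\beta}\in\mathbb H$, and let $\mathcal D=\sum_i\widetilde{\omega_i}\otimes\omega^i\in\mathbb H\otimes C(V^\vee)$, where $\{\omega_i\},\{\omega^i\}$ are any bases of $V^\vee$ with $\langle\omega_i,\omega^j\rangle=\delta_{ij}$. Let $d$ be the linear endomorphism of $\mathbb H\otimes C(V^\vee)$ with $$d(a)=\mathcal D a-(-1)^k a\mathcal D\qquad\text{for } a=h\otimes v_1\cdots v_k,\ h\in\mathbb H,\ v_i\in V^\vee.$$ Let $d^{\mathrm{triv}}$ and $d^{\mathrm{sgn}}$ be the restrictions of $d$ to $$\{a:\rho(\widetilde w)a=a\rho(\widetilde w)\ \forall\,\widetilde w\in\widetilde W\}\quad\text{and}\quad\{a:\rho(\widetilde w)a=\mathrm{sgn}(\widetilde w)\,a\rho(\widetilde w)\ \forall\,\widetilde w\in\widetilde W\},$$ respectively. Then $$\ker(d^{\mathrm{triv}})=\mathrm{Im}(d^{\mathrm{sgn}})\oplus\rho\big(\mathbb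 C[\widetilde W]^{\widetilde W}\big),$$ where $\mathbb C[\widetilde W]^{\widetilde W}$ is the space of conjugation invariants in the group algebra and $\oplus$ denotes an internal direct sum of subspaces of $\mathbb H\otimes C(V^\vee)$. -/

import Mathlib

open scoped TensorProduct NNReal

noncomputable section

namespace DiracHecke

/-! ### Root systems: positive roots, simple roots, the reflection group -/

section RootSystem

variable {R V Vd : Type*} [AddCommGroup V] [Module ℝ V] [AddCommGroup Vd] [Module ℝ Vd]

/-- A choice of positive roots: the roots lying on the positive side of a hyperplane of `V₀` that
contains no root. The set `pos` consists of indices of roots. -/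
def IsPositiveSystem (Φ : RootPairing R ℝ V Vd) (pos : Finset R) : Prop :=
  ∃ f : Module.Dual ℝ V, ∀ i, f (Φ.root i) ≠ 0 ∧ (i ∈ pos ↔ 0 < f (Φ.root i))

/-- The simple roots attached to a choice of positive roots: the positive roots which are not
linear combinations with nonnegative real coefficients of the other positive roots. -/
def IsSimpleRoot (Φ : RootPairing R ℝ V Vd) (pos : Finset R) (i : R) : Prop :=
  i ∈ pos ∧ Φ.root i ∉ Submodule.span ℝ≥0 (Φ.root '' {j | j ∈ pos ∧ j ≠ i})

/-- The Weyl group `W`, viewed inside `GL(V₀^∨)`: the group generated by the reflections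
`s_α^∨ : v' ↦ v' - (α, v') α^∨`. -/
abbrev weyl (Φ : RootPairing R ℝ V Vd) : Subgroup (Vd ≃ₗ[ℝ] Vd) :=
  Subgroup.closure (Set.range Φ.coreflection)

/-- The reflection `s_α` as an element of `W`. -/
def refl (Φ : RootPairing R ℝ V Vd) (i : R) : weyl Φ :=
  ⟨Φ.coreflection i, Subgroup.subset_closure ⟨i, rfl⟩⟩

/-- The action of a real linear automorphism of `V₀^∨` on the complexification
`V^∨ = ℂ ⊗ V₀^∨`. -/
def complexify (g : Vd ≃ₗ[ℝ] Vd) : (ℂ ⊗[ℝ] Vd) →ₗ[ℂ] (ℂ ⊗[ℝ] Vd) :=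
  (g : Vd →ₗ[ℝ] Vd).baseChange ℂ

/-- The complex number `(α, ω)` for a root `α` and `ω ∈ V^∨ = ℂ ⊗ V₀^∨`. -/
def rootEval (Φ : RootPairing R ℝ V Vd) (i : R) : (ℂ ⊗[ℝ] Vd) →ₗ[ℂ] ℂ :=
  Module.Dual.baseChange ℂ (Φ.root' i)

/-! ### The graded affine Hecke algebra -/

/-- The defining relations of the graded affine Hecke algebra, between generators
`t_w` (`w ∈ W`) and `t_f` (`f ∈ S(V^∨)`): `w ↦ t_w` and `f ↦ t_f` are multiplicative, unital and
(in the second case) `ℂ`-linear, and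
`ω t_{s_α} - t_{s_α} s_α(ω) = c_α (α, ω)` for `α` simple and `ω ∈ V^∨`. -/
inductive HeckeRel (Φ : RootPairing R ℝ V Vd) (pos : Finset R) (c : R → ℝ) :
    FreeAlgebra ℂ (weyl Φ ⊕ SymmetricAlgebra ℂ (ℂ ⊗[ℝ] Vd)) →
    FreeAlgebra ℂ (weyl Φ ⊕ SymmetricAlgebra ℂ (ℂ ⊗[ℝ] Vd)) → Prop
  | group_one : HeckeRel Φ pos c (FreeAlgebra.ι ℂ (Sum.inl 1)) 1
  | group_mul (w w' : weyl Φ) : HeckeRel Φ pos c (FreeAlgebra.ι ℂ (Sum.inl (w * w')))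
      (FreeAlgebra.ι ℂ (Sum.inl w) * FreeAlgebra.ι ℂ (Sum.inl w'))
  | sym_scalar (z : ℂ) : HeckeRel Φ pos c
      (FreeAlgebra.ι ℂ (Sum.inr (algebraMap ℂ (SymmetricAlgebra ℂ (ℂ ⊗[ℝ] Vd)) z)))
      (algebraMap ℂ _ z)
  | sym_add (f g : SymmetricAlgebra ℂ (ℂ ⊗[ℝ] Vd)) : HeckeRel Φ pos c
      (FreeAlgebra.ι ℂ (Sum.inr (f + g)))
      (FreeAlgebra.ι ℂ (Sum.inr f) + FreeAlgebra.ι ℂ (Sum.inr g))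
  | sym_mul (f g : SymmetricAlgebra ℂ (ℂ ⊗[ℝ] Vd)) : HeckeRel Φ pos c
      (FreeAlgebra.ι ℂ (Sum.inr (f * g)))
      (FreeAlgebra.ι ℂ (Sum.inr f) * FreeAlgebra.ι ℂ (Sum.inr g))
  | cross (i : R) (hi : IsSimpleRoot Φ pos i) (ω : ℂ ⊗[ℝ] Vd) : HeckeRel Φ pos c
      (FreeAlgebra.ι ℂ (Sum.inr (SymmetricAlgebra.ι ℂ _ ω)) *
          FreeAlgebra.ι ℂ (Sum.inl (refl Φ i)) -
        FreeAlgebra.ι ℂ (Sum.inl (refl Φ i)) *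
          FreeAlgebra.ι ℂ (Sum.inr (SymmetricAlgebra.ι ℂ _ (complexify (Φ.coreflection i) ω))))
      (algebraMap ℂ _ ((c i : ℂ) * rootEval Φ i ω))

/-- The graded affine Hecke algebra `ℍ = ℍ(Φ, c)` (relative to a choice of positive roots): the
complex unital associative algebra with the generators and relations above. -/
def Hecke (Φ : RootPairing R ℝ V Vd) (pos : Finset R) (c : R → ℝ) : Type _ :=
  RingQuot (HeckeRel Φ pos c)

instance (Φ : RootPairing R ℝ V Vd) (pos : Finset R) (c : R → ℝ) : Ring (Hecke Φ pos c) :=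
  inferInstanceAs (Ring (RingQuot (HeckeRel Φ pos c)))

instance (Φ : RootPairing R ℝ V Vd) (pos : Finset R) (c : R → ℝ) : Algebra ℂ (Hecke Φ pos c) :=
  inferInstanceAs (Algebra ℂ (RingQuot (HeckeRel Φ pos c)))

variable (Φ : RootPairing R ℝ V Vd) (pos : Finset R) (c : R → ℝ)

/-- The quotient map from the free algebra on the generators onto `ℍ`. -/
def heckeMk : FreeAlgebra ℂ (weyl Φ ⊕ SymmetricAlgebra ℂ (ℂ ⊗[ℝ] Vd)) →ₐ[ℂ] Hecke Φ pos c :=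
  RingQuot.mkAlgHom ℂ (HeckeRel Φ pos c)

/-- The elements `t_w` of `ℍ`. -/
def tW : weyl Φ →* Hecke Φ pos c where
  toFun w := heckeMk Φ pos c (FreeAlgebra.ι ℂ (Sum.inl w))
  map_one' := by
    have h := RingQuot.mkAlgHom_rel ℂ (HeckeRel.group_one (Φ := Φ) (pos := pos) (c := c))
    exact h.trans (map_one _)
  map_mul' w w' := by
    have h := RingQuot.mkAlgHom_rel ℂ (HeckeRel.group_mul (Φ := Φ) (pos := pos) (c := c) w w')
    exact h.trans (map_mul _ _ _)

/-- The elements `ω = t_ω` of `ℍ`, for `ω ∈ V^∨`. -/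
def tV (ω : ℂ ⊗[ℝ] Vd) : Hecke Φ pos c :=
  heckeMk Φ pos c (FreeAlgebra.ι ℂ (Sum.inr (SymmetricAlgebra.ι ℂ _ ω)))

/-- The element `ω̃ = ω - (1/2) ∑_{β > 0} c_β (β, ω) t_{s_β}` of `ℍ`. -/
def tTilde (ω : ℂ ⊗[ℝ] Vd) : Hecke Φ pos c :=
  tV Φ pos c ω - (1 / 2 : ℂ) • ∑ β ∈ pos, ((c β : ℂ) * rootEval Φ β ω) • tW Φ pos c (refl Φ β)

end RootSystem

/-! ### The Clifford algebra -/

section Clifford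

variable (Vd : Type*) [NormedAddCommGroup Vd] [InnerProductSpace ℝ Vd]

/-- The complex bilinear extension to `V^∨ = ℂ ⊗ V₀^∨` of the inner product on `V₀^∨`. -/
def form : LinearMap.BilinForm ℂ (ℂ ⊗[ℝ] Vd) :=
  LinearMap.BilinForm.baseChange ℂ (innerₗ Vd)

/-- The quadratic form `ω ↦ -⟨ω, ω⟩` on `V^∨`. -/
def negQ : QuadraticForm ℂ (ℂ ⊗[ℝ] Vd) := -(form Vd).toQuadraticMap

/-- The Clifford algebra `C(V^∨)`, with `ω ω' + ω' ω = -2 ⟨ω, ω'⟩`. -/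
abbrev Cl : Type _ := CliffordAlgebra (negQ Vd)

/-- Vectors embed in the Clifford algebra. -/
theorem ι_injective : Function.Injective (CliffordAlgebra.ι (negQ Vd)) := by
  intro x y h
  have h2 := congrArg (CliffordAlgebra.equivExterior (negQ Vd)) h
  simpa [CliffordAlgebra.equivExterior, CliffordAlgebra.changeFormEquiv,
    CliffordAlgebra.changeForm_ι] using h2

end Clifford

section Main

theorem complexify_injective {Vd : Type*} [AddCommGroup Vd] [Module ℝ Vd] {g h : Vd ≃ₗ[ℝ] Vd}
    (H : complexify g = complexify h) : g = h := by
  ext x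
  have hx := LinearMap.congr_fun H ((1 : ℂ) ⊗ₜ[ℝ] x)
  simp only [complexify, LinearMap.baseChange_tmul] at hx
  exact Module.FaithfullyFlat.tensorProduct_mk_injective (A := ℝ) (B := ℂ) Vd hx

theorem complexify_one {Vd : Type*} [AddCommGroup Vd] [Module ℝ Vd] (v : ℂ ⊗[ℝ] Vd) :
    complexify (1 : Vd ≃ₗ[ℝ] Vd) v = v :=
  LinearMap.congr_fun (LinearMap.baseChange_id (R := ℝ) (A := ℂ) (M := Vd)) v

theorem complexify_mul {Vd : Type*} [AddCommGroup Vd] [Module ℝ Vd] (g h : Vd ≃ₗ[ℝ] Vd)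
    (v : ℂ ⊗[ℝ] Vd) : complexify (g * h) v = complexify g (complexify h v) :=
  LinearMap.congr_fun (LinearMap.baseChange_comp (A := ℂ) (h : Vd →ₗ[ℝ] Vd) (g : Vd →ₗ[ℝ] Vd)) v

variable {R V Vd : Type*} [AddCommGroup V] [Module ℝ V]
  [NormedAddCommGroup Vd] [InnerProductSpace ℝ Vd]

/-! ### The spin cover of the Weyl group -/

/-- `Acts a g` says that the orthogonal transformation `p(a) : ω ↦ ε(a) ω a⁻¹` of `V^∨` is (the
complexification of) `g`. Here `ε` is `CliffordAlgebra.involute`. -/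
def Acts (a : (Cl Vd)ˣ) (g : Vd ≃ₗ[ℝ] Vd) : Prop :=
  ∀ v, CliffordAlgebra.involute (a : Cl Vd) * CliffordAlgebra.ι (negQ Vd) v *
    ((a⁻¹ : (Cl Vd)ˣ) : Cl Vd) = CliffordAlgebra.ι (negQ Vd) (complexify g v)

theorem Acts.unique {a : (Cl Vd)ˣ} {g h : Vd ≃ₗ[ℝ] Vd} (hg : Acts a g) (hh : Acts a h) : g = h :=
  complexify_injective (LinearMap.ext fun v => ι_injective Vd ((hg v).symm.trans (hh v)))

theorem Acts.one : Acts (1 : (Cl Vd)ˣ) 1 := fun v => by simp [complexify_one]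

theorem Acts.mul {a b : (Cl Vd)ˣ} {g h : Vd ≃ₗ[ℝ] Vd} (hg : Acts a g) (hh : Acts b h) :
    Acts (a * b) (g * h) := fun v => by
  rw [complexify_mul, ← hg, ← hh]
  simp [mul_assoc]

theorem Acts.inv {a : (Cl Vd)ˣ} {g : Vd ≃ₗ[ℝ] Vd} (hg : Acts a g) : Acts a⁻¹ g⁻¹ := fun v => by
  have h := hg (complexify g⁻¹ v)
  rw [← complexify_mul, mul_inv_cancel, complexify_one] at h
  rw [← h]
  have h1 : CliffordAlgebra.involute ((a⁻¹ : (Cl Vd)ˣ) : Cl Vd) *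
      CliffordAlgebra.involute (a : Cl Vd) = 1 := by
    rw [← map_mul, Units.inv_mul, map_one]
  simp only [inv_inv, mul_assoc, Units.inv_mul, mul_one]
  rw [← mul_assoc, h1, one_mul]

/-- The spin cover `W̃ = p⁻¹(W) ⊆ Pin(V^∨)`: the invertible `a ∈ C(V^∨)` with `a^t = a⁻¹` such that
`p(a) : ω ↦ ε(a) ω a⁻¹` maps `V^∨` to itself and is an element of `W`. The antiautomorphism
`a ↦ a^t` of `C(V^∨)` with `ω^t = -ω` is `star`. -/
def spinWeyl (Φ : RootPairing R ℝ V Vd) : Subgroup (Cl Vd)ˣ where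
  carrier := {a | star (a : Cl Vd) = ((a⁻¹ : (Cl Vd)ˣ) : Cl Vd) ∧ ∃ w : weyl Φ, Acts a w}
  one_mem' := ⟨by simp, 1, Acts.one⟩
  mul_mem' := by
    rintro a b ⟨ha, w, hw⟩ ⟨hb, w', hw'⟩
    exact ⟨by simp [ha, hb], w * w', hw.mul hw'⟩
  inv_mem' := by
    rintro a ⟨ha, w, hw⟩
    refine ⟨?_, w⁻¹, hw.inv⟩
    rw [← ha, star_star, inv_inv]

/-- The projection `p : W̃ → W`. -/
def proj (Φ : RootPairing R ℝ V Vd) : spinWeyl Φ →* weyl Φ where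
  toFun a := a.2.2.choose
  map_one' := Subtype.ext ((1 : spinWeyl Φ).2.2.choose_spec.unique Acts.one)
  map_mul' a b := Subtype.ext
    ((a * b).2.2.choose_spec.unique (a.2.2.choose_spec.mul b.2.2.choose_spec))

theorem acts_proj (Φ : RootPairing R ℝ V Vd) (a : spinWeyl Φ) :
    Acts (a : (Cl Vd)ˣ) (proj Φ a : Vd ≃ₗ[ℝ] Vd) :=
  a.2.2.choose_spec

/-- The sign character of `W` (the determinant of the reflection representation) lifted to `W̃`. -/
def sgn (Φ : RootPairing R ℝ V Vd) (a : spinWeyl Φ) : ℝ :=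
  LinearMap.det ((proj Φ a : Vd ≃ₗ[ℝ] Vd) : Vd →ₗ[ℝ] Vd)

/-- The conjugation invariants `ℂ[W̃]^{W̃}` in the group algebra `ℂ[W̃]`. -/
def groupInvariants (Φ : RootPairing R ℝ V Vd) : Submodule ℂ (MonoidAlgebra ℂ (spinWeyl Φ)) where
  carrier := {x | ∀ a : spinWeyl Φ,
    MonoidAlgebra.of ℂ (spinWeyl Φ) a * x * MonoidAlgebra.of ℂ (spinWeyl Φ) a⁻¹ = x}
  zero_mem' a := by simp
  add_mem' hx hy a := by rw [mul_add, add_mul, hx a, hy a]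
  smul_mem' z x hx a := by rw [mul_smul_comm, smul_mul_assoc, hx a]

/-! ### The Dirac operator and the map `d` -/

variable (Φ : RootPairing R ℝ V Vd) (pos : Finset R) (c : R → ℝ)

/-- The algebra `ℍ ⊗ C(V^∨)`. -/
abbrev HCl : Type _ := Hecke Φ pos c ⊗[ℂ] Cl Vd

/-- The homomorphism `ρ : ℂ[W̃] → ℍ ⊗ C(V^∨)`, `ρ(w̃) = t_{p(w̃)} ⊗ w̃`. -/
def rho : MonoidAlgebra ℂ (spinWeyl Φ) →ₐ[ℂ] HCl Φ pos c :=
  MonoidAlgebra.lift ℂ (HCl Φ pos c) (spinWeyl Φ)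
    { toFun := fun a => tW Φ pos c (proj Φ a) ⊗ₜ[ℂ] ((a : (Cl Vd)ˣ) : Cl Vd)
      map_one' := by simp [Algebra.TensorProduct.one_def]
      map_mul' := fun a b => by simp [Algebra.TensorProduct.tmul_mul_tmul] }

/-- The Dirac element `𝒟 = ∑ i, ω̃_i ⊗ ω^i` formed with families `ω_i`, `ω^i` in `V^∨`. -/
def dirac {κ : Type*} [Fintype κ] (e e' : κ → ℂ ⊗[ℝ] Vd) : HCl Φ pos c :=
  ∑ i, tTilde Φ pos c (e i) ⊗ₜ[ℂ] CliffordAlgebra.ι (negQ Vd) (e' i)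

/-- The automorphism `1 ⊗ ε` of `ℍ ⊗ C(V^∨)`, which maps `h ⊗ v₁ ⋯ v_k` to
`(-1)^k h ⊗ v₁ ⋯ v_k`. -/
def parity : HCl Φ pos c →ₐ[ℂ] HCl Φ pos c :=
  Algebra.TensorProduct.map (AlgHom.id ℂ (Hecke Φ pos c)) CliffordAlgebra.involute

variable {Φ pos c}

/-- The linear map `d` on `ℍ ⊗ C(V^∨)` attached to an element `D`, with
`d(a) = D a - (-1)^k a D` for `a = h ⊗ v₁ ⋯ v_k`. -/
def dMap (D : HCl Φ pos c) : HCl Φ pos c →ₗ[ℂ] HCl Φ pos c :=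
  LinearMap.mulLeft ℂ D - LinearMap.mulRight ℂ D ∘ₗ (parity Φ pos c).toLinearMap

theorem dMap_tmul_prod (D : HCl Φ pos c) (h : Hecke Φ pos c) (l : List (ℂ ⊗[ℝ] Vd)) :
    dMap D (h ⊗ₜ[ℂ] (l.map (CliffordAlgebra.ι (negQ Vd))).prod) =
      D * (h ⊗ₜ[ℂ] (l.map (CliffordAlgebra.ι (negQ Vd))).prod) -
        (-1 : ℂ) ^ l.length • (h ⊗ₜ[ℂ] (l.map (CliffordAlgebra.ι (negQ Vd))).prod * D) := by
  have hl : CliffordAlgebra.involute (l.map (CliffordAlgebra.ι (negQ Vd))).prod =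
      (-1 : ℂ) ^ l.length • (l.map (CliffordAlgebra.ι (negQ Vd))).prod :=
    CliffordAlgebra.involute_prod_map_ι l
  simp [dMap, parity, hl, TensorProduct.tmul_smul]

variable (Φ pos c)

/-- `(ℍ ⊗ C(V^∨))^triv`: the elements `a` with `ρ(w̃) a = a ρ(w̃)` for all `w̃ ∈ W̃`. -/
def trivPart : Submodule ℂ (HCl Φ pos c) where
  carrier := {x | ∀ a : spinWeyl Φ, rho Φ pos c (MonoidAlgebra.of ℂ _ a) * x =
    x * rho Φ pos c (MonoidAlgebra.of ℂ _ a)}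
  zero_mem' a := by simp
  add_mem' hx hy a := by rw [mul_add, add_mul, hx a, hy a]
  smul_mem' z x hx a := by rw [mul_smul_comm, smul_mul_assoc, hx a]

/-- `(ℍ ⊗ C(V^∨))^sgn`: the elements `a` with `ρ(w̃) a = sgn(w̃) a ρ(w̃)` for all `w̃ ∈ W̃`. -/
def sgnPart : Submodule ℂ (HCl Φ pos c) where
  carrier := {x | ∀ a : spinWeyl Φ, rho Φ pos c (MonoidAlgebra.of ℂ _ a) * x =
    (sgn Φ a : ℂ) • (x * rho Φ pos c (MonoidAlgebra.of ℂ _ a))}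
  zero_mem' a := by simp
  add_mem' hx hy a := by rw [mul_add, add_mul, smul_add, hx a, hy a]
  smul_mem' z x hx a := by rw [mul_smul_comm, smul_mul_assoc, hx a, smul_comm]

variable {Φ pos c}

/-- `d^triv`: the restriction of `d` to `(ℍ ⊗ C(V^∨))^triv`. -/
def dTriv (D : HCl Φ pos c) : trivPart Φ pos c →ₗ[ℂ] HCl Φ pos c :=
  (dMap D).domRestrict (trivPart Φ pos c)

/-- `d^sgn`: the restriction of `d` to `(ℍ ⊗ C(V^∨))^sgn`. -/
def dSgn (D : HCl Φ pos c) : sgnPart Φ pos c →ₗ[ℂ] HCl Φ pos c :=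
  (dMap D).domRestrict (sgnPart Φ pos c)

end Main

end DiracHecke

end

/-!
The graded Hecke algebra has a Poincaré–Birkhoff–Witt basis: every element is uniquely a sum of
products `t_w f` with `f` a polynomial. Uniqueness is seen in an explicit representation on
`W`-indexed families of polynomials (`exists_pbw_coordinates`), in which `t_w` acts by translation
and `ω` acts on the component of `w` as multiplication by `w⁻¹(ω)`, up to a combination of
reflections. The operators of the vectors satisfy the
cross relation because a simple reflection permutes the other positive roots; they commute because
their commutators commute with translations up to a twist and vanish on families supported at the
identity of `W` (`vecOp_mul_comm`). Filter `ℍ ⊗ C(V^∨)` by the degree of `f`.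

The elements `ω̃` are permuted by conjugation with `W` as the vectors `ω` are, so that `ρ(w̃)`
commutes with `𝒟` up to `sgn(w̃)`. Hence `d` kills the image of `ρ`, and it exchanges the trivial
and the sign isotypic parts. Moreover `𝒟² = -Ω ⊗ 1 - P²`, where `Ω` is the central Casimir element
of `ℍ` and `P ∈ ρ(ℂ[W̃])` is the difference of `∑ ω_i ⊗ ω^i` and `𝒟`, which anticommutes with `𝒟`
(`Setting.dirac_sq`). An element of either isotypic part commutes with `P²`, and since `d²` is the
commutator with `𝒟²`, one gets `d² = 0` there (`Setting.dMap_dMap_eq_zero`).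

On symbols, `d` is, up to a nonzero scalar, the Koszul differential on `S(V^∨) ⊗ C(V^∨)` for each
`w ∈ W`, multiplication by `e_i` in the first factor and contraction with `e_i^*` in the second: the
supercommutator with a vector of the Clifford algebra is a contraction. The Koszul homotopy formula
shows that this complex is exact except for the scalars `1 ⊗ 1` (`exists_koszul_primitive`), and the
elements `t_w ⊗ w̃`, with the scalars in the place of `f`, are in the image of `ρ`. So an element
`a` whose image under `d` has lower degree than expected is of the form `d b + ρ(y)`, up to lower
degree (`Setting.exists_primitive`). As `W̃` is finite, averaging makes `b` and `y` equivariant when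
`a` is, and induction on the degree gives `a = d b + ρ(y)` exactly
(`Setting.exists_eq_dMap_add_rho`).

Applied to the kernel of `d` on the trivial part, this is the sum decomposition. The sum is direct
by the same statement for the sign part: if `d b = ρ(y)` with `b` in the sign part, then `d b` has
degree zero, so that `b = d b' + ρ(y')` with `b'` in the trivial part, and `d b = d² b' = 0`.
-/

open scoped TensorProduct NNReal

noncomputable section

namespace DiracHecke

/-! ### Positive and simple roots -/

section RootCombinatorics

variable {R V Vd : Type*} [AddCommGroup V] [Module ℝ V]

section Cone

variable [AddCommGroup Vd] [Module ℝ Vd] {Φ : RootPairing R ℝ V Vd} {pos : Finset R}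

/-- `ξ ∈ V₀^∨` defines the positive system `pos`: it lies on no reflecting hyperplane, and the
positive roots are those which are positive on it. -/
def Defines (Φ : RootPairing R ℝ V Vd) (pos : Finset R) (ξ : Vd) : Prop :=
  ∀ i, Φ.root' i ξ ≠ 0 ∧ (i ∈ pos ↔ 0 < Φ.root' i ξ)

theorem IsPositiveSystem.exists_defines (h : IsPositiveSystem Φ pos) :
    ∃ ξ, Defines Φ pos ξ := by
  obtain ⟨f, hf⟩ := h
  obtain ⟨ξ, rfl⟩ := (LinearMap.IsPerfPair.bijective_right Φ.toLinearMap).2 f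
  exact ⟨ξ, hf⟩

theorem root'_reflectionPerm (i j : R) (x : Vd) :
    Φ.root' (Φ.reflectionPerm i j) x = Φ.root' j (Φ.coreflection i x) := by
  simp only [RootPairing.root', RootPairing.root_reflectionPerm, RootPairing.reflection_apply,
    RootPairing.coreflection_apply, map_sub, map_smul, LinearMap.sub_apply, LinearMap.smul_apply,
    smul_eq_mul]
  rw [mul_comm]
  rfl

theorem root'_neg (i : R) (x : Vd) :
    Φ.root' (Φ.reflectionPerm i i) x = -Φ.root' i x := by
  simp [RootPairing.root']

theorem Defines.neg_mem_iff {ξ : Vd} (hξ : Defines Φ pos ξ) (i : R) :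
    Φ.reflectionPerm i i ∈ pos ↔ i ∉ pos := by
  rw [(hξ _).2, (hξ i).2, root'_neg]
  have := (hξ i).1
  constructor
  · intro h; linarith
  · intro h
    have := lt_of_le_of_ne (not_lt.1 h) this
    linarith

/-- A positive root proportional to a positive root is equal to it. -/
theorem Defines.eq_of_root_eq_smul [Φ.IsReduced] {ξ : Vd} (hξ : Defines Φ pos ξ) {i j : R}
    (hi : i ∈ pos) (hj : j ∈ pos) {t : ℝ} (h : Φ.root j = t • Φ.root i) : j = i := by
  have hdep : ¬ LinearIndependent ℝ ![Φ.root i, Φ.root j] := by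
    rw [LinearIndependent.pair_iff]
    intro H
    have := (H (-t) 1 (by rw [h]; module)).2
    exact one_ne_zero this
  rcases RootPairing.IsReduced.eq_or_eq_neg (P := Φ) i j hdep with h' | h'
  · exact (Φ.root.injective h').symm
  · have h1 := (hξ i).2.1 hi
    have h2 := (hξ j).2.1 hj
    have : Φ.root' i ξ = -Φ.root' j ξ := by simp [RootPairing.root', h']
    linarith

theorem smul_mem_span_of_nonneg {s : Set V} {x : V} {t : ℝ} (ht : 0 ≤ t)
    (hx : x ∈ Submodule.span ℝ≥0 s) : t • x ∈ Submodule.span ℝ≥0 s := by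
  have := Submodule.smul_mem _ t.toNNReal hx
  rwa [NNReal.smul_def, Real.coe_toNNReal _ ht] at this

/-- A simple reflection permutes the other positive roots: if `s_α β = -γ` with `β, γ > 0`, then
`α` is a positive multiple of `β + γ`, against simplicity. -/
theorem IsSimpleRoot.reflectionPerm_mem [Φ.IsReduced] {ξ : Vd} (hξ : Defines Φ pos ξ) {i j : R}
    (hi : IsSimpleRoot Φ pos i) (hj : j ∈ pos) (hji : j ≠ i) : Φ.reflectionPerm i j ∈ pos := by
  by_contra hneg
  set j' := Φ.reflectionPerm i j with hj'
  have hγ : Φ.reflectionPerm j' j' ∈ pos := (hξ.neg_mem_iff j').2 hneg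
  set γ := Φ.reflectionPerm j' j' with hγ'
  have hroot : Φ.root γ = Φ.pairing j i • Φ.root i - Φ.root j := by
    rw [hγ', RootPairing.root_reflectionPerm, RootPairing.reflection_apply_self, hj',
      RootPairing.root_reflectionPerm, RootPairing.reflection_apply_root]
    module
  set k := Φ.pairing j i
  have hγi : γ ≠ i := by
    intro h
    rw [h] at hroot
    exact hji (hξ.eq_of_root_eq_smul hi.1 hj (t := k - 1) (by
      rw [sub_smul, one_smul]
      rw [eq_sub_iff_add_eq] at hroot ⊢
      rw [← hroot]; abel))
  have hk : 0 < k := by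
    have h1 : Φ.root' γ ξ = k * Φ.root' i ξ - Φ.root' j ξ := by
      simp [RootPairing.root', hroot]
    have h2 := (hξ i).2.1 hi.1
    have h3 := (hξ j).2.1 hj
    have h4 := (hξ γ).2.1 hγ
    by_contra hk
    nlinarith
  refine hi.2 ?_
  have hmem : ∀ l ∈ pos, l ≠ i →
      Φ.root l ∈ Submodule.span ℝ≥0 (Φ.root '' {j | j ∈ pos ∧ j ≠ i}) :=
    fun l hl hli => Submodule.subset_span ⟨l, ⟨hl, hli⟩, rfl⟩
  have := smul_mem_span_of_nonneg (inv_nonneg.2 hk.le)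
    (Submodule.add_mem _ (hmem j hj hji) (hmem γ hγ hγi))
  rwa [hroot, add_sub_cancel, smul_smul, inv_mul_cancel₀ hk.ne', one_smul] at this

theorem Defines.nonneg_of_mem_span {ξ : Vd} (hξ : Defines Φ pos ξ) {s : Set R}
    (hs : ∀ i ∈ s, i ∈ pos) {x : V} (hx : x ∈ Submodule.span ℝ≥0 (Φ.root '' s)) :
    0 ≤ Φ.toLinearMap x ξ ∧ (Φ.toLinearMap x ξ = 0 → x = 0) := by
  induction hx using Submodule.span_induction with
  | mem x hx =>
    obtain ⟨i, hi, rfl⟩ := hx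
    have := (hξ i).2.1 (hs i hi)
    exact ⟨this.le, fun h => absurd h this.ne'⟩
  | zero => simp
  | add x y _ _ hx hy =>
    simp only [map_add, LinearMap.add_apply]
    refine ⟨add_nonneg hx.1 hy.1, fun h => ?_⟩
    rw [hx.2 (by linarith [hx.1, hy.1]), hy.2 (by linarith [hx.1, hy.1]), add_zero]
  | smul t x _ hx =>
    simp only [NNReal.smul_def, map_smul, LinearMap.smul_apply, smul_eq_mul]
    refine ⟨mul_nonneg t.2 hx.1, fun h => ?_⟩
    rcases mul_eq_zero.1 h with h | h
    · rw [h, zero_smul]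
    · rw [hx.2 h, smul_zero]

/-- Every positive root is a nonnegative combination of simple roots: the members of a minimal set
of positive roots generating the cone of positive roots are simple. -/
theorem Defines.root_mem_span_simple [Φ.IsReduced] {ξ : Vd} (hξ : Defines Φ pos ξ) {j : R}
    (hj : j ∈ pos) : Φ.root j ∈ Submodule.span ℝ≥0 (Φ.root '' {i | IsSimpleRoot Φ pos i}) := by
  classical
  let good : Finset R → Prop := fun S =>
    S ⊆ pos ∧ ∀ j ∈ pos, Φ.root j ∈ Submodule.span ℝ≥0 (Φ.root '' (S : Set R))
  have hgood : good pos := ⟨subset_rfl, fun j hj => Submodule.subset_span ⟨j, hj, rfl⟩⟩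
  obtain ⟨S, -, hS⟩ := exists_minimal_le_of_wellFoundedLT good pos hgood
  have hsimple : ∀ i ∈ S, IsSimpleRoot Φ pos i := by
    intro i hi
    have hip : i ∈ pos := hS.prop.1 hi
    refine ⟨hip, fun hspan => ?_⟩
    have hSi : (S : Set R) = insert i ((S.erase i : Finset R) : Set R) := by
      rw [← Finset.coe_insert, Finset.insert_erase hi]
    have herase : ∀ l ∈ ((S.erase i : Finset R) : Set R), l ∈ pos := fun l hl =>
      hS.prop.1 (Finset.mem_of_mem_erase hl)
    have hdecomp : ∀ l ∈ pos, ∃ (a : ℝ≥0) (z : V),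
        z ∈ Submodule.span ℝ≥0 (Φ.root '' ((S.erase i : Finset R) : Set R)) ∧
        Φ.root l = a • Φ.root i + z := by
      intro l hl
      have := hS.prop.2 l hl
      rw [hSi, Set.image_insert_eq, Submodule.mem_span_insert] at this
      obtain ⟨a, z, hz, h⟩ := this
      exact ⟨a, z, hz, h⟩
    -- a nonzero element of the span of the other positive roots has a nonzero component away from
    -- `root i`; this uses that no other positive root is proportional to `root i`
    have key : ∀ x ∈ Submodule.span ℝ≥0 (Φ.root '' {j | j ∈ pos ∧ j ≠ i}),
        ∃ (a : ℝ≥0) (z : V),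
          z ∈ Submodule.span ℝ≥0 (Φ.root '' ((S.erase i : Finset R) : Set R)) ∧
          x = a • Φ.root i + z ∧ (z = 0 → x = 0) := by
      intro x hx
      induction hx using Submodule.span_induction with
      | mem x hx =>
        obtain ⟨l, ⟨hl, hli⟩, rfl⟩ := hx
        obtain ⟨a, z, hz, h⟩ := hdecomp l hl
        refine ⟨a, z, hz, h, fun hz0 => absurd ?_ hli⟩
        rw [hz0, add_zero, NNReal.smul_def] at h
        exact hξ.eq_of_root_eq_smul hip hl h
      | zero => exact ⟨0, 0, Submodule.zero_mem _, by simp, fun _ => rfl⟩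
      | add x y _ _ hx hy =>
        obtain ⟨a, z, hz, h, h0⟩ := hx
        obtain ⟨a', z', hz', h', h0'⟩ := hy
        refine ⟨a + a', z + z', Submodule.add_mem _ hz hz', by rw [h, h', add_smul]; abel, ?_⟩
        intro hzz
        have n1 := hξ.nonneg_of_mem_span herase hz
        have n2 := hξ.nonneg_of_mem_span herase hz'
        have : Φ.toLinearMap z ξ + Φ.toLinearMap z' ξ = 0 := by
          rw [← LinearMap.add_apply, ← map_add, hzz]; simp
        rw [h0 (n1.2 (by linarith)), h0' (n2.2 (by linarith)), add_zero]
      | smul t x _ hx =>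
        obtain ⟨a, z, hz, h, h0⟩ := hx
        refine ⟨t * a, t • z, Submodule.smul_mem _ _ hz, by rw [h, smul_add, smul_smul], ?_⟩
        intro htz
        rcases smul_eq_zero.1 htz with h' | h'
        · rw [h', zero_smul]
        · rw [h0 h', smul_zero]
    obtain ⟨a, z, hz, h, h0⟩ := key _ hspan
    have hi0 : 0 < Φ.root' i ξ := (hξ i).2.1 hip
    have nz := hξ.nonneg_of_mem_span herase hz
    have hzpos : 0 < Φ.toLinearMap z ξ := by
      refine lt_of_le_of_ne nz.1 fun h' => ?_
      have h2 := h0 (nz.2 h'.symm)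
      rw [RootPairing.root', h2] at hi0
      simp at hi0
    have hval : Φ.root' i ξ = a * Φ.root' i ξ + Φ.toLinearMap z ξ := by
      have := congrArg (fun v => Φ.toLinearMap v ξ) h
      simpa [RootPairing.root', NNReal.smul_def] using this
    have ha : (a : ℝ) < 1 := by
      by_contra hcon
      nlinarith
    have hia : Φ.root i ∈ Submodule.span ℝ≥0 (Φ.root '' ((S.erase i : Finset R) : Set R)) := by
      have := smul_mem_span_of_nonneg (inv_nonneg.2 (sub_nonneg.2 ha.le)) hz
      have hz' : z = (1 - (a : ℝ)) • Φ.root i := by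
        rw [sub_smul, one_smul, eq_sub_iff_add_eq, ← NNReal.smul_def, add_comm]
        exact h.symm
      rwa [hz', smul_smul, inv_mul_cancel₀ (sub_pos.2 ha).ne', one_smul] at this
    have hbad : good (S.erase i) := by
      refine ⟨(Finset.erase_subset _ _).trans hS.prop.1, fun l hl => ?_⟩
      obtain ⟨b, y, hy, h⟩ := hdecomp l hl
      rw [h]
      exact Submodule.add_mem _ (Submodule.smul_mem _ _ hia) hy
    exact Finset.notMem_erase i S (hS.le_of_le hbad (Finset.erase_subset _ _) hi)
  exact Submodule.span_mono (Set.image_mono fun i hi => hsimple i hi) (hS.prop.2 j hj)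

theorem coreflection_reflectionPerm (i j : R) :
    Φ.coreflection (Φ.reflectionPerm i j) =
      Φ.coreflection i * Φ.coreflection j * Φ.coreflection i :=
  Φ.flip.reflection_reflectionPerm

theorem coreflection_neg (i : R) :
    Φ.coreflection (Φ.reflectionPerm i i) = Φ.coreflection i := by
  rw [coreflection_reflectionPerm, mul_assoc, ← sq, Φ.coreflection_sq, mul_one]

theorem refl_mul_self (i : R) : refl Φ i * refl Φ i = 1 :=
  Subtype.ext ((sq _).symm.trans (Φ.coreflection_sq i))

theorem refl_inv (i : R) : (refl Φ i)⁻¹ = refl Φ i :=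
  inv_eq_of_mul_eq_one_right (refl_mul_self i)

theorem refl_reflectionPerm (i j : R) :
    refl Φ (Φ.reflectionPerm i j) = refl Φ i * refl Φ j * refl Φ i :=
  Subtype.ext (coreflection_reflectionPerm i j)

theorem refl_neg (i : R) : refl Φ (Φ.reflectionPerm i i) = refl Φ i :=
  Subtype.ext (coreflection_neg i)

/-- Sums over all roots of an even function are twice sums over the positive roots. -/
theorem Defines.sum_eq_two_smul [Fintype R] {M : Type*} [AddCommGroup M] {ξ : Vd}
    (hξ : Defines Φ pos ξ) (φ : R → M) (hφ : ∀ i, φ (Φ.reflectionPerm i i) = φ i) :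
    ∑ i, φ i = 2 • ∑ i ∈ pos, φ i := by
  classical
  rw [two_smul, ← Finset.sum_add_sum_compl pos φ]
  congr 1
  refine Finset.sum_bij' (fun i _ => Φ.reflectionPerm i i) (fun i _ => Φ.reflectionPerm i i)
    ?_ ?_ ?_ ?_ ?_
  · intro i hi
    exact (hξ.neg_mem_iff i).2 (Finset.mem_compl.1 hi)
  · intro i hi
    rw [Finset.mem_compl]
    exact fun h => (hξ.neg_mem_iff i).1 h hi
  · intro i _
    exact Φ.indexNeg.neg_neg i
  · intro i _
    exact Φ.indexNeg.neg_neg i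
  · intro i _
    exact (hφ i).symm

end Cone

section Weyl

variable [NormedAddCommGroup Vd] [InnerProductSpace ℝ Vd] {Φ : RootPairing R ℝ V Vd}
  {pos : Finset R}

/-- Invariance of the inner product under reflections. -/
abbrev InvariantInner (Φ : RootPairing R ℝ V Vd) : Prop :=
  ∀ (i : R) (x y : Vd), inner ℝ (Φ.coreflection i x) (Φ.coreflection i y) = inner ℝ x y

theorem InvariantInner.root'_mul (h : InvariantInner Φ) (i : R) (x : Vd) :
    Φ.root' i x * inner ℝ (Φ.coroot i) (Φ.coroot i) = 2 * inner ℝ (Φ.coroot i) x := by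
  have := h i (Φ.coroot i) x
  rw [RootPairing.coreflection_apply_self, RootPairing.coreflection_apply, inner_neg_left,
    inner_sub_right, inner_smul_right] at this
  linarith

theorem inner_coroot_pos (i : R) : 0 < inner ℝ (Φ.coroot i) (Φ.coroot i) := by
  rw [real_inner_self_eq_norm_sq]
  have h : Φ.coroot i ≠ 0 := by
    intro h
    have := Φ.root_coroot_two i
    rw [h, map_zero] at this
    norm_num at this
  positivity

theorem InvariantInner.pairing_pos (h : InvariantInner Φ) {i j : R} (hij : 0 < Φ.pairing i j) :
    0 < Φ.pairing j i := by
  have h1 := h.root'_mul i (Φ.coroot j)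
  have h2 := h.root'_mul j (Φ.coroot i)
  rw [RootPairing.root'_coroot_eq_pairing] at h1 h2
  rw [real_inner_comm (Φ.coroot i) (Φ.coroot j)] at h2
  have := mul_pos hij (inner_coroot_pos (Φ := Φ) i)
  rw [h1, ← h2] at this
  exact pos_of_mul_pos_left this (inner_coroot_pos j).le

variable [Finite R] [Φ.IsReduced]

/-- Reflections are products of simple reflections, by induction on the value of the root at `ξ`: a
positive root which is not simple pairs positively with some simple coroot, and the corresponding
simple reflection lowers its value while keeping it positive. -/
theorem Defines.coreflection_mem_closure_simple (hin : InvariantInner Φ) {ξ : Vd}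
    (hξ : Defines Φ pos ξ) {j : R} (hj : j ∈ pos) :
    Φ.coreflection j ∈ Subgroup.closure (Φ.coreflection '' {i | IsSimpleRoot Φ pos i}) := by
  have wf : WellFounded (fun a b : R => Φ.root' a ξ < Φ.root' b ξ) :=
    haveI : IsTrans R (fun a b : R => Φ.root' a ξ < Φ.root' b ξ) := ⟨fun _ _ _ => lt_trans⟩
    haveI : Std.Irrefl (fun a b : R => Φ.root' a ξ < Φ.root' b ξ) := ⟨fun _ => lt_irrefl _⟩
    Finite.wellFounded_of_trans_of_irrefl _
  induction j using wf.induction with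
  | _ j ih =>
  by_cases hs : IsSimpleRoot Φ pos j
  · exact Subgroup.subset_closure ⟨j, hs, rfl⟩
  obtain ⟨i, hi, hij⟩ : ∃ i, IsSimpleRoot Φ pos i ∧ 0 < Φ.pairing i j := by
    by_contra! hcon
    have : ∀ x ∈ Submodule.span ℝ≥0 (Φ.root '' {i | IsSimpleRoot Φ pos i}),
        Φ.toLinearMap x (Φ.coroot j) ≤ 0 := by
      intro x hx
      induction hx using Submodule.span_induction with
      | mem x hx =>
        obtain ⟨i, hi, rfl⟩ := hx
        exact hcon i hi
      | zero => simp
      | add x y _ _ hx hy =>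
        rw [map_add, LinearMap.add_apply]; linarith
      | smul t x _ hx =>
        simp only [NNReal.smul_def, map_smul, LinearMap.smul_apply, smul_eq_mul]
        exact mul_nonpos_of_nonneg_of_nonpos t.2 hx
    have h2 := this _ (hξ.root_mem_span_simple hj)
    rw [Φ.root_coroot_two j] at h2
    norm_num at h2
  have hji := hin.pairing_pos hij
  have hne : j ≠ i := fun h => hs (h ▸ hi)
  have hmem := ih (Φ.reflectionPerm i j) (by
    rw [root'_reflectionPerm, RootPairing.coreflection_apply, map_sub, map_smul, smul_eq_mul,
      RootPairing.root'_coroot_eq_pairing]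
    have := mul_pos ((hξ i).2.1 hi.1) hji
    linarith) (hi.reflectionPerm_mem hξ hj hne)
  have hs' : Φ.coreflection i ∈
      Subgroup.closure (Φ.coreflection '' {i | IsSimpleRoot Φ pos i}) :=
    Subgroup.subset_closure ⟨i, hi, rfl⟩
  have := coreflection_reflectionPerm (Φ := Φ) i (Φ.reflectionPerm i j)
  rw [Φ.reflectionPerm_self] at this
  rw [this]
  exact mul_mem (mul_mem hs' hmem) hs'

/-- The Weyl group is generated by the simple reflections. -/
theorem Defines.weyl_induction (hin : InvariantInner Φ) {ξ : Vd} (hξ : Defines Φ pos ξ)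
    {p : weyl Φ → Prop} (one : p 1)
    (mul : ∀ i, IsSimpleRoot Φ pos i → ∀ w, p w → p (refl Φ i * w)) (w : weyl Φ) : p w := by
  have hle : weyl Φ ≤ Subgroup.closure (Φ.coreflection '' {i | IsSimpleRoot Φ pos i}) := by
    rw [Subgroup.closure_le]
    rintro _ ⟨j, rfl⟩
    by_cases hj : j ∈ pos
    · exact hξ.coreflection_mem_closure_simple hin hj
    · have := hξ.coreflection_mem_closure_simple hin ((hξ.neg_mem_iff j).2 hj)
      rwa [coreflection_neg] at this
  have hsub : Subgroup.closure (Φ.coreflection '' {i | IsSimpleRoot Φ pos i}) ≤ weyl Φ :=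
    Subgroup.closure_mono (Set.image_subset_range _ _)
  obtain ⟨w, hw⟩ := w
  have hw' := hle hw
  suffices ∀ w ∈ Subgroup.closure (Φ.coreflection '' {i | IsSimpleRoot Φ pos i}),
      ∀ hw : w ∈ weyl Φ, p ⟨w, hw⟩ from this w hw' hw
  intro w hw
  induction hw using Subgroup.closure_induction_left with
  | one => exact fun _ => one
  | mul_left x hx y hy ih =>
    obtain ⟨i, hi, rfl⟩ := hx
    exact fun _ => mul i hi ⟨y, hsub hy⟩ (ih (hsub hy))
  | inv_mul_cancel x hx y hy ih =>
    obtain ⟨i, hi, rfl⟩ := hx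
    exact fun _ => mul i hi ⟨y, hsub hy⟩ (ih (hsub hy))

end Weyl

end RootCombinatorics

/-! ### The Hecke algebra: conjugation by the Weyl group and the action on the vectors `ω̃` -/

section Equivariance

variable {R V Vd : Type*} [AddCommGroup V] [Module ℝ V] [AddCommGroup Vd] [Module ℝ Vd]
  {Φ : RootPairing R ℝ V Vd} {pos : Finset R} {c : R → ℝ}

theorem rootEval_tmul (i : R) (z : ℂ) (v : Vd) :
    rootEval Φ i (z ⊗ₜ[ℝ] v) = z * (Φ.root' i v : ℂ) := by
  simp [rootEval, mul_comm]

theorem complexify_tmul (g : Vd ≃ₗ[ℝ] Vd) (z : ℂ) (v : Vd) :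
    complexify g (z ⊗ₜ[ℝ] v) = z ⊗ₜ[ℝ] g v := rfl

theorem rootEval_reflectionPerm (i j : R) (ω : ℂ ⊗[ℝ] Vd) :
    rootEval Φ (Φ.reflectionPerm i j) ω = rootEval Φ j (complexify (Φ.coreflection i) ω) := by
  induction ω using TensorProduct.induction_on with
  | zero => simp
  | tmul z v => rw [rootEval_tmul, complexify_tmul, rootEval_tmul, root'_reflectionPerm]
  | add x y hx hy => rw [map_add, hx, hy, map_add, map_add]

theorem complexify_coreflection (i : R) (ω : ℂ ⊗[ℝ] Vd) :
    complexify (Φ.coreflection i) ω = ω - rootEval Φ i ω • ((1 : ℂ) ⊗ₜ[ℝ] Φ.coroot i) := by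
  induction ω using TensorProduct.induction_on with
  | zero => simp
  | tmul z v =>
    rw [rootEval_tmul, complexify_tmul, RootPairing.coreflection_apply, TensorProduct.tmul_sub,
      TensorProduct.tmul_smul, TensorProduct.smul_tmul', TensorProduct.smul_tmul', smul_eq_mul,
      mul_one, Complex.real_smul, mul_comm]
  | add x y hx hy => rw [map_add, hx, hy, map_add]; module

theorem rootEval_complexify_coreflection_self (i : R) (ω : ℂ ⊗[ℝ] Vd) :
    rootEval Φ i (complexify (Φ.coreflection i) ω) = -rootEval Φ i ω := by
  rw [complexify_coreflection, map_sub, map_smul, rootEval_tmul,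
    RootPairing.root'_coroot_eq_pairing, RootPairing.pairing_same]
  push_cast
  rw [smul_eq_mul]
  ring

theorem complexify_coreflection_self (i : R) (ω : ℂ ⊗[ℝ] Vd) :
    complexify (Φ.coreflection i) (complexify (Φ.coreflection i) ω) = ω := by
  rw [← complexify_mul, ← sq, Φ.coreflection_sq, complexify_one]

variable (pos c) in
/-- The linear map `ω ↦ (1/2) ∑_{β > 0} c_β (β, ω) t_{s_β}` into an algebra to which `W` maps. -/
def reflSum {B : Type*} [Ring B] [Algebra ℂ B] (t : weyl Φ →* B) : (ℂ ⊗[ℝ] Vd) →ₗ[ℂ] B :=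
  (1 / 2 : ℂ) • ∑ β ∈ pos, (c β : ℂ) • (rootEval Φ β).smulRight (t (refl Φ β))

theorem reflSum_apply {B : Type*} [Ring B] [Algebra ℂ B] (t : weyl Φ →* B) (ω : ℂ ⊗[ℝ] Vd) :
    reflSum pos c t ω =
      (1 / 2 : ℂ) • ∑ β ∈ pos, ((c β : ℂ) * rootEval Φ β ω) • t (refl Φ β) := by
  simp [reflSum, LinearMap.sum_apply, mul_smul]

/-- The failure of `reflSum` to be equivariant under a simple reflection is exactly the cross
relation, because a simple reflection changes the sign of a single positive root. -/
theorem reflSum_mul_refl [Φ.IsReduced] {ξ : Vd} (hξ : Defines Φ pos ξ)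
    (hc : ∀ i j, c (Φ.reflectionPerm i j) = c j) {B : Type*} [Ring B] [Algebra ℂ B]
    (t : weyl Φ →* B) {i : R} (hi : IsSimpleRoot Φ pos i) (ω : ℂ ⊗[ℝ] Vd) :
    reflSum pos c t ω * t (refl Φ i) =
      t (refl Φ i) * reflSum pos c t (complexify (Φ.coreflection i) ω) +
        algebraMap ℂ B (c i * rootEval Φ i ω) := by
  classical
  have hii : t (refl Φ i) * t (refl Φ i) = 1 := by rw [← map_mul, refl_mul_self, map_one]
  have hperm : ∀ j ∈ pos.erase i, Φ.reflectionPerm i j ∈ pos.erase i := by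
    intro j hj
    rw [Finset.mem_erase] at hj ⊢
    refine ⟨fun h => ?_, hi.reflectionPerm_mem hξ hj.2 hj.1⟩
    have h1 : j = Φ.reflectionPerm i i := by
      have := Φ.reflectionPerm_self i j
      rwa [h, eq_comm] at this
    exact (hξ.neg_mem_iff i).1 (h1 ▸ hj.2) hi.1
  have key : ∑ β ∈ pos.erase i, ((c β : ℂ) * rootEval Φ β ω) • (t (refl Φ β) * t (refl Φ i)) =
      ∑ β ∈ pos.erase i, ((c β : ℂ) * rootEval Φ β (complexify (Φ.coreflection i) ω)) •
        (t (refl Φ i) * t (refl Φ β)) := by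
    refine Finset.sum_bij' (fun j _ => Φ.reflectionPerm i j) (fun j _ => Φ.reflectionPerm i j)
      hperm hperm (fun j _ => Φ.reflectionPerm_self i j) (fun j _ => Φ.reflectionPerm_self i j) ?_
    intro j _
    rw [hc, rootEval_reflectionPerm, complexify_coreflection_self, refl_reflectionPerm, map_mul,
      map_mul, ← mul_assoc, ← mul_assoc, hii, one_mul]
  rw [reflSum_apply, reflSum_apply, smul_mul_assoc, mul_smul_comm, Finset.sum_mul, Finset.mul_sum]
  simp only [smul_mul_assoc, mul_smul_comm]
  rw [← Finset.add_sum_erase _ _ hi.1, ← Finset.add_sum_erase _ _ hi.1, key, hii,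
    rootEval_complexify_coreflection_self, Algebra.algebraMap_eq_smul_one]
  module

theorem tTilde_eq (ω : ℂ ⊗[ℝ] Vd) :
    tTilde Φ pos c ω = tV Φ pos c ω - reflSum pos c (tW Φ pos c) ω := by
  rw [tTilde, reflSum_apply]

variable (Φ pos c) in
/-- The algebra map `f ↦ t_f` on `S(V^∨)`. -/
def tSym : SymmetricAlgebra ℂ (ℂ ⊗[ℝ] Vd) →ₐ[ℂ] Hecke Φ pos c :=
  AlgHom.ofLinearMap
    { toFun := fun f => heckeMk Φ pos c (FreeAlgebra.ι ℂ (Sum.inr f))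
      map_add' := fun f g =>
        (RingQuot.mkAlgHom_rel ℂ (HeckeRel.sym_add (Φ := Φ) (pos := pos) (c := c) f g)).trans
          (map_add _ _ _)
      map_smul' := fun z f => by
        rw [Algebra.smul_def, RingHom.id_apply]
        have h1 : heckeMk Φ pos c (FreeAlgebra.ι ℂ (Sum.inr (algebraMap ℂ _ z * f))) = _ :=
          (RingQuot.mkAlgHom_rel ℂ (HeckeRel.sym_mul (Φ := Φ) (pos := pos) (c := c)
            (algebraMap ℂ _ z) f)).trans (map_mul _ _ _)
        have h2 : heckeMk Φ pos c (FreeAlgebra.ι ℂ (Sum.inr (algebraMap ℂ _ z))) = _ :=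
          (RingQuot.mkAlgHom_rel ℂ (HeckeRel.sym_scalar (Φ := Φ) (pos := pos) (c := c) z)).trans
            (AlgHom.commutes _ _)
        rw [Algebra.smul_def]
        refine h1.trans ?_
        exact congrArg (· * _) h2 }
    (by
      have h2 := (RingQuot.mkAlgHom_rel ℂ
        (HeckeRel.sym_scalar (Φ := Φ) (pos := pos) (c := c) 1)).trans (AlgHom.commutes _ _)
      rw [map_one, map_one] at h2
      exact h2)
    (fun f g =>
        (RingQuot.mkAlgHom_rel ℂ (HeckeRel.sym_mul (Φ := Φ) (pos := pos) (c := c) f g)).trans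
          (map_mul _ _ _))

theorem tSym_ι (ω : ℂ ⊗[ℝ] Vd) :
    tSym Φ pos c (SymmetricAlgebra.ι ℂ _ ω) = tV Φ pos c ω := rfl

theorem tV_add (ω ω' : ℂ ⊗[ℝ] Vd) :
    tV Φ pos c (ω + ω') = tV Φ pos c ω + tV Φ pos c ω' := by
  simp only [← tSym_ι, map_add]

theorem tV_smul (z : ℂ) (ω : ℂ ⊗[ℝ] Vd) : tV Φ pos c (z • ω) = z • tV Φ pos c ω := by
  simp only [← tSym_ι, map_smul]

theorem tV_mul_comm (ω ω' : ℂ ⊗[ℝ] Vd) :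
    tV Φ pos c ω * tV Φ pos c ω' = tV Φ pos c ω' * tV Φ pos c ω := by
  simp only [← tSym_ι, ← map_mul, mul_comm]

theorem tV_mul_refl {i : R} (hi : IsSimpleRoot Φ pos i) (ω : ℂ ⊗[ℝ] Vd) :
    tV Φ pos c ω * tW Φ pos c (refl Φ i) =
      tW Φ pos c (refl Φ i) * tV Φ pos c (complexify (Φ.coreflection i) ω) +
        algebraMap ℂ _ ((c i : ℂ) * rootEval Φ i ω) := by
  have h : heckeMk Φ pos c _ = heckeMk Φ pos c _ :=
    RingQuot.mkAlgHom_rel ℂ (HeckeRel.cross (Φ := Φ) (pos := pos) (c := c) i hi ω)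
  rw [map_sub, map_mul, map_mul, AlgHom.commutes] at h
  exact sub_eq_iff_eq_add'.1 h

/-- `ℍ` is generated by the elements `t_w` and `ω`. -/
theorem Hecke.induction {p : Hecke Φ pos c → Prop} (scalar : ∀ z, p (algebraMap ℂ _ z))
    (weyl : ∀ w, p (tW Φ pos c w)) (vec : ∀ ω, p (tV Φ pos c ω))
    (add : ∀ a b, p a → p b → p (a + b)) (mul : ∀ a b, p a → p b → p (a * b))
    (h : Hecke Φ pos c) : p h := by
  obtain ⟨x, rfl⟩ := RingQuot.mkAlgHom_surjective ℂ (HeckeRel Φ pos c) h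
  induction x using FreeAlgebra.induction with
  | grade0 z =>
    rw [AlgHom.commutes]
    exact scalar z
  | grade1 x =>
    rcases x with w | f
    · exact weyl w
    · change p (tSym Φ pos c f)
      induction f using SymmetricAlgebra.induction with
      | algebraMap z => rw [AlgHom.commutes]; exact scalar z
      | ι ω => exact vec ω
      | mul a b ha hb => rw [map_mul]; exact mul _ _ ha hb
      | add a b ha hb => rw [map_add]; exact add _ _ ha hb
  | mul a b ha hb => rw [map_mul]; exact mul _ _ ha hb
  | add a b ha hb => rw [map_add]; exact add _ _ ha hb

theorem tTilde_add (ω ω' : ℂ ⊗[ℝ] Vd) :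
    tTilde Φ pos c (ω + ω') = tTilde Φ pos c ω + tTilde Φ pos c ω' := by
  simp only [tTilde_eq, tV_add, map_add]; abel

theorem tTilde_smul (z : ℂ) (ω : ℂ ⊗[ℝ] Vd) :
    tTilde Φ pos c (z • ω) = z • tTilde Φ pos c ω := by
  simp only [tTilde_eq, tV_smul, map_smul, smul_sub]

end Equivariance

section WeylEquivariance

variable {R V Vd : Type*} [AddCommGroup V] [Module ℝ V]
  [NormedAddCommGroup Vd] [InnerProductSpace ℝ Vd]
  {Φ : RootPairing R ℝ V Vd} {pos : Finset R} {c : R → ℝ}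

/-- The elements `ω̃` are permuted by conjugation with `W` as the vectors `ω`. -/
theorem tW_mul_tTilde [Finite R] [Φ.IsReduced] (hin : InvariantInner Φ) {ξ : Vd}
    (hξ : Defines Φ pos ξ) (hc : ∀ i j, c (Φ.reflectionPerm i j) = c j) (w : weyl Φ)
    (ω : ℂ ⊗[ℝ] Vd) :
    tW Φ pos c w * tTilde Φ pos c ω =
      tTilde Φ pos c (complexify (w : Vd ≃ₗ[ℝ] Vd) ω) * tW Φ pos c w := by
  induction w using hξ.weyl_induction hin generalizing ω with
  | one => simp [complexify_one]
  | mul i hi w ih =>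
    rw [map_mul, mul_assoc, ih, ← mul_assoc, ← mul_assoc]
    congr 1
    rw [Subgroup.coe_mul, complexify_mul, tTilde_eq, tTilde_eq, mul_sub, sub_mul, tV_mul_refl hi,
      reflSum_mul_refl hξ hc _ hi]
    change _ = tW Φ pos c (refl Φ i) * tV Φ pos c (complexify (Φ.coreflection i)
      (complexify (Φ.coreflection i) _)) + algebraMap ℂ _ (c i * rootEval Φ i _) -
      (tW Φ pos c (refl Φ i) * reflSum pos c _ (complexify (Φ.coreflection i)
      (complexify (Φ.coreflection i) _)) + algebraMap ℂ _ (c i * rootEval Φ i _))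
    rw [complexify_coreflection_self]
    abel

theorem finite_weyl [Finite R] [Φ.IsRootSystem] : Finite (weyl Φ) := by
  have hstab : ∀ w : weyl Φ, ∀ i, ∃ j, (w : Vd ≃ₗ[ℝ] Vd) (Φ.coroot i) = Φ.coroot j := by
    rintro ⟨w, hw⟩
    induction hw using Subgroup.closure_induction with
    | mem x hx =>
      obtain ⟨k, rfl⟩ := hx
      exact fun i => ⟨Φ.reflectionPerm k i, (Φ.coroot_reflectionPerm k i).symm⟩
    | one => exact fun i => ⟨i, rfl⟩
    | mul x y _ _ hx hy =>
      intro i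
      obtain ⟨j, hj⟩ := hy i
      obtain ⟨k, hk⟩ := hx j
      exact ⟨k, (congrArg x hj).trans hk⟩
    | inv x _ hx =>
      choose σ hσ using hx
      have hinj : Function.Injective σ := fun a b h =>
        Φ.coroot.injective (x.injective ((hσ a).trans ((congrArg Φ.coroot h).trans (hσ b).symm)))
      intro i
      obtain ⟨j, hj⟩ := (Finite.injective_iff_surjective.1 hinj) i
      refine ⟨j, ?_⟩
      have := hσ j
      rw [hj] at this
      exact (LinearEquiv.symm_apply_eq x).2 this.symm
  choose σ hσ using hstab
  refine Finite.of_injective σ fun w w' h => Subtype.ext (LinearEquiv.toLinearMap_injective ?_)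
  refine LinearMap.ext_on_range (RootPairing.IsRootSystem.span_coroot_eq_top (P := Φ)) fun i => ?_
  exact (hσ w i).trans ((congrArg (fun f => Φ.coroot (f i)) h).trans (hσ w' i).symm)

end WeylEquivariance

/-! ### The Poincaré–Birkhoff–Witt theorem for the graded affine Hecke algebra -/

section SymmetricLift

variable {M B : Type*} [AddCommGroup M] [Module ℂ M] [Ring B] [Algebra ℂ B]

/-- A linear map with commuting values in a noncommutative algebra extends to the symmetric
algebra. -/
theorem exists_symmetricAlgebra_lift (D : M →ₗ[ℂ] B) (hD : ∀ x y, D x * D y = D y * D x) :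
    ∃ F : SymmetricAlgebra ℂ M →ₐ[ℂ] B, ∀ x, F (SymmetricAlgebra.ι ℂ M x) = D x := by
  have : IsMulCommutative (Algebra.adjoin ℂ (Set.range D)) :=
    Algebra.isMulCommutative_adjoin ℂ (by rintro _ ⟨x, rfl⟩ _ ⟨y, rfl⟩; exact hD x y)
  let : CommRing (Algebra.adjoin ℂ (Set.range D)) :=
    { (inferInstance : Ring (Algebra.adjoin ℂ (Set.range D))) with
      mul_comm := fun a b => this.is_comm.comm a b }
  let D' : M →ₗ[ℂ] Algebra.adjoin ℂ (Set.range D) :=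
    { toFun := fun x => ⟨D x, Algebra.subset_adjoin ⟨x, rfl⟩⟩
      map_add' := fun x y => Subtype.ext (map_add D x y)
      map_smul' := fun z x => Subtype.ext (map_smul D z x) }
  refine ⟨(Algebra.adjoin ℂ (Set.range D)).val.comp (SymmetricAlgebra.lift D'), fun x => ?_⟩
  rw [AlgHom.comp_apply, SymmetricAlgebra.lift_ι_apply]
  rfl

end SymmetricLift

section PBW

variable {R V Vd κ : Type*} [AddCommGroup V] [Module ℝ V]
  [NormedAddCommGroup Vd] [InnerProductSpace ℝ Vd]
  {Φ : RootPairing R ℝ V Vd} {pos : Finset R} {c : R → ℝ}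

/-- Vectors as linear polynomials in the coordinates given by a basis of `V^∨`. -/
def linPoly (e : Module.Basis κ ℂ (ℂ ⊗[ℝ] Vd)) : (ℂ ⊗[ℝ] Vd) →ₗ[ℂ] MvPolynomial κ ℂ :=
  e.constr ℂ MvPolynomial.X

theorem linPoly_basis (e : Module.Basis κ ℂ (ℂ ⊗[ℝ] Vd)) (i : κ) :
    linPoly e (e i) = MvPolynomial.X i := by
  simp [linPoly]

theorem equivMvPolynomial_ι (e : Module.Basis κ ℂ (ℂ ⊗[ℝ] Vd)) (ω : ℂ ⊗[ℝ] Vd) :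
    SymmetricAlgebra.equivMvPolynomial e (SymmetricAlgebra.ι ℂ _ ω) = linPoly e ω := by
  have : (SymmetricAlgebra.equivMvPolynomial e).toLinearMap ∘ₗ SymmetricAlgebra.ι ℂ _ =
      linPoly e := e.ext fun i => by
    rw [linPoly_basis]
    exact SymmetricAlgebra.equivMvPolynomial_ι_apply e i
  exact LinearMap.congr_fun this ω

/-- Left translations on functions on `W`. -/
def translate (Φ : RootPairing R ℝ V Vd) (κ : Type*) :
    weyl Φ →* Module.End ℂ (weyl Φ → MvPolynomial κ ℂ) where
  toFun u := LinearMap.funLeft ℂ _ (fun w => u⁻¹ * w)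
  map_one' := by ext F w : 2; simp [LinearMap.funLeft]
  map_mul' u u' := by
    refine LinearMap.ext fun F => funext fun w => ?_
    simp [LinearMap.funLeft, mul_assoc]

theorem translate_apply (u : weyl Φ) (F : weyl Φ → MvPolynomial κ ℂ) (w : weyl Φ) :
    translate Φ κ u F w = F (u⁻¹ * w) := rfl

variable (c) in
/-- The polynomials in `ℍ`, in the coordinates given by a basis of `V^∨`. -/
def tPoly (Φ : RootPairing R ℝ V Vd) (pos : Finset R) (e : Module.Basis κ ℂ (ℂ ⊗[ℝ] Vd)) :
    MvPolynomial κ ℂ →ₐ[ℂ] Hecke Φ pos c :=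
  (tSym Φ pos c).comp (SymmetricAlgebra.equivMvPolynomial e).symm.toAlgHom

theorem tPoly_linPoly (e : Module.Basis κ ℂ (ℂ ⊗[ℝ] Vd)) (ω : ℂ ⊗[ℝ] Vd) :
    tPoly c Φ pos e (linPoly e ω) = tV Φ pos c ω := by
  rw [tPoly, AlgHom.comp_apply, ← equivMvPolynomial_ι, ← tSym_ι]
  congr 1
  exact AlgEquiv.symm_apply_apply _ _

variable [Fintype R]

/-- The operator by which `ω̃` acts on `W`-indexed families of polynomials: multiplication by
`w⁻¹(ω)` on the component of `w`, plus a combination of translations by reflections. In place of a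
sum over positive roots stands a sum over all roots `β`, weighted by the sign of `β` at `w ξ`, which
makes the operators equivariant under `W`. -/
def tildeOp (Φ : RootPairing R ℝ V Vd) (c : R → ℝ) (ξ : Vd) (e : Module.Basis κ ℂ (ℂ ⊗[ℝ] Vd)) :
    (ℂ ⊗[ℝ] Vd) →ₗ[ℂ] Module.End ℂ (weyl Φ → MvPolynomial κ ℂ) :=
  LinearMap.mk₂ ℂ (fun ω F w =>
    linPoly e (complexify ((w⁻¹ : weyl Φ) : Vd ≃ₗ[ℝ] Vd) ω) * F w +
      (1 / 4 : ℂ) • ∑ β, ((c β : ℂ) * rootEval Φ β ω *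
        ((Φ.root' β ((w : Vd ≃ₗ[ℝ] Vd) ξ)).sign : ℂ)) • F (refl Φ β * w))
    (fun ω ω' F => by
      funext w
      simp only [map_add, Pi.add_apply, add_mul, mul_add, add_smul, Finset.sum_add_distrib,
        smul_add]
      abel)
    (fun z ω F => by
      funext w
      simp only [map_smul, Pi.smul_apply, smul_mul_assoc, smul_add, Finset.smul_sum, smul_smul,
        smul_eq_mul]
      congr 1
      refine Finset.sum_congr rfl fun β _ => ?_
      congr 1
      ring)
    (fun ω F G => by
      funext w
      simp only [Pi.add_apply, mul_add, smul_add, Finset.sum_add_distrib]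
      abel)
    (fun z ω F => by
      funext w
      simp only [Pi.smul_apply, mul_smul_comm, smul_add, Finset.smul_sum, smul_smul]
      congr 1
      refine Finset.sum_congr rfl fun β _ => ?_
      congr 1
      ring)

theorem tildeOp_apply (ξ : Vd) (e : Module.Basis κ ℂ (ℂ ⊗[ℝ] Vd)) (ω : ℂ ⊗[ℝ] Vd)
    (F : weyl Φ → MvPolynomial κ ℂ) (w : weyl Φ) :
    tildeOp Φ c ξ e ω F w = linPoly e (complexify ((w⁻¹ : weyl Φ) : Vd ≃ₗ[ℝ] Vd) ω) * F w +
      (1 / 4 : ℂ) • ∑ β, ((c β : ℂ) * rootEval Φ β ω *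
        ((Φ.root' β ((w : Vd ≃ₗ[ℝ] Vd) ξ)).sign : ℂ)) • F (refl Φ β * w) := rfl

/-- Equivariance of `tildeOp`, the counterpart of `tW_mul_tTilde`. -/
theorem tildeOp_mul_translate (ξ : Vd) (e : Module.Basis κ ℂ (ℂ ⊗[ℝ] Vd))
    (hc : ∀ i j, c (Φ.reflectionPerm i j) = c j) (i : R) (ω : ℂ ⊗[ℝ] Vd) :
    tildeOp Φ c ξ e ω * translate Φ κ (refl Φ i) =
      translate Φ κ (refl Φ i) * tildeOp Φ c ξ e (complexify (Φ.coreflection i) ω) := by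
  refine LinearMap.ext fun F => funext fun w => ?_
  simp only [Module.End.mul_apply, translate_apply, tildeOp_apply, refl_inv]
  congr 2
  · congr 1
    rw [mul_inv_rev, refl_inv, Subgroup.coe_mul, complexify_mul]
    change _ = complexify _ (complexify (Φ.coreflection i) (complexify (Φ.coreflection i) ω))
    rw [complexify_coreflection_self]
  · refine Fintype.sum_equiv (Φ.reflectionPerm i) _ _ fun β => ?_
    have h1 : ((refl Φ i * w : weyl Φ) : Vd ≃ₗ[ℝ] Vd) ξ =
        Φ.coreflection i ((w : Vd ≃ₗ[ℝ] Vd) ξ) := rfl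
    have h2 : refl Φ (Φ.reflectionPerm i β) * (refl Φ i * w) = refl Φ i * (refl Φ β * w) := by
      rw [refl_reflectionPerm, mul_assoc (refl Φ i * refl Φ β), ← mul_assoc (refl Φ i) (refl Φ i),
        refl_mul_self, one_mul, mul_assoc]
    rw [hc, rootEval_reflectionPerm, complexify_coreflection_self, h1, root'_reflectionPerm,
      RootPairing.coreflection_same, h2]

/-- The operator by which `ω` acts on `W`-indexed families of polynomials. -/
def vecOp (Φ : RootPairing R ℝ V Vd) (pos : Finset R) (c : R → ℝ) (ξ : Vd)
    (e : Module.Basis κ ℂ (ℂ ⊗[ℝ] Vd)) :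
    (ℂ ⊗[ℝ] Vd) →ₗ[ℂ] Module.End ℂ (weyl Φ → MvPolynomial κ ℂ) :=
  tildeOp Φ c ξ e + reflSum pos c (translate Φ κ)

theorem vecOp_mul_translate [Φ.IsReduced] {ξ : Vd} (hξ : Defines Φ pos ξ)
    (e : Module.Basis κ ℂ (ℂ ⊗[ℝ] Vd)) (hc : ∀ i j, c (Φ.reflectionPerm i j) = c j) {i : R}
    (hi : IsSimpleRoot Φ pos i) (ω : ℂ ⊗[ℝ] Vd) :
    vecOp Φ pos c ξ e ω * translate Φ κ (refl Φ i) =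
      translate Φ κ (refl Φ i) * vecOp Φ pos c ξ e (complexify (Φ.coreflection i) ω) +
        algebraMap ℂ _ (c i * rootEval Φ i ω) := by
  rw [vecOp, LinearMap.add_apply, LinearMap.add_apply, add_mul, mul_add,
    tildeOp_mul_translate ξ e hc, reflSum_mul_refl hξ hc _ hi, add_assoc]

open Classical in
/-- On families supported at the identity of `W`, vectors act by multiplication: there the signs in
`tildeOp` are such that its combination of reflections cancels against `reflSum`. -/
theorem vecOp_single {ξ : Vd} (hξ : Defines Φ pos ξ) (e : Module.Basis κ ℂ (ℂ ⊗[ℝ] Vd))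
    (hc : ∀ i j, c (Φ.reflectionPerm i j) = c j) (ω : ℂ ⊗[ℝ] Vd) (f : MvPolynomial κ ℂ) :
    vecOp Φ pos c ξ e ω (Pi.single 1 f) = Pi.single 1 (linPoly e ω * f) := by
  funext w
  let F : weyl Φ → MvPolynomial κ ℂ := Pi.single 1 f
  have hF : ∀ u, u ≠ 1 → F u = 0 := fun u hu => Pi.single_eq_of_ne hu _
  have h1 : ∀ β, ((Φ.root' β ((w : Vd ≃ₗ[ℝ] Vd) ξ)).sign : ℂ) • F (refl Φ β * w) =
      -((Φ.root' β ξ).sign : ℂ) • F (refl Φ β * w) := by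
    intro β
    by_cases hβ : refl Φ β * w = 1
    · have hw : w = refl Φ β := by rw [← refl_inv β]; exact (inv_eq_of_mul_eq_one_right hβ).symm
      have h2 : Φ.root' β ((w : Vd ≃ₗ[ℝ] Vd) ξ) = -Φ.root' β ξ := by
        rw [hw]
        exact (root'_reflectionPerm β β ξ).symm.trans (root'_neg β ξ)
      rw [h2, Real.sign_neg, Complex.ofReal_neg]
    · rw [hF _ hβ, smul_zero, smul_zero]
  have h3 : ∑ β, ((c β : ℂ) * rootEval Φ β ω * ((Φ.root' β ((w : Vd ≃ₗ[ℝ] Vd) ξ)).sign : ℂ)) •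
      F (refl Φ β * w) =
      -(2 • ∑ β ∈ pos, ((c β : ℂ) * rootEval Φ β ω) • F (refl Φ β * w)) := by
    have h4 : ∀ β, ((c β : ℂ) * rootEval Φ β ω * ((Φ.root' β ((w : Vd ≃ₗ[ℝ] Vd) ξ)).sign : ℂ)) •
        F (refl Φ β * w) =
        -(((c β : ℂ) * rootEval Φ β ω * ((Φ.root' β ξ).sign : ℂ)) • F (refl Φ β * w)) := by
      intro β
      rw [mul_smul, h1, smul_smul, ← neg_smul]
      congr 1
      ring
    simp only [h4]
    rw [Finset.sum_neg_distrib, hξ.sum_eq_two_smul]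
    · congr 2
      refine Finset.sum_congr rfl fun β hβ => ?_
      rw [Real.sign_of_pos ((hξ β).2.1 hβ), Complex.ofReal_one, mul_one]
    · intro β
      rw [hc, rootEval_reflectionPerm, rootEval_complexify_coreflection_self, root'_neg,
        Real.sign_neg, Complex.ofReal_neg, refl_neg, mul_neg, mul_neg, neg_mul, neg_neg]
  rw [vecOp, LinearMap.add_apply, LinearMap.add_apply, Pi.add_apply, tildeOp_apply, h3,
    reflSum_apply, LinearMap.smul_apply, LinearMap.sum_apply, Pi.smul_apply, Finset.sum_apply]
  simp only [LinearMap.smul_apply, Pi.smul_apply, translate_apply, refl_inv]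
  have h5 : linPoly e (complexify ((w⁻¹ : weyl Φ) : Vd ≃ₗ[ℝ] Vd) ω) * F w =
      (Pi.single 1 (linPoly e ω * f) : weyl Φ → MvPolynomial κ ℂ) w := by
    by_cases hw : w = 1
    · subst hw
      simp [F, complexify_one]
    · rw [hF w hw, Pi.single_eq_of_ne hw, mul_zero]
  rw [h5]
  module

variable [Φ.IsReduced]

/-- The operators `vecOp` commute: the cross relation shows that their commutators commute with
translations up to a twist, and the commutators vanish on families supported at the identity. -/
theorem vecOp_mul_comm [Φ.IsRootSystem] (hin : InvariantInner Φ) {ξ : Vd}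
    (hξ : Defines Φ pos ξ)
    (e : Module.Basis κ ℂ (ℂ ⊗[ℝ] Vd)) (hc : ∀ i j, c (Φ.reflectionPerm i j) = c j)
    (ω ω' : ℂ ⊗[ℝ] Vd) :
    vecOp Φ pos c ξ e ω * vecOp Φ pos c ξ e ω' = vecOp Φ pos c ξ e ω' * vecOp Φ pos c ξ e ω := by
  classical
  have := finite_weyl (Φ := Φ)
  have := Fintype.ofFinite (weyl Φ)
  set D := vecOp Φ pos c ξ e with hD
  have hstep : ∀ (i : R) (_ : IsSimpleRoot Φ pos i) (ω ω' : ℂ ⊗[ℝ] Vd),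
      (D ω * D ω' - D ω' * D ω) * translate Φ κ (refl Φ i) = translate Φ κ (refl Φ i) *
        (D (complexify (Φ.coreflection i) ω) * D (complexify (Φ.coreflection i) ω') -
          D (complexify (Φ.coreflection i) ω') * D (complexify (Φ.coreflection i) ω)) := by
    intro i hi ω ω'
    have h := vecOp_mul_translate hξ e hc hi ω
    have h' := vecOp_mul_translate hξ e hc hi ω'
    rw [← hD] at h h'
    have hs : D (complexify (Φ.coreflection i) ω) =
        D ω - rootEval Φ i ω • D ((1 : ℂ) ⊗ₜ[ℝ] Φ.coroot i) := by
      rw [complexify_coreflection, map_sub, map_smul]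
    have hs' : D (complexify (Φ.coreflection i) ω') =
        D ω' - rootEval Φ i ω' • D ((1 : ℂ) ⊗ₜ[ℝ] Φ.coroot i) := by
      rw [complexify_coreflection, map_sub, map_smul]
    rw [sub_mul, mul_assoc, h', mul_assoc, h, mul_add, mul_add, ← mul_assoc, ← mul_assoc, h, h']
    simp only [Algebra.algebraMap_eq_smul_one, add_mul, mul_smul_comm, smul_mul_assoc, mul_one,
      one_mul, mul_sub, mul_assoc]
    have e1 : (c i * rootEval Φ i ω) • D (complexify (Φ.coreflection i) ω') +
        (c i * rootEval Φ i ω') • D ω - ((c i * rootEval Φ i ω') •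
          D (complexify (Φ.coreflection i) ω) + (c i * rootEval Φ i ω) • D ω') = 0 := by
      rw [hs, hs']
      module
    rw [← sub_eq_zero, ← e1]
    abel
  have hzero : ∀ (w : weyl Φ) (ω ω' : ℂ ⊗[ℝ] Vd) (f : MvPolynomial κ ℂ),
      (D ω * D ω' - D ω' * D ω) (translate Φ κ w (Pi.single 1 f)) = 0 := by
    intro w
    induction w using hξ.weyl_induction hin with
    | one =>
      intro ω ω' f
      rw [map_one, Module.End.one_apply, LinearMap.sub_apply, Module.End.mul_apply,
        Module.End.mul_apply, hD, vecOp_single hξ e hc, vecOp_single hξ e hc, vecOp_single hξ e hc,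
        vecOp_single hξ e hc, sub_eq_zero, mul_left_comm]
    | mul i hi w ih =>
      intro ω ω' f
      rw [map_mul, Module.End.mul_apply, ← Module.End.mul_apply, hstep i hi, Module.End.mul_apply,
        ih, map_zero]
  rw [← sub_eq_zero]
  refine LinearMap.pi_ext fun w f => ?_
  have : (Pi.single w f : weyl Φ → MvPolynomial κ ℂ) = translate Φ κ w (Pi.single 1 f) := by
    funext u
    rw [translate_apply]
    by_cases hu : u = w
    · subst hu
      simp
    · rw [Pi.single_eq_of_ne hu, Pi.single_eq_of_ne]
      rwa [ne_eq, inv_mul_eq_one, eq_comm]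
  rw [this, hzero, LinearMap.zero_apply]

open Classical in
/-- The Poincaré-Birkhoff-Witt theorem for `ℍ` (linear independence): the elements `t_w f`, for
`w ∈ W` and `f` in `S(V^∨)`, have well-defined coordinates. -/
theorem exists_pbw_coordinates [Φ.IsRootSystem] (hin : InvariantInner Φ) {ξ : Vd}
    (hξ : Defines Φ pos ξ)
    (e : Module.Basis κ ℂ (ℂ ⊗[ℝ] Vd)) (hc : ∀ i j, c (Φ.reflectionPerm i j) = c j) :
    ∃ ψ : Hecke Φ pos c →ₗ[ℂ] weyl Φ → MvPolynomial κ ℂ, ∀ w f,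
      ψ (tW Φ pos c w * tPoly c Φ pos e f) = Pi.single w f := by
  obtain ⟨S, hS⟩ := exists_symmetricAlgebra_lift (vecOp Φ pos c ξ e)
    (vecOp_mul_comm hin hξ e hc)
  let gen : weyl Φ ⊕ SymmetricAlgebra ℂ (ℂ ⊗[ℝ] Vd) →
      Module.End ℂ (weyl Φ → MvPolynomial κ ℂ) := Sum.elim (translate Φ κ) S
  have hrel : ∀ ⦃x y⦄, HeckeRel Φ pos c x y →
      FreeAlgebra.lift ℂ gen x = FreeAlgebra.lift ℂ gen y := by
    intro x y h
    induction h with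
    | group_one => simp [gen]
    | group_mul w w' => simp [gen]
    | sym_scalar z => simp [gen]
    | sym_add f g => simp [gen]
    | sym_mul f g => simp [gen]
    | cross i hi ω =>
      simp only [map_sub, map_mul, FreeAlgebra.lift_ι_apply, gen, Sum.elim_inl, Sum.elim_inr, hS,
        AlgHom.commutes]
      rw [vecOp_mul_translate hξ e hc hi]
      simp
  let rep : Hecke Φ pos c →ₐ[ℂ] Module.End ℂ (weyl Φ → MvPolynomial κ ℂ) :=
    RingQuot.liftAlgHom ℂ ⟨FreeAlgebra.lift ℂ gen, hrel⟩
  have hrep : ∀ x, rep (heckeMk Φ pos c x) = FreeAlgebra.lift ℂ gen x := fun x =>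
    RingQuot.liftAlgHom_mkAlgHom_apply ℂ _ hrel x
  have hrepW : ∀ w, rep (tW Φ pos c w) = translate Φ κ w := fun w =>
    (hrep _).trans (by simp [gen])
  have hrepS : ∀ f, rep (tSym Φ pos c f) = S f := fun f => (hrep _).trans (by simp [gen])
  have hsym : ∀ f g, S f (Pi.single 1 g) =
      Pi.single 1 (SymmetricAlgebra.equivMvPolynomial e f * g) := by
    intro f
    induction f using SymmetricAlgebra.induction with
    | algebraMap z =>
      intro g
      rw [AlgHom.commutes, AlgEquiv.commutes, Module.algebraMap_end_apply, ← Pi.single_smul,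
        Algebra.smul_def]
    | ι ω =>
      intro g
      rw [hS, vecOp_single hξ e hc, equivMvPolynomial_ι]
    | mul a b ha hb =>
      intro g
      rw [map_mul, Module.End.mul_apply, hb, ha, map_mul, mul_assoc]
    | add a b ha hb =>
      intro g
      rw [map_add, LinearMap.add_apply, hb, ha, map_add, add_mul, Pi.single_add]
  refine ⟨LinearMap.applyₗ (Pi.single 1 1) ∘ₗ rep.toLinearMap, fun w f => ?_⟩
  change rep _ (Pi.single 1 1) = _
  rw [map_mul, hrepW, tPoly, AlgHom.comp_apply, hrepS, Module.End.mul_apply, hsym]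
  funext u
  rw [translate_apply, mul_one]
  have : (SymmetricAlgebra.equivMvPolynomial e)
      ((SymmetricAlgebra.equivMvPolynomial e).symm.toAlgHom f) = f :=
    AlgEquiv.apply_symm_apply _ _
  rw [this]
  by_cases hu : u = w
  · subst hu
    simp
  · rw [Pi.single_eq_of_ne hu, Pi.single_eq_of_ne]
    rwa [ne_eq, inv_mul_eq_one, eq_comm]

end PBW

/-! ### Degree filtrations -/

section PolynomialFiltration

variable {κ : Type*}

/-- The polynomials of degree `< n`. -/
def polyLT (κ : Type*) (n : ℕ) : Submodule ℂ (MvPolynomial κ ℂ) :=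
  MvPolynomial.restrictSupport ℂ {m | m.degree < n}

theorem polyLT_eq_span (n : ℕ) : polyLT κ n =
    Submodule.span ℂ ((MvPolynomial.monomial · 1) '' {m : κ →₀ ℕ | m.degree < n}) :=
  MvPolynomial.restrictSupport_eq_span _ _

theorem monomial_mem_polyLT {m : κ →₀ ℕ} {n : ℕ} (h : m.degree < n) (z : ℂ) :
    MvPolynomial.monomial m z ∈ polyLT κ n :=
  (MvPolynomial.monomial_mem_restrictSupport _).2 (Or.inl h)

theorem polyLT_mono {m n : ℕ} (h : m ≤ n) : polyLT κ m ≤ polyLT κ n :=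
  MvPolynomial.restrictSupport_mono _ fun _ hx => lt_of_lt_of_le hx h

theorem polyLT_zero : polyLT κ 0 = ⊥ := by
  rw [polyLT_eq_span]
  simp

theorem C_mem_polyLT_one (z : ℂ) : MvPolynomial.C z ∈ polyLT κ 1 :=
  monomial_mem_polyLT (by simp) z

theorem exists_eq_C_of_mem_polyLT_one {f : MvPolynomial κ ℂ} (hf : f ∈ polyLT κ 1) :
    ∃ z, f = MvPolynomial.C z := by
  rw [polyLT_eq_span] at hf
  induction hf using Submodule.span_induction with
  | mem x hx =>
    obtain ⟨m, hm, rfl⟩ := hx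
    have : m = 0 := (Finsupp.degree_eq_zero_iff m).1 (Nat.lt_one_iff.1 hm)
    exact ⟨1, by rw [this]; rfl⟩
  | zero => exact ⟨0, by simp⟩
  | add x y _ _ hx hy =>
    obtain ⟨a, rfl⟩ := hx
    obtain ⟨b, rfl⟩ := hy
    exact ⟨a + b, by simp⟩
  | smul t x _ hx =>
    obtain ⟨a, rfl⟩ := hx
    exact ⟨t * a, by simp [MvPolynomial.smul_eq_C_mul]⟩

/-- Partial derivatives as linear maps. -/
def partialDeriv (i : κ) : MvPolynomial κ ℂ →ₗ[ℂ] MvPolynomial κ ℂ :=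
  (MvPolynomial.pderiv (R := ℂ) i).toLinearMap

theorem partialDeriv_apply (i : κ) (f : MvPolynomial κ ℂ) :
    partialDeriv i f = MvPolynomial.pderiv i f := rfl

theorem X_mul_mem_polyLT {n : ℕ} (i : κ) {f : MvPolynomial κ ℂ} (hf : f ∈ polyLT κ n) :
    MvPolynomial.X i * f ∈ polyLT κ (n + 1) := by
  suffices polyLT κ n ≤ (polyLT κ (n + 1)).comap (LinearMap.mulLeft ℂ (MvPolynomial.X i)) from
    this hf
  rw [polyLT_eq_span, Submodule.span_le]
  rintro _ ⟨m, hm, rfl⟩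
  change MvPolynomial.X i * MvPolynomial.monomial m 1 ∈ polyLT κ (n + 1)
  rw [MvPolynomial.X, MvPolynomial.monomial_mul]
  refine monomial_mem_polyLT ?_ _
  have : m.degree < n := hm
  rw [map_add, Finsupp.degree_single]
  omega

theorem pderiv_mem_polyLT {n : ℕ} (i : κ) {f : MvPolynomial κ ℂ} (hf : f ∈ polyLT κ (n + 1)) :
    partialDeriv i f ∈ polyLT κ n := by
  suffices polyLT κ (n + 1) ≤ (polyLT κ n).comap (partialDeriv i) from
    this hf
  rw [polyLT_eq_span, Submodule.span_le]
  rintro _ ⟨m, hm, rfl⟩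
  change MvPolynomial.pderiv i (MvPolynomial.monomial m 1) ∈ polyLT κ n
  rw [MvPolynomial.pderiv_monomial]
  by_cases hmi : m i = 0
  · simp [hmi]
  · refine monomial_mem_polyLT ?_ _
    have hle : Finsupp.single i 1 ≤ m := by
      rw [Finsupp.single_le_iff]; omega
    have h2 : (m - Finsupp.single i 1).degree + 1 = m.degree := by
      conv_rhs => rw [← tsub_add_cancel_of_le hle, map_add, Finsupp.degree_single]
    have : m.degree < n + 1 := hm
    omega

/-- Euler's formula: on polynomials of degree at most `n`, the Euler operator is multiplication by
`n` up to terms of lower degree. -/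
theorem euler_sub_mem_polyLT [Fintype κ] {n : ℕ} {f : MvPolynomial κ ℂ}
    (hf : f ∈ polyLT κ (n + 1)) :
    ∑ i, MvPolynomial.X i * partialDeriv i f - (n : ℂ) • f ∈ polyLT κ n := by
  let E : MvPolynomial κ ℂ →ₗ[ℂ] MvPolynomial κ ℂ :=
    ∑ i, LinearMap.mulLeft ℂ (MvPolynomial.X i) ∘ₗ (partialDeriv i) -
      (n : ℂ) • LinearMap.id
  suffices polyLT κ (n + 1) ≤ (polyLT κ n).comap E by
    have := this hf
    simpa [E] using this
  rw [polyLT_eq_span, Submodule.span_le]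
  rintro _ ⟨m, hm, rfl⟩
  have hE : E (MvPolynomial.monomial m 1) =
      ((m.degree : ℂ) - n) • MvPolynomial.monomial m 1 := by
    have h1 : ∀ i, MvPolynomial.X i * partialDeriv i (MvPolynomial.monomial m (1 : ℂ)) =
        (m i : ℂ) • MvPolynomial.monomial m 1 := by
      intro i
      rw [partialDeriv_apply, MvPolynomial.pderiv_monomial, MvPolynomial.X,
        MvPolynomial.monomial_mul, MvPolynomial.smul_monomial]
      by_cases hmi : m i = 0
      · simp [hmi]
      · have hle : Finsupp.single i 1 ≤ m := by
          rw [Finsupp.single_le_iff]; omega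
        rw [add_tsub_cancel_of_le hle]
        simp
    simp only [E, LinearMap.sub_apply, LinearMap.sum_apply, LinearMap.comp_apply,
      LinearMap.mulLeft_apply, LinearMap.smul_apply, LinearMap.id_apply, h1]
    rw [← Finset.sum_smul, sub_smul, Finsupp.degree_eq_sum]
    push_cast
    rfl
  change E _ ∈ polyLT κ n
  rw [hE]
  have : m.degree < n + 1 := hm
  rcases Nat.lt_succ_iff_lt_or_eq.1 this with h | h
  · exact Submodule.smul_mem _ _ (monomial_mem_polyLT h 1)
  · rw [h, sub_self, zero_smul]
    exact zero_mem _

end PolynomialFiltration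

section HeckeFiltration

variable {R V Vd κ : Type*} [AddCommGroup V] [Module ℝ V]
  [NormedAddCommGroup Vd] [InnerProductSpace ℝ Vd]
  {Φ : RootPairing R ℝ V Vd} {pos : Finset R} {c : R → ℝ}
  {e : Module.Basis κ ℂ (ℂ ⊗[ℝ] Vd)}

variable (Φ pos c e) in
/-- The span of the elements `t_w f` with `f` of degree `< n`. -/
def heckeLT (n : ℕ) : Submodule ℂ (Hecke Φ pos c) :=
  Submodule.span ℂ {h | ∃ w, ∃ f ∈ polyLT κ n, h = tW Φ pos c w * tPoly c Φ pos e f}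

theorem mul_mem_heckeLT {n : ℕ} (w : weyl Φ) {f : MvPolynomial κ ℂ} (hf : f ∈ polyLT κ n) :
    tW Φ pos c w * tPoly c Φ pos e f ∈ heckeLT Φ pos c e n :=
  Submodule.subset_span ⟨w, f, hf, rfl⟩

theorem heckeLT_mono {m n : ℕ} (h : m ≤ n) : heckeLT Φ pos c e m ≤ heckeLT Φ pos c e n :=
  Submodule.span_mono fun _ ⟨w, f, hf, hx⟩ => ⟨w, f, polyLT_mono h hf, hx⟩

theorem tW_mem_heckeLT_one (w : weyl Φ) : tW Φ pos c w ∈ heckeLT Φ pos c e 1 := by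
  have := mul_mem_heckeLT (pos := pos) (c := c) (e := e) w (C_mem_polyLT_one (κ := κ) 1)
  rwa [map_one, map_one, mul_one] at this

theorem tW_mul_mem_heckeLT {n : ℕ} (u : weyl Φ) {h : Hecke Φ pos c}
    (hh : h ∈ heckeLT Φ pos c e n) : tW Φ pos c u * h ∈ heckeLT Φ pos c e n := by
  suffices heckeLT Φ pos c e n ≤
      (heckeLT Φ pos c e n).comap (LinearMap.mulLeft ℂ (tW Φ pos c u)) from this hh
  rw [heckeLT, Submodule.span_le]
  rintro _ ⟨w, f, hf, rfl⟩
  change tW Φ pos c u * (tW Φ pos c w * tPoly c Φ pos e f) ∈ heckeLT Φ pos c e n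
  rw [← mul_assoc, ← map_mul]
  exact mul_mem_heckeLT _ hf

theorem reflSum_mul_mem_heckeLT {n : ℕ} (ω : ℂ ⊗[ℝ] Vd) {h : Hecke Φ pos c}
    (hh : h ∈ heckeLT Φ pos c e n) :
    reflSum pos c (tW Φ pos c) ω * h ∈ heckeLT Φ pos c e n := by
  rw [reflSum_apply, smul_mul_assoc, Finset.sum_mul]
  refine Submodule.smul_mem _ _ (Submodule.sum_mem _ fun β _ => ?_)
  rw [smul_mul_assoc]
  exact Submodule.smul_mem _ _ (tW_mul_mem_heckeLT _ hh)

theorem linPoly_mul_mem_polyLT {n : ℕ} (ω : ℂ ⊗[ℝ] Vd) {f : MvPolynomial κ ℂ}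
    (hf : f ∈ polyLT κ n) : linPoly e ω * f ∈ polyLT κ (n + 1) := by
  have hω : ω ∈ Submodule.span ℂ (Set.range e) := by rw [e.span_eq]; trivial
  induction hω using Submodule.span_induction with
  | mem x hx =>
    obtain ⟨i, rfl⟩ := hx
    rw [linPoly_basis]
    exact X_mul_mem_polyLT i hf
  | zero => simp
  | add x y _ _ hx hy => rw [map_add, add_mul]; exact Submodule.add_mem _ hx hy
  | smul z x _ hx => rw [map_smul, smul_mul_assoc]; exact Submodule.smul_mem _ _ hx

variable [Finite R] [Φ.IsReduced]

theorem tV_mul_mem_heckeLT (hin : InvariantInner Φ) {ξ : Vd}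
    (hξ : Defines Φ pos ξ) (hc : ∀ i j, c (Φ.reflectionPerm i j) = c j) {n : ℕ}
    (ω : ℂ ⊗[ℝ] Vd) {h : Hecke Φ pos c} (hh : h ∈ heckeLT Φ pos c e n) :
    tV Φ pos c ω * h ∈ heckeLT Φ pos c e (n + 1) := by
  suffices heckeLT Φ pos c e n ≤
      (heckeLT Φ pos c e (n + 1)).comap (LinearMap.mulLeft ℂ (tV Φ pos c ω)) from this hh
  rw [heckeLT, Submodule.span_le]
  rintro _ ⟨w, f, hf, rfl⟩
  change tV Φ pos c ω * (tW Φ pos c w * tPoly c Φ pos e f) ∈ heckeLT Φ pos c e (n + 1)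
  set ω' := complexify ((w⁻¹ : weyl Φ) : Vd ≃ₗ[ℝ] Vd) ω with hω'
  have hω : complexify (w : Vd ≃ₗ[ℝ] Vd) ω' = ω := by
    rw [hω', ← complexify_mul, ← Subgroup.coe_mul, mul_inv_cancel]
    exact complexify_one _
  have h1 := tW_mul_tTilde hin hξ hc w ω'
  rw [hω, tTilde_eq, tTilde_eq, mul_sub, sub_mul] at h1
  have h2 : tV Φ pos c ω * tW Φ pos c w = tW Φ pos c w * tV Φ pos c ω' -
      tW Φ pos c w * reflSum pos c (tW Φ pos c) ω' +
      reflSum pos c (tW Φ pos c) ω * tW Φ pos c w := by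
    rw [h1]; abel
  have hf' : tPoly c Φ pos e f ∈ heckeLT Φ pos c e n := by
    have := mul_mem_heckeLT (pos := pos) (c := c) (e := e) (1 : weyl Φ) hf
    rwa [map_one, one_mul] at this
  rw [← mul_assoc, h2, add_mul, sub_mul, mul_assoc, ← tPoly_linPoly e, ← map_mul, mul_assoc,
    mul_assoc]
  refine Submodule.add_mem _ (Submodule.sub_mem _ ?_ ?_) ?_
  · exact mul_mem_heckeLT w (linPoly_mul_mem_polyLT ω' hf)
  · exact heckeLT_mono n.le_succ (tW_mul_mem_heckeLT _ (reflSum_mul_mem_heckeLT _ hf'))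
  · exact heckeLT_mono n.le_succ (reflSum_mul_mem_heckeLT _ (tW_mul_mem_heckeLT _ hf'))

theorem tPoly_mul_tW_mem_heckeLT (hin : InvariantInner Φ) {ξ : Vd}
    (hξ : Defines Φ pos ξ) (hc : ∀ i j, c (Φ.reflectionPerm i j) = c j) {n : ℕ}
    {f : MvPolynomial κ ℂ} (hf : f ∈ polyLT κ n) (u : weyl Φ) :
    tPoly c Φ pos e f * tW Φ pos c u ∈ heckeLT Φ pos c e n := by
  have hmon : ∀ (k : ℕ) (m : κ →₀ ℕ), m.degree = k →
      tPoly c Φ pos e (MvPolynomial.monomial m 1) * tW Φ pos c u ∈ heckeLT Φ pos c e (k + 1) := by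
    intro k
    induction k with
    | zero =>
      intro m hm
      rw [(Finsupp.degree_eq_zero_iff m).1 hm]
      change tPoly c Φ pos e 1 * _ ∈ _
      rw [map_one, one_mul]
      exact tW_mem_heckeLT_one u
    | succ k ih =>
      intro m hm
      have hm0 : m ≠ 0 := by rintro rfl; simp at hm
      obtain ⟨i, hi⟩ := Finsupp.ne_iff.1 hm0
      have hle : Finsupp.single i 1 ≤ m := by
        rw [Finsupp.single_le_iff]; exact Nat.one_le_iff_ne_zero.2 hi
      have h2 : (m - Finsupp.single i 1).degree + 1 = m.degree := by
        conv_rhs => rw [← tsub_add_cancel_of_le hle, map_add, Finsupp.degree_single]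
      have h3 : MvPolynomial.monomial m (1 : ℂ) =
          linPoly e (e i) * MvPolynomial.monomial (m - Finsupp.single i 1) 1 := by
        rw [linPoly_basis, MvPolynomial.X, MvPolynomial.monomial_mul, add_tsub_cancel_of_le hle,
          one_mul]
      rw [h3, map_mul, tPoly_linPoly, mul_assoc]
      exact tV_mul_mem_heckeLT hin hξ hc _ (ih _ (by omega))
  suffices polyLT κ n ≤ (heckeLT Φ pos c e n).comap
      (LinearMap.mulRight ℂ (tW Φ pos c u) ∘ₗ (tPoly c Φ pos e).toLinearMap) from this hf
  rw [polyLT_eq_span, Submodule.span_le]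
  rintro _ ⟨m, hm, rfl⟩
  exact heckeLT_mono (Nat.succ_le_of_lt hm) (hmon _ m rfl)

/-- The filtration is stable under right multiplication by the elements of `W`. -/
theorem mul_tW_mem_heckeLT (hin : InvariantInner Φ) {ξ : Vd}
    (hξ : Defines Φ pos ξ) (hc : ∀ i j, c (Φ.reflectionPerm i j) = c j) {n : ℕ}
    {h : Hecke Φ pos c} (hh : h ∈ heckeLT Φ pos c e n) (u : weyl Φ) :
    h * tW Φ pos c u ∈ heckeLT Φ pos c e n := by
  suffices heckeLT Φ pos c e n ≤
      (heckeLT Φ pos c e n).comap (LinearMap.mulRight ℂ (tW Φ pos c u)) from this hh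
  rw [heckeLT, Submodule.span_le]
  rintro _ ⟨w, f, hf, rfl⟩
  change tW Φ pos c w * tPoly c Φ pos e f * tW Φ pos c u ∈ heckeLT Φ pos c e n
  rw [mul_assoc]
  exact tW_mul_mem_heckeLT _ (tPoly_mul_tW_mem_heckeLT hin hξ hc hf u)

/-- The elements `t_w f` span `ℍ`. -/
theorem exists_mem_heckeLT (hin : InvariantInner Φ) {ξ : Vd}
    (hξ : Defines Φ pos ξ) (hc : ∀ i j, c (Φ.reflectionPerm i j) = c j)
    (e : Module.Basis κ ℂ (ℂ ⊗[ℝ] Vd)) (h : Hecke Φ pos c) :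
    ∃ n, h ∈ heckeLT Φ pos c e n := by
  suffices ∀ (x : Hecke Φ pos c) n, x ∈ heckeLT Φ pos c e n →
      ∃ m, h * x ∈ heckeLT Φ pos c e m by
    obtain ⟨m, hm⟩ := this (tW Φ pos c 1) 1 (tW_mem_heckeLT_one 1)
    rw [map_one, mul_one] at hm
    exact ⟨m, hm⟩
  induction h using Hecke.induction with
  | scalar z =>
    intro x n hx
    rw [← Algebra.smul_def]
    exact ⟨n, Submodule.smul_mem _ _ hx⟩
  | weyl w => exact fun x n hx => ⟨n, tW_mul_mem_heckeLT w hx⟩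
  | vec ω => exact fun x n hx => ⟨n + 1, tV_mul_mem_heckeLT hin hξ hc ω hx⟩
  | add a b ha hb =>
    intro x n hx
    obtain ⟨m, hm⟩ := ha x n hx
    obtain ⟨m', hm'⟩ := hb x n hx
    rw [add_mul]
    exact ⟨max m m', Submodule.add_mem _ (heckeLT_mono (le_max_left _ _) hm)
      (heckeLT_mono (le_max_right _ _) hm')⟩
  | mul a b ha hb =>
    intro x n hx
    obtain ⟨m, hm⟩ := hb x n hx
    rw [mul_assoc]
    exact ha _ m hm

end HeckeFiltration

/-! ### Contractions and the number operator on the Clifford algebra -/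

section CliffordContraction

variable {Vd κ : Type*} [NormedAddCommGroup Vd] [InnerProductSpace ℝ Vd]

theorem form_tmul (z z' : ℂ) (v v' : Vd) :
    form Vd (z ⊗ₜ[ℝ] v) (z' ⊗ₜ[ℝ] v') = z * z' * (inner ℝ v v' : ℝ) := by
  simp [form, mul_comm]

theorem form_comm (v w : ℂ ⊗[ℝ] Vd) : form Vd v w = form Vd w v := by
  induction v using TensorProduct.induction_on with
  | zero => simp
  | add x y hx hy => rw [map_add, LinearMap.add_apply, hx, hy, map_add]
  | tmul z v =>
    induction w using TensorProduct.induction_on with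
    | zero => simp
    | add x y hx hy => rw [map_add, hx, hy, map_add, LinearMap.add_apply]
    | tmul z' v' => rw [form_tmul, form_tmul, real_inner_comm, mul_comm z]

theorem ι_mul_ι_add (v w : ℂ ⊗[ℝ] Vd) :
    CliffordAlgebra.ι (negQ Vd) v * CliffordAlgebra.ι (negQ Vd) w +
      CliffordAlgebra.ι (negQ Vd) w * CliffordAlgebra.ι (negQ Vd) v =
      algebraMap ℂ _ (-2 * form Vd v w) := by
  rw [CliffordAlgebra.ι_mul_ι_add_swap]
  congr 1
  simp only [QuadraticMap.polar, negQ, neg_apply,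
    LinearMap.BilinMap.toQuadraticMap_apply, map_add, LinearMap.add_apply]
  rw [form_comm w v]
  ring

/-- The supercommutator with a vector is a contraction. -/
theorem ι_mul_sub_involute_mul (v : ℂ ⊗[ℝ] Vd) (x : Cl Vd) :
    CliffordAlgebra.ι (negQ Vd) v * x - CliffordAlgebra.involute x * CliffordAlgebra.ι (negQ Vd) v =
      (-2 : ℂ) • CliffordAlgebra.contractLeft (form Vd v) x := by
  induction x using CliffordAlgebra.left_induction with
  | algebraMap r =>
    rw [AlgHom.commutes, CliffordAlgebra.contractLeft_algebraMap, smul_zero, sub_eq_zero,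
      Algebra.commutes]
  | add x y hx hy =>
    rw [mul_add, map_add, add_mul, map_add, smul_add, ← hx, ← hy]
    abel
  | ι_mul x m hx =>
    rw [CliffordAlgebra.contractLeft_ι_mul, map_mul, CliffordAlgebra.involute_ι, smul_sub,
      ← mul_smul_comm, ← hx, smul_smul, Algebra.smul_def, ← ι_mul_ι_add]
    noncomm_ring

/-- The filtration of the Clifford algebra: `clLT n` is spanned by the products of fewer than `n`
vectors. -/
def clLT (Vd : Type*) [NormedAddCommGroup Vd] [InnerProductSpace ℝ Vd] (n : ℕ) :
    Submodule ℂ (Cl Vd) :=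
  Submodule.span ℂ {x | ∃ l : List (ℂ ⊗[ℝ] Vd), l.length < n ∧
    x = (l.map (CliffordAlgebra.ι (negQ Vd))).prod}

theorem prod_mem_clLT {n : ℕ} {l : List (ℂ ⊗[ℝ] Vd)} (h : l.length < n) :
    (l.map (CliffordAlgebra.ι (negQ Vd))).prod ∈ clLT Vd n :=
  Submodule.subset_span ⟨l, h, rfl⟩

theorem clLT_mono {m n : ℕ} (h : m ≤ n) : clLT Vd m ≤ clLT Vd n :=
  Submodule.span_mono fun _ ⟨l, hl, hx⟩ => ⟨l, hl.trans_le h, hx⟩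

theorem ι_mul_mem_clLT {n : ℕ} (v : ℂ ⊗[ℝ] Vd) {x : Cl Vd} (hx : x ∈ clLT Vd n) :
    CliffordAlgebra.ι (negQ Vd) v * x ∈ clLT Vd (n + 1) := by
  suffices clLT Vd n ≤ (clLT Vd (n + 1)).comap
      (LinearMap.mulLeft ℂ (CliffordAlgebra.ι (negQ Vd) v)) from this hx
  rw [clLT, Submodule.span_le]
  rintro _ ⟨l, hl, rfl⟩
  exact Submodule.subset_span ⟨v :: l, Nat.succ_lt_succ hl, by simp⟩

theorem exists_mem_clLT (x : Cl Vd) : ∃ n, x ∈ clLT Vd n := by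
  induction x using CliffordAlgebra.left_induction with
  | algebraMap r =>
    refine ⟨1, ?_⟩
    rw [Algebra.algebraMap_eq_smul_one]
    exact Submodule.smul_mem _ _ (Submodule.subset_span ⟨[], by simp, by simp⟩)
  | add x y hx hy =>
    obtain ⟨m, hm⟩ := hx
    obtain ⟨n, hn⟩ := hy
    exact ⟨max m n, Submodule.add_mem _ (clLT_mono (le_max_left _ _) hm)
      (clLT_mono (le_max_right _ _) hn)⟩
  | ι_mul x m hx =>
    obtain ⟨n, hn⟩ := hx
    exact ⟨n + 1, ι_mul_mem_clLT m hn⟩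

theorem exists_eq_algebraMap_of_mem_clLT_one {x : Cl Vd} (hx : x ∈ clLT Vd 1) :
    ∃ z : ℂ, x = algebraMap ℂ _ z := by
  have : clLT Vd 1 ≤ Submodule.span ℂ {(1 : Cl Vd)} := by
    refine Submodule.span_mono ?_
    rintro _ ⟨l, hl, rfl⟩
    rw [List.length_eq_zero_iff.1 (Nat.lt_one_iff.1 hl)]
    simp
  obtain ⟨z, hz⟩ := Submodule.mem_span_singleton.1 (this hx)
  exact ⟨z, by rw [← hz, Algebra.algebraMap_eq_smul_one]⟩

theorem contractLeft_prod_mem_clLT (d : Module.Dual ℂ (ℂ ⊗[ℝ] Vd)) (l : List (ℂ ⊗[ℝ] Vd)) :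
    CliffordAlgebra.contractLeft d (l.map (CliffordAlgebra.ι (negQ Vd))).prod ∈
      clLT Vd l.length := by
  induction l with
  | nil => simp
  | cons v l ih =>
    rw [List.map_cons, List.prod_cons, CliffordAlgebra.contractLeft_ι_mul, List.length_cons]
    exact Submodule.sub_mem _ (Submodule.smul_mem _ _ (prod_mem_clLT (Nat.lt_succ_self _)))
      (ι_mul_mem_clLT v ih)

variable [Fintype κ] (e : Module.Basis κ ℂ (ℂ ⊗[ℝ] Vd))

/-- The number operator `∑ e_i (e_i^* ⌟ x)` of the Clifford algebra. -/
def number : Cl Vd →ₗ[ℂ] Cl Vd :=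
  ∑ i, LinearMap.mulLeft ℂ (CliffordAlgebra.ι (negQ Vd) (e i)) ∘ₗ
    CliffordAlgebra.contractLeft (e.coord i)

theorem number_apply (x : Cl Vd) : number e x =
    ∑ i, CliffordAlgebra.ι (negQ Vd) (e i) * CliffordAlgebra.contractLeft (e.coord i) x := by
  simp [number, LinearMap.sum_apply]

theorem number_ι_mul (v : ℂ ⊗[ℝ] Vd) (y : Cl Vd) :
    number e (CliffordAlgebra.ι (negQ Vd) v * y) =
      CliffordAlgebra.ι (negQ Vd) v * y + CliffordAlgebra.ι (negQ Vd) v * number e y +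
        ∑ i, (2 * form Vd (e i) v) • CliffordAlgebra.contractLeft (e.coord i) y := by
  have h1 : ∀ i, CliffordAlgebra.ι (negQ Vd) (e i) *
      CliffordAlgebra.contractLeft (e.coord i) (CliffordAlgebra.ι (negQ Vd) v * y) =
      CliffordAlgebra.ι (negQ Vd) (e.repr v i • e i) * y +
      CliffordAlgebra.ι (negQ Vd) v *
        (CliffordAlgebra.ι (negQ Vd) (e i) * CliffordAlgebra.contractLeft (e.coord i) y) +
      (2 * form Vd (e i) v) • CliffordAlgebra.contractLeft (e.coord i) y := by
    intro i
    have h2 := ι_mul_ι_add (e i) v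
    rw [CliffordAlgebra.contractLeft_ι_mul, mul_sub, mul_smul_comm, map_smul, smul_mul_assoc,
      ← mul_assoc, ← mul_assoc, eq_sub_of_add_eq h2, sub_mul, ← Algebra.smul_def,
      Module.Basis.coord_apply]
    module
  rw [number_apply, Finset.sum_congr rfl fun i _ => h1 i, Finset.sum_add_distrib,
    Finset.sum_add_distrib, ← Finset.sum_mul, ← map_sum, e.sum_repr, ← Finset.mul_sum,
    ← number_apply]

/-- On products of at most `n` vectors the number operator is multiplication by `n`, up to
products of fewer vectors. -/
theorem number_sub_mem_clLT {n : ℕ} {x : Cl Vd} (hx : x ∈ clLT Vd (n + 1)) :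
    number e x - (n : ℂ) • x ∈ clLT Vd n := by
  have hlist : ∀ l : List (ℂ ⊗[ℝ] Vd),
      number e (l.map (CliffordAlgebra.ι (negQ Vd))).prod -
        (l.length : ℂ) • (l.map (CliffordAlgebra.ι (negQ Vd))).prod ∈ clLT Vd l.length := by
    intro l
    induction l with
    | nil => simp [number_apply]
    | cons v l ih =>
      set y := (l.map (CliffordAlgebra.ι (negQ Vd))).prod with hy
      rw [List.map_cons, List.prod_cons, ← hy, List.length_cons, number_ι_mul]
      have h1 : CliffordAlgebra.ι (negQ Vd) v * y + CliffordAlgebra.ι (negQ Vd) v * number e y +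
          ∑ i, (2 * form Vd (e i) v) • CliffordAlgebra.contractLeft (e.coord i) y -
          ((l.length + 1 : ℕ) : ℂ) • (CliffordAlgebra.ι (negQ Vd) v * y) =
          CliffordAlgebra.ι (negQ Vd) v * (number e y - (l.length : ℂ) • y) +
          ∑ i, (2 * form Vd (e i) v) • CliffordAlgebra.contractLeft (e.coord i) y := by
        rw [mul_sub, mul_smul_comm]
        push_cast
        module
      rw [h1]
      refine Submodule.add_mem _ (ι_mul_mem_clLT v ih) (Submodule.sum_mem _ fun i _ => ?_)
      exact Submodule.smul_mem _ _
        (clLT_mono (Nat.le_succ _) (contractLeft_prod_mem_clLT (e.coord i) l))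
  suffices clLT Vd (n + 1) ≤ (clLT Vd n).comap (number e - (n : ℂ) • LinearMap.id) from this hx
  rw [clLT, Submodule.span_le]
  rintro _ ⟨l, hl, rfl⟩
  change number e _ - (n : ℂ) • _ ∈ clLT Vd n
  rcases Nat.lt_succ_iff_lt_or_eq.1 hl with h | h
  · have h2 := Submodule.add_mem _ (clLT_mono h.le (hlist l))
      (Submodule.smul_mem _ ((l.length : ℂ) - n) (prod_mem_clLT h))
    convert h2 using 1
    module
  · rw [← h]
    exact hlist l

theorem eq_algebraMap_of_number_eq_zero {x : Cl Vd} (hx : number e x = 0) :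
    ∃ z : ℂ, x = algebraMap ℂ _ z := by
  obtain ⟨n, hn⟩ := exists_mem_clLT x
  have hdown : ∀ n, x ∈ clLT Vd (n + 1) → x ∈ clLT Vd 1 := by
    intro n
    induction n with
    | zero => exact id
    | succ n ih =>
      intro h
      refine ih ?_
      have h2 := number_sub_mem_clLT e h
      rw [hx, zero_sub, ← neg_smul] at h2
      exact (Submodule.smul_mem_iff _ (neg_ne_zero.2 (Nat.cast_ne_zero.2 n.succ_ne_zero))).1 h2
  exact exists_eq_algebraMap_of_mem_clLT_one (hdown n (clLT_mono n.le_succ hn))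

end CliffordContraction

/-! ### The spin cover of the Weyl group -/

section SpinCover

variable {R V Vd κ : Type*} [AddCommGroup V] [Module ℝ V]
  [NormedAddCommGroup Vd] [InnerProductSpace ℝ Vd] {Φ : RootPairing R ℝ V Vd}

/-- `(α, ω)` in terms of the bilinear form and the coroot. -/
theorem InvariantInner.rootEval_mul (h : InvariantInner Φ) (i : R) (ω : ℂ ⊗[ℝ] Vd) :
    rootEval Φ i ω * (inner ℝ (Φ.coroot i) (Φ.coroot i) : ℝ) =
      2 * form Vd ((1 : ℂ) ⊗ₜ[ℝ] Φ.coroot i) ω := by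
  induction ω using TensorProduct.induction_on with
  | zero => simp
  | tmul z v =>
    rw [rootEval_tmul, form_tmul, one_mul, mul_assoc, ← Complex.ofReal_mul, h.root'_mul]
    push_cast
    ring
  | add x y hx hy => rw [map_add, map_add, add_mul, hx, hy, mul_add]

/-- The unit vector in the direction of a coroot. -/
def unitCoroot (Φ : RootPairing R ℝ V Vd) (i : R) : ℂ ⊗[ℝ] Vd :=
  (1 : ℂ) ⊗ₜ[ℝ] (‖Φ.coroot i‖⁻¹ • Φ.coroot i)

theorem unitCoroot_eq_smul (i : R) :
    unitCoroot Φ i = (‖Φ.coroot i‖⁻¹ : ℂ) • ((1 : ℂ) ⊗ₜ[ℝ] Φ.coroot i) := by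
  rw [unitCoroot, TensorProduct.tmul_smul, TensorProduct.smul_tmul', TensorProduct.smul_tmul',
    Complex.real_smul, Complex.ofReal_inv]
  rfl

theorem coroot_norm_ne_zero (i : R) : ‖Φ.coroot i‖ ≠ 0 := by
  have := inner_coroot_pos (Φ := Φ) i
  rw [real_inner_self_eq_norm_sq] at this
  exact fun h => by simp [h] at this

theorem form_unitCoroot (i : R) : form Vd (unitCoroot Φ i) (unitCoroot Φ i) = 1 := by
  have := coroot_norm_ne_zero (Φ := Φ) i
  rw [unitCoroot, form_tmul, real_inner_smul_left, real_inner_smul_right,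
    real_inner_self_eq_norm_sq]
  rw [one_mul, one_mul, ← Complex.ofReal_one]
  congr 1
  field_simp

theorem ι_unitCoroot_sq (i : R) :
    CliffordAlgebra.ι (negQ Vd) (unitCoroot Φ i) * CliffordAlgebra.ι (negQ Vd) (unitCoroot Φ i) =
      -1 := by
  have h : negQ Vd (unitCoroot Φ i) = -1 := by
    change -(form Vd (unitCoroot Φ i) (unitCoroot Φ i)) = -1
    rw [form_unitCoroot]
  rw [CliffordAlgebra.ι_sq_scalar, h, map_neg, map_one]

/-- `(α, ω)` is a multiple of the inner product with the unit coroot. -/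
theorem InvariantInner.rootEval_eq (h : InvariantInner Φ) (i : R) (ω : ℂ ⊗[ℝ] Vd) :
    rootEval Φ i ω = (2 / ‖Φ.coroot i‖ : ℝ) * form Vd (unitCoroot Φ i) ω := by
  have h1 := h.rootEval_mul i ω
  have h0 := coroot_norm_ne_zero (Φ := Φ) i
  have h0' : (‖Φ.coroot i‖ : ℂ) ≠ 0 := by exact_mod_cast h0
  rw [unitCoroot_eq_smul, map_smul, LinearMap.smul_apply, smul_eq_mul]
  rw [real_inner_self_eq_norm_sq] at h1
  push_cast at h1 ⊢
  field_simp
  linear_combination h1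

theorem InvariantInner.complexify_coreflection_eq (h : InvariantInner Φ) (i : R)
    (ω : ℂ ⊗[ℝ] Vd) :
    complexify (Φ.coreflection i) ω = ω - (2 * form Vd (unitCoroot Φ i) ω) • unitCoroot Φ i := by
  have h0' : (‖Φ.coroot i‖ : ℂ) ≠ 0 := by exact_mod_cast coroot_norm_ne_zero (Φ := Φ) i
  rw [complexify_coreflection, h.rootEval_eq]
  conv_rhs => rw [unitCoroot_eq_smul, smul_smul, ← unitCoroot_eq_smul]
  congr 2
  push_cast
  ring

/-- Twisted conjugation by a unit coroot is the reflection. -/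
theorem InvariantInner.unitCoroot_conj (hin : InvariantInner Φ) (i : R) (v : ℂ ⊗[ℝ] Vd) :
    CliffordAlgebra.involute (CliffordAlgebra.ι (negQ Vd) (unitCoroot Φ i)) *
      CliffordAlgebra.ι (negQ Vd) v * -CliffordAlgebra.ι (negQ Vd) (unitCoroot Φ i) =
      CliffordAlgebra.ι (negQ Vd) (complexify (Φ.coreflection i) v) := by
  rw [CliffordAlgebra.involute_ι, hin.complexify_coreflection_eq, map_sub, map_smul,
    neg_mul, neg_mul_neg, eq_sub_of_add_eq (ι_mul_ι_add (unitCoroot Φ i) v), sub_mul, mul_assoc,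
    ι_unitCoroot_sq, ← Algebra.smul_def, mul_neg, mul_one, sub_neg_eq_add]
  module

/-- The lift of a reflection to `W̃`. -/
def reflLift (hin : InvariantInner Φ) (i : R) : spinWeyl Φ where
  val :=
    { val := CliffordAlgebra.ι (negQ Vd) (unitCoroot Φ i)
      inv := -CliffordAlgebra.ι (negQ Vd) (unitCoroot Φ i)
      val_inv := by rw [mul_neg, ι_unitCoroot_sq, neg_neg]
      inv_val := by rw [neg_mul, ι_unitCoroot_sq, neg_neg] }
  property := ⟨CliffordAlgebra.star_ι _, refl Φ i, hin.unitCoroot_conj i⟩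

theorem coe_reflLift (hin : InvariantInner Φ) (i : R) :
    (((reflLift hin i : spinWeyl Φ) : (Cl Vd)ˣ) : Cl Vd) =
      CliffordAlgebra.ι (negQ Vd) (unitCoroot Φ i) := rfl

theorem proj_reflLift (hin : InvariantInner Φ) (i : R) :
    proj Φ (reflLift hin i) = refl Φ i :=
  Subtype.ext ((acts_proj Φ (reflLift hin i)).unique (hin.unitCoroot_conj i))

theorem finiteDimensional_coroot [Finite R] [Φ.IsRootSystem] : FiniteDimensional ℝ Vd :=
  Module.finite_def.2 ((Submodule.fg_def).2 ⟨_, Set.finite_range Φ.coroot,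
    RootPairing.IsRootSystem.span_coroot_eq_top⟩)

theorem det_coreflection [Finite R] [Φ.IsRootSystem] (i : R) :
    LinearMap.det ((Φ.coreflection i : Vd ≃ₗ[ℝ] Vd) : Vd →ₗ[ℝ] Vd) = -1 := by
  have := finiteDimensional_coroot (Φ := Φ)
  have h : ((Φ.coreflection i : Vd ≃ₗ[ℝ] Vd) : Vd →ₗ[ℝ] Vd) =
      LinearMap.transvection (-Φ.root' i) (Φ.coroot i) := by
    ext v
    simp [LinearMap.transvection, RootPairing.coreflection_apply, sub_eq_add_neg]
  rw [h, LinearMap.transvection.det]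
  simp
  norm_num

theorem sgn_mul (a b : spinWeyl Φ) : sgn Φ (a * b) = sgn Φ a * sgn Φ b := by
  rw [sgn, map_mul]
  exact LinearMap.det_comp _ _

/-- Every element of `W` lifts to `W̃`, to an element whose parity is the determinant. -/
theorem exists_lift [Finite R] [Φ.IsRootSystem] (hin : InvariantInner Φ) (w : weyl Φ) :
    ∃ b : spinWeyl Φ, proj Φ b = w ∧ sgn Φ b * sgn Φ b = 1 ∧
      CliffordAlgebra.involute ((b : (Cl Vd)ˣ) : Cl Vd) =
        (sgn Φ b : ℂ) • ((b : (Cl Vd)ˣ) : Cl Vd) := by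
  have hrefl : ∀ i (b : spinWeyl Φ), sgn Φ b * sgn Φ b = 1 ∧
      CliffordAlgebra.involute ((b : (Cl Vd)ˣ) : Cl Vd) =
        (sgn Φ b : ℂ) • ((b : (Cl Vd)ˣ) : Cl Vd) →
      sgn Φ (reflLift hin i * b) * sgn Φ (reflLift hin i * b) = 1 ∧
      CliffordAlgebra.involute (((reflLift hin i * b : spinWeyl Φ) : (Cl Vd)ˣ) : Cl Vd) =
        (sgn Φ (reflLift hin i * b) : ℂ) •
          (((reflLift hin i * b : spinWeyl Φ) : (Cl Vd)ˣ) : Cl Vd) := by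
    intro i b hb
    have hs : sgn Φ (reflLift hin i) = -1 := by
      rw [sgn, proj_reflLift]
      exact det_coreflection i
    rw [sgn_mul, hs]
    refine ⟨by linear_combination hb.1, ?_⟩
    rw [Subgroup.coe_mul, Units.val_mul, map_mul, hb.2, coe_reflLift, CliffordAlgebra.involute_ι]
    rw [mul_smul_comm, neg_mul]
    push_cast
    module
  obtain ⟨w, hw⟩ := w
  induction hw using Subgroup.closure_induction_left with
  | one => exact ⟨1, map_one _, by simp [sgn], by simp [sgn]⟩
  | mul_left x hx y hy ih =>
    obtain ⟨i, rfl⟩ := hx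
    obtain ⟨b, hb, hb'⟩ := ih
    exact ⟨reflLift hin i * b, by rw [map_mul, hb, proj_reflLift]; rfl, hrefl i b hb'⟩
  | inv_mul_cancel x hx y hy ih =>
    obtain ⟨i, rfl⟩ := hx
    obtain ⟨b, hb, hb'⟩ := ih
    exact ⟨reflLift hin i * b, by rw [map_mul, hb, proj_reflLift]; rfl, hrefl i b hb'⟩

variable [DecidableEq κ] {e e' : Module.Basis κ ℂ (ℂ ⊗[ℝ] Vd)}

theorem repr_eq_form (hdual : ∀ i j, form Vd (e i) (e' j) = if i = j then 1 else 0) (i : κ) :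
    form Vd (e' i) = e.coord i := by
  refine e.ext fun j => ?_
  rw [form_comm, hdual, e.coord_apply, e.repr_self, Finsupp.single_apply]

variable [Fintype κ]

/-- The kernel of `p : W̃ → W` consists of `±1`: its elements are killed by all contractions, hence
scalars, and `a^t = a⁻¹` leaves only the scalars of square `1`. -/
theorem eq_one_or_neg_one_of_proj_eq_one
    (hdual : ∀ i j, form Vd (e i) (e' j) = if i = j then 1 else 0) {a : spinWeyl Φ}
    (ha : proj Φ a = 1) :
    ((a : (Cl Vd)ˣ) : Cl Vd) = 1 ∨ ((a : (Cl Vd)ˣ) : Cl Vd) = -1 := by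
  have h1 : ∀ v, CliffordAlgebra.contractLeft (form Vd v) ((a : (Cl Vd)ˣ) : Cl Vd) = 0 := by
    intro v
    have h := acts_proj Φ a v
    rw [ha] at h
    have h' : CliffordAlgebra.involute ((a : (Cl Vd)ˣ) : Cl Vd) * CliffordAlgebra.ι (negQ Vd) v =
        CliffordAlgebra.ι (negQ Vd) v * ((a : (Cl Vd)ˣ) : Cl Vd) := by
      rw [Units.mul_inv_eq_iff_eq_mul] at h
      rw [h]
      congr 2
      exact complexify_one v
    have h2 := ι_mul_sub_involute_mul v ((a : (Cl Vd)ˣ) : Cl Vd)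
    rw [h', sub_self] at h2
    exact (smul_eq_zero.1 h2.symm).resolve_left (by norm_num)
  obtain ⟨z, hz⟩ := eq_algebraMap_of_number_eq_zero e (x := ((a : (Cl Vd)ˣ) : Cl Vd)) (by
    rw [number_apply]
    refine Finset.sum_eq_zero fun i _ => ?_
    rw [← repr_eq_form hdual i, h1, mul_zero])
  have hstar := a.2.1
  have h3 : star ((a : (Cl Vd)ˣ) : Cl Vd) * ((a : (Cl Vd)ˣ) : Cl Vd) = 1 := by
    rw [hstar, Units.inv_mul]
  rw [hz, CliffordAlgebra.star_algebraMap, ← map_mul] at h3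
  have hz2 : z * z = 1 := by
    have hinj : Function.Injective (algebraMap ℂ (Cl Vd)) := FaithfulSMul.algebraMap_injective _ _
    exact hinj (h3.trans (map_one _).symm)
  rcases mul_self_eq_one_iff.1 hz2 with h | h
  · left; rw [hz, h, map_one]
  · right; rw [hz, h, map_neg, map_one]

theorem finite_spinWeyl [Finite R] [Φ.IsRootSystem]
    (hdual : ∀ i j, form Vd (e i) (e' j) = if i = j then 1 else 0) : Finite (spinWeyl Φ) := by
  have := finite_weyl (Φ := Φ)
  have hker : Finite (proj Φ).ker := by
    refine Finite.of_injective
      (fun a : (proj Φ).ker => (⟨(((a : spinWeyl Φ) : (Cl Vd)ˣ) : Cl Vd), by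
        rcases eq_one_or_neg_one_of_proj_eq_one hdual a.2 with h | h
        · exact Or.inl h
        · exact Or.inr h⟩ : ({1, -1} : Set (Cl Vd)))) ?_
    intro a b h
    exact Subtype.ext (Subtype.ext (Units.ext (Subtype.ext_iff.1 h)))
  exact (MonoidHom.finite_iff_finite_ker_range (proj Φ)).2 ⟨hker, inferInstance⟩

theorem sgn_mul_self_and_involute [Finite R] [Φ.IsRootSystem] (hin : InvariantInner Φ)
    (hdual : ∀ i j, form Vd (e i) (e' j) = if i = j then 1 else 0) (a : spinWeyl Φ) :
    sgn Φ a * sgn Φ a = 1 ∧ CliffordAlgebra.involute ((a : (Cl Vd)ˣ) : Cl Vd) =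
        (sgn Φ a : ℂ) • ((a : (Cl Vd)ˣ) : Cl Vd) := by
  obtain ⟨b, hb, hb1, hb2⟩ := exists_lift hin (proj Φ a)
  have hs : sgn Φ a = sgn Φ b := by rw [sgn, sgn, hb]
  rw [hs]
  refine ⟨hb1, ?_⟩
  have hk : proj Φ (b⁻¹ * a) = 1 := by rw [map_mul, map_inv, hb, inv_mul_cancel]
  have hab : ((a : (Cl Vd)ˣ) : Cl Vd) =
      ((b : (Cl Vd)ˣ) : Cl Vd) * (((b⁻¹ * a : spinWeyl Φ) : (Cl Vd)ˣ) : Cl Vd) := by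
    rw [← Units.val_mul, ← Subgroup.coe_mul, mul_inv_cancel_left]
  rw [hab]
  rcases eq_one_or_neg_one_of_proj_eq_one hdual hk with h | h
  · rw [h, mul_one, hb2]
  · rw [h, mul_neg, mul_one, map_neg, hb2, smul_neg]

/-- The elements of `W̃` move vectors past themselves, up to a sign. -/
theorem spin_mul_ι [Finite R] [Φ.IsRootSystem] (hin : InvariantInner Φ)
    (hdual : ∀ i j, form Vd (e i) (e' j) = if i = j then 1 else 0) (a : spinWeyl Φ)
    (v : ℂ ⊗[ℝ] Vd) :
    ((a : (Cl Vd)ˣ) : Cl Vd) * CliffordAlgebra.ι (negQ Vd) v =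
      (sgn Φ a : ℂ) • (CliffordAlgebra.ι (negQ Vd)
        (complexify (proj Φ a : Vd ≃ₗ[ℝ] Vd) v) * ((a : (Cl Vd)ˣ) : Cl Vd)) := by
  obtain ⟨h1, h2⟩ := sgn_mul_self_and_involute hin hdual a
  have h := acts_proj Φ a v
  rw [Units.mul_inv_eq_iff_eq_mul, h2] at h
  rw [← h, smul_mul_assoc, smul_smul, ← Complex.ofReal_mul, h1, Complex.ofReal_one, one_smul]

end SpinCover

/-! ### The Dirac element and the map `d` -/

section DiracElement

section DualBases

variable {Vd κ : Type*} [NormedAddCommGroup Vd] [InnerProductSpace ℝ Vd]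
  [DecidableEq κ] {e e' : Module.Basis κ ℂ (ℂ ⊗[ℝ] Vd)}

theorem form_eq_coord' (hdual : ∀ i j, form Vd (e i) (e' j) = if i = j then 1 else 0) (i : κ) :
    form Vd (e i) = e'.coord i := by
  refine e'.ext fun j => ?_
  rw [hdual, e'.coord_apply, e'.repr_self, Finsupp.single_apply]
  simp only [eq_comm]

variable [Fintype κ]

theorem sum_form_smul (hdual : ∀ i j, form Vd (e i) (e' j) = if i = j then 1 else 0)
    (v : ℂ ⊗[ℝ] Vd) : ∑ i, form Vd (e' i) v • e i = v := by
  simp only [repr_eq_form hdual, Module.Basis.coord_apply]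
  exact e.sum_repr v

theorem sum_form_smul' (hdual : ∀ i j, form Vd (e i) (e' j) = if i = j then 1 else 0)
    (v : ℂ ⊗[ℝ] Vd) : ∑ i, form Vd (e i) v • e' i = v := by
  simp only [form_eq_coord' hdual, Module.Basis.coord_apply]
  exact e'.sum_repr v

/-- The canonical element attached to dual bases is invariant under isometries. -/
theorem sum_dual_isometry (hdual : ∀ i j, form Vd (e i) (e' j) = if i = j then 1 else 0)
    {X : Type*} [AddCommGroup X] [Module ℂ X]
    (B : (ℂ ⊗[ℝ] Vd) →ₗ[ℂ] (ℂ ⊗[ℝ] Vd) →ₗ[ℂ] X) (g g' : (ℂ ⊗[ℝ] Vd) →ₗ[ℂ] (ℂ ⊗[ℝ] Vd))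
    (hg : ∀ v w, form Vd (g v) w = form Vd v (g' w)) (hgg : ∀ v, g (g' v) = v) :
    ∑ i, B (g (e i)) (g (e' i)) = ∑ i, B (e i) (e' i) := by
  have h1 : ∀ i, B (g (e i)) (g (e' i)) = ∑ j, form Vd (e' i) (g' (e j)) • B (g (e i)) (e' j) := by
    intro i
    conv_lhs => rw [← sum_form_smul' hdual (g (e' i))]
    simp only [map_sum, map_smul, form_comm (e _) (g _), hg]
  rw [Finset.sum_congr rfl fun i _ => h1 i, Finset.sum_comm]
  refine Finset.sum_congr rfl fun j _ => ?_
  conv_rhs => rw [← hgg (e j), ← sum_form_smul hdual (g' (e j))]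
  simp only [map_sum, map_smul, LinearMap.sum_apply, LinearMap.smul_apply]

end DualBases

variable {R V Vd κ : Type*} [AddCommGroup V] [Module ℝ V]
  [NormedAddCommGroup Vd] [InnerProductSpace ℝ Vd] {Φ : RootPairing R ℝ V Vd}

theorem form_complexify_weyl (hin : InvariantInner Φ) (w : weyl Φ) (v v' : ℂ ⊗[ℝ] Vd) :
    form Vd (complexify (w : Vd ≃ₗ[ℝ] Vd) v) v' =
      form Vd v (complexify ((w⁻¹ : weyl Φ) : Vd ≃ₗ[ℝ] Vd) v') := by
  have hreal : ∀ x y : Vd, inner ℝ ((w : Vd ≃ₗ[ℝ] Vd) x) ((w : Vd ≃ₗ[ℝ] Vd) y) = inner ℝ x y := by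
    obtain ⟨w, hw⟩ := w
    change ∀ x y : Vd, inner ℝ (w x) (w y) = inner ℝ x y
    induction hw using Subgroup.closure_induction with
    | mem x hx => obtain ⟨i, rfl⟩ := hx; exact hin i
    | one => exact fun _ _ => rfl
    | mul x y _ _ hx hy => exact fun a b => (hx _ _).trans (hy _ _)
    | inv x _ hx =>
      intro a b
      rw [← hx]
      congr 1
      · exact x.apply_symm_apply a
      · exact x.apply_symm_apply b
  induction v using TensorProduct.induction_on with
  | zero => simp
  | add x y hx hy => rw [map_add, map_add, LinearMap.add_apply, hx, hy, map_add,
      LinearMap.add_apply]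
  | tmul z x =>
    induction v' using TensorProduct.induction_on with
    | zero => simp
    | add a b ha hb => rw [map_add, ha, hb, map_add, map_add]
    | tmul z' x' =>
      rw [complexify_tmul, complexify_tmul, form_tmul, form_tmul]
      congr 2
      rw [← hreal x]
      congr 1
      exact ((w : Vd ≃ₗ[ℝ] Vd).apply_symm_apply x').symm

theorem complexify_weyl_inv (w : weyl Φ) (v : ℂ ⊗[ℝ] Vd) :
    complexify (w : Vd ≃ₗ[ℝ] Vd) (complexify ((w⁻¹ : weyl Φ) : Vd ≃ₗ[ℝ] Vd) v) = v := by
  rw [← complexify_mul, ← Subgroup.coe_mul, mul_inv_cancel]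
  exact complexify_one v

/-- The standing assumptions: an invariant inner product, a positive system cut out by the
regular point `ξ`, an invariant parameter function, and dual bases of `V^∨`. -/
structure Setting [DecidableEq κ] (Φ : RootPairing R ℝ V Vd) (pos : Finset R) (c : R → ℝ) (ξ : Vd)
    (e e' : Module.Basis κ ℂ (ℂ ⊗[ℝ] Vd)) : Prop where
  inner_inv : InvariantInner Φ
  defines : Defines Φ pos ξ
  param_inv : ∀ i j, c (Φ.reflectionPerm i j) = c j
  dual : ∀ i j, form Vd (e i) (e' j) = if i = j then 1 else 0

section Dirac

variable {pos : Finset R} {c : R → ℝ}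

theorem rho_of (a : spinWeyl Φ) : rho Φ pos c (MonoidAlgebra.of ℂ _ a) =
    tW Φ pos c (proj Φ a) ⊗ₜ[ℂ] ((a : (Cl Vd)ˣ) : Cl Vd) := by
  rw [rho, MonoidAlgebra.lift_of]
  rfl

variable (pos c) in
/-- The image `ρ(w̃)` of an element of `W̃`. -/
def spinElt : spinWeyl Φ →* HCl Φ pos c :=
  (rho Φ pos c : _ →* HCl Φ pos c).comp (MonoidAlgebra.of ℂ _)

theorem spinElt_apply (a : spinWeyl Φ) : spinElt pos c a =
    tW Φ pos c (proj Φ a) ⊗ₜ[ℂ] ((a : (Cl Vd)ˣ) : Cl Vd) := rho_of a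

theorem rho_of' (a : spinWeyl Φ) : rho Φ pos c (MonoidAlgebra.of ℂ _ a) = spinElt pos c a := rfl

variable (Φ pos c) in
/-- The linear map `ω ↦ ω` from `V^∨` to `ℍ`. -/
def tVLinear : (ℂ ⊗[ℝ] Vd) →ₗ[ℂ] Hecke Φ pos c where
  toFun := tV Φ pos c
  map_add' := tV_add
  map_smul' := tV_smul

variable (Φ pos c) in
/-- The linear map `ω ↦ ω̃` from `V^∨` to `ℍ`. -/
def tTildeLinear : (ℂ ⊗[ℝ] Vd) →ₗ[ℂ] Hecke Φ pos c where
  toFun := tTilde Φ pos c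
  map_add' := tTilde_add
  map_smul' := tTilde_smul

theorem parity_tmul (h : Hecke Φ pos c) (x : Cl Vd) :
    parity Φ pos c (h ⊗ₜ[ℂ] x) = h ⊗ₜ[ℂ] CliffordAlgebra.involute x := rfl

theorem parity_parity (x : HCl Φ pos c) : parity Φ pos c (parity Φ pos c x) = x := by
  induction x using TensorProduct.induction_on with
  | zero => simp
  | tmul h x => rw [parity_tmul, parity_tmul, CliffordAlgebra.involute_involute]
  | add x y hx hy => rw [map_add, map_add, hx, hy]

theorem dMap_apply (D x : HCl Φ pos c) : dMap D x = D * x - parity Φ pos c x * D := rfl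

variable [Fintype κ]

theorem parity_dirac (e e' : κ → ℂ ⊗[ℝ] Vd) :
    parity Φ pos c (dirac Φ pos c e e') = -dirac Φ pos c e e' := by
  rw [dirac, map_sum, ← Finset.sum_neg_distrib]
  refine Finset.sum_congr rfl fun i _ => ?_
  rw [parity_tmul, CliffordAlgebra.involute_ι, TensorProduct.tmul_neg]

/-- The square of `d` is the commutator with `𝒟²`. -/
theorem dMap_dMap (e e' : κ → ℂ ⊗[ℝ] Vd) (x : HCl Φ pos c) :
    dMap (dirac Φ pos c e e') (dMap (dirac Φ pos c e e') x) =
      dirac Φ pos c e e' * dirac Φ pos c e e' * x -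
        x * (dirac Φ pos c e e' * dirac Φ pos c e e') := by
  rw [dMap_apply, dMap_apply, map_sub, map_mul, map_mul, parity_parity, parity_dirac]
  noncomm_ring

variable [DecidableEq κ] {ξ : Vd} {e e' : Module.Basis κ ℂ (ℂ ⊗[ℝ] Vd)}

/-! ### The leading part of the Dirac element and the Casimir element -/

variable (Φ pos c) in
/-- The element `∑ ω_i ⊗ ω^i`, the leading part of the Dirac element. -/
def leadingDirac (e e' : κ → ℂ ⊗[ℝ] Vd) : HCl Φ pos c :=
  ∑ i, tV Φ pos c (e i) ⊗ₜ[ℂ] CliffordAlgebra.ι (negQ Vd) (e' i)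

variable (pos c) in
/-- The element of `ℂ[W̃]` whose image under `ρ` is the difference of `∑ ω_i ⊗ ω^i` and the Dirac
element. -/
def reflElt (hin : InvariantInner Φ) : MonoidAlgebra ℂ (spinWeyl Φ) :=
  ∑ β ∈ pos, ((c β / ‖Φ.coroot β‖ : ℝ) : ℂ) • MonoidAlgebra.of ℂ _ (reflLift hin β)

theorem Setting.dirac_eq (hS : Setting Φ pos c ξ e e') : dirac Φ pos c e e' =
    leadingDirac Φ pos c e e' - rho Φ pos c (reflElt pos c hS.inner_inv) := by
  have h1 : ∀ β, ∑ i, (rootEval Φ β (e i)) • CliffordAlgebra.ι (negQ Vd) (e' i) =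
      ((2 / ‖Φ.coroot β‖ : ℝ) : ℂ) • CliffordAlgebra.ι (negQ Vd) (unitCoroot Φ β) := by
    intro β
    conv_rhs => rw [← sum_form_smul' hS.dual (unitCoroot Φ β)]
    rw [map_sum, Finset.smul_sum]
    refine Finset.sum_congr rfl fun i _ => ?_
    rw [hS.inner_inv.rootEval_eq, map_smul, smul_smul, form_comm]
  have h2 : rho Φ pos c (reflElt pos c hS.inner_inv) =
      ∑ i, reflSum pos c (tW Φ pos c) (e i) ⊗ₜ[ℂ] CliffordAlgebra.ι (negQ Vd) (e' i) := by
    have h3 : ∀ i, reflSum pos c (tW Φ pos c) (e i) ⊗ₜ[ℂ] CliffordAlgebra.ι (negQ Vd) (e' i) =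
        ∑ β ∈ pos, ((1 / 2 : ℂ) * c β) • (tW Φ pos c (refl Φ β) ⊗ₜ[ℂ]
          (rootEval Φ β (e i) • CliffordAlgebra.ι (negQ Vd) (e' i))) := by
      intro i
      rw [reflSum_apply, Finset.smul_sum, TensorProduct.sum_tmul]
      refine Finset.sum_congr rfl fun β _ => ?_
      rw [TensorProduct.tmul_smul, smul_smul, smul_smul, TensorProduct.smul_tmul', mul_assoc]
    rw [Finset.sum_congr rfl fun i _ => h3 i, Finset.sum_comm, reflElt, map_sum]
    refine Finset.sum_congr rfl fun β _ => ?_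
    rw [map_smul, rho_of, proj_reflLift, coe_reflLift, ← Finset.smul_sum,
      ← TensorProduct.tmul_sum, h1, TensorProduct.tmul_smul, smul_smul]
    congr 1
    push_cast
    ring
  rw [h2, leadingDirac, dirac, ← Finset.sum_sub_distrib]
  refine Finset.sum_congr rfl fun i _ => ?_
  rw [tTilde_eq, TensorProduct.sub_tmul]

variable (Φ pos c) in
/-- The Casimir element `∑ ω_i ω^i` of `ℍ`. -/
def casimir (e e' : κ → ℂ ⊗[ℝ] Vd) : Hecke Φ pos c :=
  ∑ i, tV Φ pos c (e i) * tV Φ pos c (e' i)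

theorem Setting.casimir_mul_refl (hS : Setting Φ pos c ξ e e') {i : R}
    (hi : IsSimpleRoot Φ pos i) : casimir Φ pos c e e' * tW Φ pos c (refl Φ i) =
      tW Φ pos c (refl Φ i) * casimir Φ pos c e e' := by
  set s := complexify (Φ.coreflection i) with hs
  have h1 : casimir Φ pos c e e' = ∑ j, tV Φ pos c (s (e j)) * tV Φ pos c (s (e' j)) :=
    (sum_dual_isometry hS.dual ((LinearMap.mul ℂ (Hecke Φ pos c)).compl₁₂
      (tVLinear Φ pos c) (tVLinear Φ pos c))
      (complexify ((refl Φ i : weyl Φ) : Vd ≃ₗ[ℝ] Vd)) _ (form_complexify_weyl hS.inner_inv _)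
      (complexify_weyl_inv _)).symm
  have h2 : ∑ j, (rootEval Φ i (e j) • s (e' j) + rootEval Φ i (e' j) • e j) = 0 := by
    have h3 : ∑ j, rootEval Φ i (e j) • e' j =
        ((2 / ‖Φ.coroot i‖ : ℝ) : ℂ) • unitCoroot Φ i := by
      conv_rhs => rw [← sum_form_smul' hS.dual (unitCoroot Φ i)]
      rw [Finset.smul_sum]
      refine Finset.sum_congr rfl fun j _ => ?_
      rw [hS.inner_inv.rootEval_eq, smul_smul, form_comm]
    have h4 : ∑ j, rootEval Φ i (e' j) • e j =
        ((2 / ‖Φ.coroot i‖ : ℝ) : ℂ) • unitCoroot Φ i := by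
      conv_rhs => rw [← sum_form_smul hS.dual (unitCoroot Φ i)]
      rw [Finset.smul_sum]
      refine Finset.sum_congr rfl fun j _ => ?_
      rw [hS.inner_inv.rootEval_eq, smul_smul, form_comm]
    have h5 : ∑ j, rootEval Φ i (e j) • s (e' j) = s (∑ j, rootEval Φ i (e j) • e' j) := by
      rw [map_sum]
      exact Finset.sum_congr rfl fun j _ => (map_smul _ _ _).symm
    rw [Finset.sum_add_distrib, h5, h3, h4, hs, map_smul, hS.inner_inv.complexify_coreflection_eq,
      form_unitCoroot]
    module
  conv_rhs => rw [h1]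
  rw [casimir, Finset.sum_mul, Finset.mul_sum, ← sub_eq_zero, ← Finset.sum_sub_distrib]
  have h6 : ∀ j, tV Φ pos c (e j) * tV Φ pos c (e' j) * tW Φ pos c (refl Φ i) -
      tW Φ pos c (refl Φ i) * (tV Φ pos c (s (e j)) * tV Φ pos c (s (e' j))) =
      (c i : ℂ) • tVLinear Φ pos c
        (rootEval Φ i (e j) • s (e' j) + rootEval Φ i (e' j) • e j) := by
    intro j
    rw [mul_assoc, tV_mul_refl hi, mul_add, ← mul_assoc, tV_mul_refl hi, ← hs, map_add, map_smul,
      map_smul]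
    change _ = (c i : ℂ) • (rootEval Φ i (e j) • tV Φ pos c (s (e' j)) +
      rootEval Φ i (e' j) • tV Φ pos c (e j))
    rw [Algebra.algebraMap_eq_smul_one, Algebra.algebraMap_eq_smul_one, add_mul, smul_mul_assoc,
      one_mul, mul_smul_comm, mul_one, mul_assoc]
    module
  rw [Finset.sum_congr rfl fun j _ => h6 j, ← Finset.smul_sum, ← map_sum, h2, map_zero, smul_zero]

/-- The Casimir element is central: with the reflections it commutes because the correction terms of
the cross relation add up to a multiple of `α^∨ + s_α(α^∨) = 0`. -/
theorem Setting.casimir_central [Finite R] [Φ.IsReduced]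
    (hS : Setting Φ pos c ξ e e') (h : Hecke Φ pos c) :
    casimir Φ pos c e e' * h = h * casimir Φ pos c e e' := by
  induction h using Hecke.induction with
  | scalar z => exact (Algebra.commutes z _).symm
  | weyl w =>
    induction w using hS.defines.weyl_induction hS.inner_inv with
    | one => rw [map_one, mul_one, one_mul]
    | mul i hi w ih =>
      rw [map_mul, ← mul_assoc, hS.casimir_mul_refl hi, mul_assoc, ih, mul_assoc]
  | vec ω =>
    rw [casimir, Finset.sum_mul, Finset.mul_sum]
    refine Finset.sum_congr rfl fun i _ => ?_
    rw [mul_assoc, tV_mul_comm _ ω, ← mul_assoc, tV_mul_comm _ ω, mul_assoc]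
  | add a b ha hb => rw [mul_add, add_mul, ha, hb]
  | mul a b ha hb => rw [← mul_assoc, ha, mul_assoc, hb, mul_assoc]

theorem Setting.casimir_tmul_central [Finite R] [Φ.IsReduced]
    (hS : Setting Φ pos c ξ e e') (x : HCl Φ pos c) :
    (casimir Φ pos c e e' ⊗ₜ[ℂ] (1 : Cl Vd)) * x =
      x * (casimir Φ pos c e e' ⊗ₜ[ℂ] (1 : Cl Vd)) := by
  induction x using TensorProduct.induction_on with
  | zero => simp
  | tmul h y =>
    rw [Algebra.TensorProduct.tmul_mul_tmul, Algebra.TensorProduct.tmul_mul_tmul,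
      hS.casimir_central, one_mul, mul_one]
  | add a b ha hb => rw [mul_add, add_mul, ha, hb]

theorem Setting.leadingDirac_sq (hS : Setting Φ pos c ξ e e') :
    leadingDirac Φ pos c e e' * leadingDirac Φ pos c e e' =
      -(casimir Φ pos c e e' ⊗ₜ[ℂ] (1 : Cl Vd)) := by
  have h1 : leadingDirac Φ pos c e e' * leadingDirac Φ pos c e e' =
      ∑ i, ∑ j, (tV Φ pos c (e i) * tV Φ pos c (e j)) ⊗ₜ[ℂ]
        (CliffordAlgebra.ι (negQ Vd) (e' i) * CliffordAlgebra.ι (negQ Vd) (e' j)) := by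
    rw [leadingDirac, Finset.sum_mul_sum]
    simp only [Algebra.TensorProduct.tmul_mul_tmul]
  have h2 : leadingDirac Φ pos c e e' * leadingDirac Φ pos c e e' =
      ∑ i, ∑ j, (tV Φ pos c (e i) * tV Φ pos c (e j)) ⊗ₜ[ℂ]
        (CliffordAlgebra.ι (negQ Vd) (e' j) * CliffordAlgebra.ι (negQ Vd) (e' i)) := by
    rw [h1, Finset.sum_comm]
    refine Finset.sum_congr rfl fun i _ => Finset.sum_congr rfl fun j _ => ?_
    rw [tV_mul_comm]
  have h3 : ∀ i, ∑ j, form Vd (e' i) (e' j) • tV Φ pos c (e j) = tV Φ pos c (e' i) := by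
    intro i
    change ∑ j, form Vd (e' i) (e' j) • tVLinear Φ pos c (e j) = tVLinear Φ pos c (e' i)
    conv_rhs => rw [← sum_form_smul hS.dual (e' i)]
    rw [map_sum]
    refine Finset.sum_congr rfl fun j _ => ?_
    rw [map_smul, form_comm]
  have h4 : leadingDirac Φ pos c e e' * leadingDirac Φ pos c e e' +
      leadingDirac Φ pos c e e' * leadingDirac Φ pos c e e' =
      (-2 : ℂ) • (casimir Φ pos c e e' ⊗ₜ[ℂ] (1 : Cl Vd)) := by
    nth_rewrite 2 [h2]
    rw [h1]
    rw [← Finset.sum_add_distrib, casimir, TensorProduct.sum_tmul, Finset.smul_sum]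
    refine Finset.sum_congr rfl fun i _ => ?_
    rw [← Finset.sum_add_distrib, ← h3, Finset.mul_sum, TensorProduct.sum_tmul, Finset.smul_sum]
    refine Finset.sum_congr rfl fun j _ => ?_
    rw [← TensorProduct.tmul_add, ι_mul_ι_add, Algebra.algebraMap_eq_smul_one,
      TensorProduct.tmul_smul, mul_smul_comm, ← TensorProduct.smul_tmul', smul_smul]
  have h5 : (2 : ℂ) • (leadingDirac Φ pos c e e' * leadingDirac Φ pos c e e') =
      (2 : ℂ) • -(casimir Φ pos c e e' ⊗ₜ[ℂ] (1 : Cl Vd)) := by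
    rw [two_smul, h4]
    module
  exact (smul_right_injective _ (two_ne_zero (α := ℂ))) h5

/-! ### Equivariance of the Dirac element and the square of `d` -/

variable [Finite R] [Φ.IsRootSystem]

theorem Setting.parity_spinElt (hS : Setting Φ pos c ξ e e') (a : spinWeyl Φ) :
    parity Φ pos c (spinElt pos c a) = (sgn Φ a : ℂ) • spinElt pos c a := by
  rw [spinElt_apply, parity_tmul, (sgn_mul_self_and_involute hS.inner_inv hS.dual a).2,
    TensorProduct.tmul_smul]

theorem Setting.sgn_mul_self (hS : Setting Φ pos c ξ e e') (a : spinWeyl Φ) :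
    (sgn Φ a : ℂ) * (sgn Φ a : ℂ) = 1 := by
  rw [← Complex.ofReal_mul, (sgn_mul_self_and_involute hS.inner_inv hS.dual a).1,
    Complex.ofReal_one]

variable [Φ.IsReduced]

/-- The Dirac element is `sgn`-invariant under `W̃`. -/
theorem Setting.spinElt_mul_dirac (hS : Setting Φ pos c ξ e e') (a : spinWeyl Φ) :
    spinElt pos c a * dirac Φ pos c e e' =
      (sgn Φ a : ℂ) • (dirac Φ pos c e e' * spinElt pos c a) := by
  have h1 : dirac Φ pos c e e' = ∑ i, tTilde Φ pos c
      (complexify (proj Φ a : Vd ≃ₗ[ℝ] Vd) (e i)) ⊗ₜ[ℂ] CliffordAlgebra.ι (negQ Vd)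
      (complexify (proj Φ a : Vd ≃ₗ[ℝ] Vd) (e' i)) :=
    (sum_dual_isometry hS.dual ((TensorProduct.mk ℂ (Hecke Φ pos c) (Cl Vd)).compl₁₂
      (tTildeLinear Φ pos c) (CliffordAlgebra.ι (negQ Vd)))
      (complexify (proj Φ a : Vd ≃ₗ[ℝ] Vd)) _ (form_complexify_weyl hS.inner_inv _)
      (complexify_weyl_inv _)).symm
  conv_rhs => rw [h1]
  rw [dirac, Finset.mul_sum, Finset.sum_mul, Finset.smul_sum]
  refine Finset.sum_congr rfl fun i _ => ?_
  rw [spinElt_apply, Algebra.TensorProduct.tmul_mul_tmul, Algebra.TensorProduct.tmul_mul_tmul,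
    tW_mul_tTilde hS.inner_inv hS.defines hS.param_inv, spin_mul_ι hS.inner_inv hS.dual,
    TensorProduct.tmul_smul]

theorem Setting.dirac_mul_spinElt (hS : Setting Φ pos c ξ e e') (a : spinWeyl Φ) :
    dirac Φ pos c e e' * spinElt pos c a =
      (sgn Φ a : ℂ) • (spinElt pos c a * dirac Φ pos c e e') := by
  rw [hS.spinElt_mul_dirac, smul_smul, hS.sgn_mul_self, one_smul]

/-- `d` vanishes on the image of `ρ`. -/
theorem Setting.dMap_rho (hS : Setting Φ pos c ξ e e') (y : MonoidAlgebra ℂ (spinWeyl Φ)) :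
    dMap (dirac Φ pos c e e') (rho Φ pos c y) = 0 := by
  induction y using MonoidAlgebra.induction_on with
  | of a =>
    rw [rho_of', dMap_apply, hS.parity_spinElt, hS.dirac_mul_spinElt, smul_mul_assoc, sub_self]
  | add x y hx hy => rw [map_add, map_add, hx, hy, add_zero]
  | smul z x hx => rw [map_smul, map_smul, hx, smul_zero]

theorem Setting.dMap_spinElt_mul (hS : Setting Φ pos c ξ e e') (a : spinWeyl Φ)
    (x : HCl Φ pos c) :
    dMap (dirac Φ pos c e e') (spinElt pos c a * x) =
      (sgn Φ a : ℂ) • (spinElt pos c a * dMap (dirac Φ pos c e e') x) := by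
  rw [dMap_apply, dMap_apply, map_mul, hS.parity_spinElt, ← mul_assoc, hS.dirac_mul_spinElt,
    mul_sub, smul_sub, smul_mul_assoc, smul_mul_assoc, smul_mul_assoc, mul_assoc, mul_assoc]

theorem Setting.dMap_mul_spinElt (hS : Setting Φ pos c ξ e e') (a : spinWeyl Φ)
    (x : HCl Φ pos c) :
    dMap (dirac Φ pos c e e') (x * spinElt pos c a) =
      dMap (dirac Φ pos c e e') x * spinElt pos c a := by
  rw [dMap_apply, dMap_apply, map_mul, hS.parity_spinElt, sub_mul, mul_assoc, mul_assoc,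
    smul_mul_assoc, mul_smul_comm, hS.spinElt_mul_dirac, mul_assoc _ _ (spinElt pos c a),
    mul_smul_comm, smul_smul, hS.sgn_mul_self, one_smul]

/-- `𝒟²` is the difference of a central element and the square of an element of `ρ(ℂ[W̃])` which
anticommutes with `𝒟`. -/
theorem Setting.dirac_sq (hS : Setting Φ pos c ξ e e') :
    dirac Φ pos c e e' * dirac Φ pos c e e' =
      -(casimir Φ pos c e e' ⊗ₜ[ℂ] (1 : Cl Vd)) -
        rho Φ pos c (reflElt pos c hS.inner_inv) * rho Φ pos c (reflElt pos c hS.inner_inv) := by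
  set P := rho Φ pos c (reflElt pos c hS.inner_inv) with hP
  set D := dirac Φ pos c e e' with hD
  have hanti : P * D = -(D * P) := by
    rw [hP, reflElt, map_sum, Finset.sum_mul, Finset.mul_sum, ← Finset.sum_neg_distrib]
    refine Finset.sum_congr rfl fun β _ => ?_
    have hs : sgn Φ (reflLift hS.inner_inv β) = -1 := by
      rw [sgn, proj_reflLift]
      exact det_coreflection β
    rw [map_smul, rho_of', smul_mul_assoc, mul_smul_comm, hD, hS.spinElt_mul_dirac, hs]
    push_cast
    module
  have hL : leadingDirac Φ pos c e e' = D + P := by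
    rw [hD, hS.dirac_eq, sub_add_cancel]
  rw [← hS.leadingDirac_sq, hL, add_mul, mul_add, mul_add, hanti]
  abel

/-- `d² = 0` on elements which commute or anticommute with the lifts of the reflections. -/
theorem Setting.dMap_dMap_eq_zero (hS : Setting Φ pos c ξ e e') {x : HCl Φ pos c} {η : ℂ}
    (hη : η * η = 1) (hx : ∀ β, spinElt pos c (reflLift hS.inner_inv β) * x =
      η • (x * spinElt pos c (reflLift hS.inner_inv β))) :
    dMap (dirac Φ pos c e e') (dMap (dirac Φ pos c e e') x) = 0 := by
  set P := rho Φ pos c (reflElt pos c hS.inner_inv) with hP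
  have h1 : P * x = η • (x * P) := by
    rw [hP, reflElt, map_sum, Finset.sum_mul, Finset.mul_sum, Finset.smul_sum]
    refine Finset.sum_congr rfl fun β _ => ?_
    rw [map_smul, rho_of', smul_mul_assoc, hx, mul_smul_comm, smul_comm]
  have h2 : P * P * x = x * (P * P) := by
    rw [mul_assoc, h1, mul_smul_comm, ← mul_assoc, h1, smul_mul_assoc, smul_smul, hη, one_smul,
      mul_assoc]
  have h3 : (casimir Φ pos c e e' ⊗ₜ[ℂ] (1 : Cl Vd)) * x =
      x * (casimir Φ pos c e e' ⊗ₜ[ℂ] (1 : Cl Vd)) :=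
    hS.casimir_tmul_central x
  rw [dMap_dMap, hS.dirac_sq, sub_mul, mul_sub, ← hP, h2, neg_mul, mul_neg, h3, sub_self]

end Dirac

end DiracElement

/-! ### The Koszul differential and its homotopy -/

section Koszul

variable {Vd κ : Type*} [NormedAddCommGroup Vd] [InnerProductSpace ℝ Vd]

/-- The tensors in `S(V^∨) ⊗ C(V^∨)` of degree `< n` in the first factor and of degree `< k` in the
second. -/
def koszulLT (κ Vd : Type*) [NormedAddCommGroup Vd] [InnerProductSpace ℝ Vd] (n k : ℕ) :
    Submodule ℂ (MvPolynomial κ ℂ ⊗[ℂ] Cl Vd) :=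
  Submodule.map₂ (TensorProduct.mk ℂ _ _) (polyLT κ n) (clLT Vd k)

/-- The tensors in `S(V^∨) ⊗ C(V^∨)` of degree `< n` in the first factor. -/
def symLT (κ Vd : Type*) [NormedAddCommGroup Vd] [InnerProductSpace ℝ Vd] (n : ℕ) :
    Submodule ℂ (MvPolynomial κ ℂ ⊗[ℂ] Cl Vd) :=
  Submodule.map₂ (TensorProduct.mk ℂ _ _) (polyLT κ n) ⊤

theorem tmul_mem_symLT {n : ℕ} {f : MvPolynomial κ ℂ} (hf : f ∈ polyLT κ n) (x : Cl Vd) :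
    f ⊗ₜ[ℂ] x ∈ symLT κ Vd n :=
  Submodule.apply_mem_map₂ (TensorProduct.mk ℂ _ _) hf Submodule.mem_top

theorem exists_mem_koszulLT {n : ℕ} {q : MvPolynomial κ ℂ ⊗[ℂ] Cl Vd} (hq : q ∈ symLT κ Vd n) :
    ∃ k, q ∈ koszulLT κ Vd n k := by
  have hmono : ∀ k l, k ≤ l → koszulLT κ Vd n k ≤ koszulLT κ Vd n l := fun k l h =>
    Submodule.map₂_le_map₂_right (clLT_mono h)
  rw [symLT, Submodule.map₂_eq_span_image2] at hq
  induction hq using Submodule.span_induction with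
  | mem x hx =>
    obtain ⟨f, hf, x, -, rfl⟩ := hx
    obtain ⟨k, hk⟩ := exists_mem_clLT x
    exact ⟨k, Submodule.apply_mem_map₂ _ hf hk⟩
  | zero => exact ⟨0, zero_mem _⟩
  | add x y _ _ hx hy =>
    obtain ⟨k, hk⟩ := hx
    obtain ⟨l, hl⟩ := hy
    exact ⟨max k l, Submodule.add_mem _ (hmono _ _ (le_max_left _ _) hk)
      (hmono _ _ (le_max_right _ _) hl)⟩
  | smul t x _ hx =>
    obtain ⟨k, hk⟩ := hx
    exact ⟨k, Submodule.smul_mem _ _ hk⟩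

variable [Fintype κ] (e : Module.Basis κ ℂ (ℂ ⊗[ℝ] Vd))

/-- The Koszul differential on `S(V^∨) ⊗ C(V^∨)`: multiplication by `e_i` in the first factor,
contraction with the dual vector `e_i^*` in the second. -/
def koszul : MvPolynomial κ ℂ ⊗[ℂ] Cl Vd →ₗ[ℂ] MvPolynomial κ ℂ ⊗[ℂ] Cl Vd :=
  ∑ i, TensorProduct.map (LinearMap.mulLeft ℂ (MvPolynomial.X i))
    (CliffordAlgebra.contractLeft (e.coord i))

/-- The homotopy for the Koszul differential: differentiation in the first factor, Clifford
multiplication in the second. -/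
def koszulHomotopy : MvPolynomial κ ℂ ⊗[ℂ] Cl Vd →ₗ[ℂ] MvPolynomial κ ℂ ⊗[ℂ] Cl Vd :=
  ∑ i, TensorProduct.map (partialDeriv i)
    (LinearMap.mulLeft ℂ (CliffordAlgebra.ι (negQ Vd) (e i)))

theorem koszul_tmul (f : MvPolynomial κ ℂ) (x : Cl Vd) : koszul e (f ⊗ₜ[ℂ] x) =
    ∑ i, (MvPolynomial.X i * f) ⊗ₜ[ℂ] CliffordAlgebra.contractLeft (e.coord i) x := by
  simp [koszul, LinearMap.sum_apply]

theorem koszulHomotopy_tmul (f : MvPolynomial κ ℂ) (x : Cl Vd) :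
    koszulHomotopy e (f ⊗ₜ[ℂ] x) =
      ∑ i, partialDeriv i f ⊗ₜ[ℂ] (CliffordAlgebra.ι (negQ Vd) (e i) * x) := by
  simp [koszulHomotopy, LinearMap.sum_apply]

theorem koszul_koszul (q : MvPolynomial κ ℂ ⊗[ℂ] Cl Vd) : koszul e (koszul e q) = 0 := by
  induction q using TensorProduct.induction_on with
  | zero => simp
  | add x y hx hy => rw [map_add, map_add, hx, hy, add_zero]
  | tmul f x =>
    simp only [koszul_tmul, map_sum]
    have h : ∑ i, ∑ j, (MvPolynomial.X j * (MvPolynomial.X i * f)) ⊗ₜ[ℂ]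
        CliffordAlgebra.contractLeft (e.coord j)
          (CliffordAlgebra.contractLeft (e.coord i) x) =
        -∑ i, ∑ j, (MvPolynomial.X j * (MvPolynomial.X i * f)) ⊗ₜ[ℂ]
        CliffordAlgebra.contractLeft (e.coord j)
          (CliffordAlgebra.contractLeft (e.coord i) x) := by
      conv_rhs => rw [Finset.sum_comm]
      rw [← Finset.sum_neg_distrib]
      refine Finset.sum_congr rfl fun i _ => ?_
      rw [← Finset.sum_neg_distrib]
      refine Finset.sum_congr rfl fun j _ => ?_
      rw [CliffordAlgebra.contractLeft_comm, TensorProduct.tmul_neg, mul_left_comm]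
    rw [eq_neg_iff_add_eq_zero, ← two_smul ℂ] at h
    exact (smul_eq_zero.1 h).resolve_left two_ne_zero

open Classical in
/-- The homotopy formula: the anticommutator of the Koszul differential and its homotopy is the sum
of the Euler operator and the number operator. -/
theorem koszul_homotopy (q : MvPolynomial κ ℂ ⊗[ℂ] Cl Vd) :
    koszul e (koszulHomotopy e q) + koszulHomotopy e (koszul e q) =
      LinearMap.rTensor _ (∑ i, LinearMap.mulLeft ℂ (MvPolynomial.X i) ∘ₗ partialDeriv i) q +
        LinearMap.lTensor _ (number e) q := by
  induction q using TensorProduct.induction_on with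
  | zero => simp
  | add x y hx hy =>
    simp only [map_add]
    rw [add_add_add_comm, hx, hy, add_add_add_comm]
  | tmul f x =>
    simp only [koszul_tmul, koszulHomotopy_tmul, map_sum, LinearMap.rTensor_tmul,
      LinearMap.lTensor_tmul, number_apply]
    have h1 : ∀ i j, (MvPolynomial.X j * partialDeriv i f) ⊗ₜ[ℂ]
        CliffordAlgebra.contractLeft (e.coord j) (CliffordAlgebra.ι (negQ Vd) (e i) * x) =
        (if i = j then (MvPolynomial.X j * partialDeriv i f) ⊗ₜ[ℂ] x else 0) -
        (MvPolynomial.X j * partialDeriv i f) ⊗ₜ[ℂ] (CliffordAlgebra.ι (negQ Vd) (e i) *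
          CliffordAlgebra.contractLeft (e.coord j) x) := by
      intro i j
      rw [CliffordAlgebra.contractLeft_ι_mul, e.coord_apply, e.repr_self, Finsupp.single_apply,
        TensorProduct.tmul_sub]
      split_ifs <;> simp
    have h2 : ∀ i j, partialDeriv i (MvPolynomial.X j * f) ⊗ₜ[ℂ]
        (CliffordAlgebra.ι (negQ Vd) (e i) * CliffordAlgebra.contractLeft (e.coord j) x) =
        (if i = j then f ⊗ₜ[ℂ] (CliffordAlgebra.ι (negQ Vd) (e i) *
          CliffordAlgebra.contractLeft (e.coord j) x) else 0) +
        (MvPolynomial.X j * partialDeriv i f) ⊗ₜ[ℂ] (CliffordAlgebra.ι (negQ Vd) (e i) *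
          CliffordAlgebra.contractLeft (e.coord j) x) := by
      intro i j
      rw [partialDeriv_apply, Derivation.leibniz, MvPolynomial.pderiv_X, ← partialDeriv_apply,
        smul_eq_mul, smul_eq_mul, TensorProduct.add_tmul, add_comm, Pi.single_apply]
      simp only [eq_comm (a := j)]
      split_ifs <;> simp
    simp only [h1, h2, Finset.sum_sub_distrib, Finset.sum_add_distrib, Finset.sum_ite_eq,
      Finset.sum_ite_eq', Finset.mem_univ, if_true]
    rw [Finset.sum_comm (γ := κ) (f := fun i j =>
      (MvPolynomial.X j * partialDeriv i f) ⊗ₜ[ℂ] (CliffordAlgebra.ι (negQ Vd) (e i) *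
          CliffordAlgebra.contractLeft (e.coord j) x))]
    simp only [LinearMap.sum_apply, LinearMap.comp_apply, LinearMap.mulLeft_apply,
      TensorProduct.sum_tmul, TensorProduct.tmul_sum]
    abel

theorem koszul_mem_symLT {n : ℕ} {q : MvPolynomial κ ℂ ⊗[ℂ] Cl Vd} (hq : q ∈ symLT κ Vd n) :
    koszul e q ∈ symLT κ Vd (n + 1) := by
  suffices symLT κ Vd n ≤ (symLT κ Vd (n + 1)).comap (koszul e) from this hq
  refine Submodule.map₂_le.2 fun f hf x _ => ?_
  change koszul e (f ⊗ₜ[ℂ] x) ∈ symLT κ Vd (n + 1)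
  rw [koszul_tmul]
  exact Submodule.sum_mem _ fun i _ => tmul_mem_symLT (X_mul_mem_polyLT i hf) _

theorem koszulHomotopy_mem_symLT {n : ℕ} {q : MvPolynomial κ ℂ ⊗[ℂ] Cl Vd}
    (hq : q ∈ symLT κ Vd (n + 1)) : koszulHomotopy e q ∈ symLT κ Vd n := by
  suffices symLT κ Vd (n + 1) ≤ (symLT κ Vd n).comap (koszulHomotopy e) from this hq
  refine Submodule.map₂_le.2 fun f hf x _ => ?_
  change koszulHomotopy e (f ⊗ₜ[ℂ] x) ∈ symLT κ Vd n
  rw [koszulHomotopy_tmul]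
  exact Submodule.sum_mem _ fun i _ => tmul_mem_symLT (pderiv_mem_polyLT i hf) _

/-- A filtered form of the exactness of the Koszul complex, proved by induction on the Clifford
degree: on tensors of bidegree `(n, k)` the homotopy formula is multiplication by `n + k`, up to
tensors of lower degree. -/
theorem exists_koszul_primitive (n k : ℕ) {q : MvPolynomial κ ℂ ⊗[ℂ] Cl Vd}
    (hq : q ∈ koszulLT κ Vd (n + 1) k) (hdq : koszul e q ∈ symLT κ Vd (n + 1)) :
    ∃ b ∈ symLT κ Vd n, ∃ z : ℂ,
      q - koszul e b - z • ((1 : MvPolynomial κ ℂ) ⊗ₜ[ℂ] (1 : Cl Vd)) ∈ symLT κ Vd n := by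
  induction k generalizing q with
  | zero =>
    have : clLT Vd 0 = ⊥ := by simp [clLT]
    rw [koszulLT, this, Submodule.map₂_bot_right, Submodule.mem_bot] at hq
    exact ⟨0, zero_mem _, 0, by simp [hq]⟩
  | succ k ih =>
    have hq' : q ∈ symLT κ Vd (n + 1) := Submodule.map₂_le_map₂_right le_top hq
    -- in bidegree zero, where the homotopy formula gives nothing, `q` is a scalar
    by_cases hnk : n + k = 0
    · obtain ⟨rfl, rfl⟩ : n = 0 ∧ k = 0 := by omega
      have hle : koszulLT κ Vd 1 1 ≤
          Submodule.span ℂ {(1 : MvPolynomial κ ℂ) ⊗ₜ[ℂ] (1 : Cl Vd)} := by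
        refine Submodule.map₂_le.2 fun f hf x hx => ?_
        obtain ⟨z, rfl⟩ := exists_eq_C_of_mem_polyLT_one hf
        obtain ⟨z', rfl⟩ := exists_eq_algebraMap_of_mem_clLT_one hx
        refine Submodule.mem_span_singleton.2 ⟨z' * z, ?_⟩
        change _ = (MvPolynomial.C z) ⊗ₜ[ℂ] (algebraMap ℂ (Cl Vd) z')
        rw [Algebra.algebraMap_eq_smul_one, MvPolynomial.C_eq_smul_one, TensorProduct.tmul_smul,
          ← TensorProduct.smul_tmul', smul_smul]
      obtain ⟨z, hz⟩ := Submodule.mem_span_singleton.1 (hle hq)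
      exact ⟨0, zero_mem _, z, by simp [hz]⟩
    have ht : ((n : ℂ) + k) ≠ 0 := by exact_mod_cast hnk
    set r₁ := LinearMap.rTensor (Cl Vd)
      (∑ i, LinearMap.mulLeft ℂ (MvPolynomial.X i) ∘ₗ partialDeriv i) q - (n : ℂ) • q with hr₁
    set q₁ := LinearMap.lTensor (MvPolynomial κ ℂ) (number e) q - (k : ℂ) • q with hq₁
    have hr₁mem : r₁ ∈ symLT κ Vd n := by
      suffices symLT κ Vd (n + 1) ≤ (symLT κ Vd n).comap (LinearMap.rTensor (Cl Vd)
          (∑ i, LinearMap.mulLeft ℂ (MvPolynomial.X i) ∘ₗ partialDeriv i) -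
            (n : ℂ) • LinearMap.id) from this hq'
      refine Submodule.map₂_le.2 fun f hf x _ => ?_
      have h := tmul_mem_symLT (Vd := Vd) (euler_sub_mem_polyLT hf) x
      rw [TensorProduct.sub_tmul, ← TensorProduct.smul_tmul'] at h
      rw [Submodule.mem_comap]
      convert h using 1
      simp [LinearMap.sum_apply]
    have hq₁mem : q₁ ∈ koszulLT κ Vd (n + 1) k := by
      suffices koszulLT κ Vd (n + 1) (k + 1) ≤ (koszulLT κ Vd (n + 1) k).comap
          (LinearMap.lTensor (MvPolynomial κ ℂ) (number e) - (k : ℂ) • LinearMap.id) from this hq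
      refine Submodule.map₂_le.2 fun f hf x hx => ?_
      have h := Submodule.apply_mem_map₂ (TensorProduct.mk ℂ _ _) hf (number_sub_mem_clLT e hx)
      rw [map_sub, map_smul] at h
      exact h
    set h := koszulHomotopy e q with hh
    set r₂ := koszulHomotopy e (koszul e q) with hr₂
    have hr₂mem : r₂ ∈ symLT κ Vd n := koszulHomotopy_mem_symLT e hdq
    have hform : koszul e h + r₂ = r₁ + q₁ + ((n : ℂ) + k) • q := by
      rw [hh, hr₂, koszul_homotopy, hr₁, hq₁]
      module
    have hq₁' : q₁ = koszul e h + r₂ - r₁ - ((n : ℂ) + k) • q := by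
      rw [hform]; module
    obtain ⟨b, hb, z, hz⟩ := ih hq₁mem (by
      rw [hq₁', map_sub, map_sub, map_add, koszul_koszul, zero_add, map_smul]
      exact Submodule.sub_mem _ (Submodule.sub_mem _ (koszul_mem_symLT e hr₂mem)
        (koszul_mem_symLT e hr₁mem)) (Submodule.smul_mem _ _ hdq))
    refine ⟨((n : ℂ) + k)⁻¹ • (h - b), Submodule.smul_mem _ _ (Submodule.sub_mem _
      (koszulHomotopy_mem_symLT e hq') hb), -((n : ℂ) + k)⁻¹ * z, ?_⟩
    have hfin : q - koszul e (((n : ℂ) + k)⁻¹ • (h - b)) -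
        (-((n : ℂ) + k)⁻¹ * z) • ((1 : MvPolynomial κ ℂ) ⊗ₜ[ℂ] (1 : Cl Vd)) =
        ((n : ℂ) + k)⁻¹ • (r₂ - r₁ -
          (q₁ - koszul e b - z • ((1 : MvPolynomial κ ℂ) ⊗ₜ[ℂ] (1 : Cl Vd)))) := by
      have hq2 : q = ((n : ℂ) + k)⁻¹ • (koszul e h + r₂ - r₁ - q₁) := by
        have h3 : koszul e h + r₂ - r₁ - q₁ = ((n : ℂ) + k) • q := by rw [hform]; abel
        rw [h3, smul_smul, inv_mul_cancel₀ ht, one_smul]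
      conv_lhs => rw [hq2]
      rw [map_smul, map_sub]
      module
    rw [hfin]
    exact Submodule.smul_mem _ _ (Submodule.sub_mem _ (Submodule.sub_mem _ hr₂mem hr₁mem) hz)

end Koszul

/-! ### The symbol of the map `d` -/

section Symbol

variable {R V Vd κ : Type*} [AddCommGroup V] [Module ℝ V]
  [NormedAddCommGroup Vd] [InnerProductSpace ℝ Vd] {Φ : RootPairing R ℝ V Vd}
  {pos : Finset R} {c : R → ℝ}

section Filtration

variable {e : Module.Basis κ ℂ (ℂ ⊗[ℝ] Vd)}

variable (Φ pos c e) in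
/-- The filtration of `ℍ ⊗ C(V^∨)` by the degree in `ℍ`. -/
def fil (n : ℕ) : Submodule ℂ (HCl Φ pos c) :=
  Submodule.map₂ (TensorProduct.mk ℂ _ _) (heckeLT Φ pos c e n) ⊤

theorem tmul_mem_fil {n : ℕ} {h : Hecke Φ pos c} (hh : h ∈ heckeLT Φ pos c e n) (x : Cl Vd) :
    h ⊗ₜ[ℂ] x ∈ fil Φ pos c e n :=
  Submodule.apply_mem_map₂ (TensorProduct.mk ℂ _ _) hh Submodule.mem_top

theorem fil_mono {m n : ℕ} (h : m ≤ n) : fil Φ pos c e m ≤ fil Φ pos c e n :=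
  Submodule.map₂_le_map₂_left (heckeLT_mono h)

theorem fil_zero : fil Φ pos c e 0 = ⊥ := by
  have : heckeLT Φ pos c e 0 = ⊥ := by
    rw [heckeLT, Submodule.span_eq_bot]
    rintro _ ⟨w, f, hf, rfl⟩
    rw [polyLT_zero, Submodule.mem_bot] at hf
    rw [hf, map_zero, mul_zero]
  rw [fil, this, Submodule.map₂_bot_left]

theorem spinElt_mul_mem_fil {n : ℕ} (a : spinWeyl Φ) {x : HCl Φ pos c}
    (hx : x ∈ fil Φ pos c e n) : spinElt pos c a * x ∈ fil Φ pos c e n := by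
  suffices fil Φ pos c e n ≤ (fil Φ pos c e n).comap (LinearMap.mulLeft ℂ (spinElt pos c a)) from
    this hx
  refine Submodule.map₂_le.2 fun h hh y _ => ?_
  change spinElt pos c a * (h ⊗ₜ[ℂ] y) ∈ fil Φ pos c e n
  rw [spinElt_apply, Algebra.TensorProduct.tmul_mul_tmul]
  exact tmul_mem_fil (tW_mul_mem_heckeLT _ hh) _

theorem rho_mul_mem_fil {n : ℕ} (y : MonoidAlgebra ℂ (spinWeyl Φ)) {x : HCl Φ pos c}
    (hx : x ∈ fil Φ pos c e n) : rho Φ pos c y * x ∈ fil Φ pos c e n := by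
  induction y using MonoidAlgebra.induction_on with
  | of a => exact spinElt_mul_mem_fil a hx
  | add y z hy hz => rw [map_add, add_mul]; exact Submodule.add_mem _ hy hz
  | smul t y hy => rw [map_smul, smul_mul_assoc]; exact Submodule.smul_mem _ _ hy

theorem rho_mem_fil_one (y : MonoidAlgebra ℂ (spinWeyl Φ)) :
    rho Φ pos c y ∈ fil Φ pos c e 1 := by
  have h : (1 : HCl Φ pos c) ∈ fil Φ pos c e 1 := by
    have := tmul_mem_fil (tW_mem_heckeLT_one (e := e) (pos := pos) (c := c) (1 : weyl Φ))
      (1 : Cl Vd)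
    rwa [map_one] at this
  have := rho_mul_mem_fil y h
  rwa [mul_one] at this

variable (pos c e) in
/-- The inclusion of `S(V^∨) ⊗ C(V^∨)` into `ℍ ⊗ C(V^∨)`. -/
def incl (Φ : RootPairing R ℝ V Vd) : MvPolynomial κ ℂ ⊗[ℂ] Cl Vd →ₗ[ℂ] HCl Φ pos c :=
  LinearMap.rTensor (Cl Vd) (tPoly c Φ pos e).toLinearMap

theorem incl_tmul (f : MvPolynomial κ ℂ) (x : Cl Vd) :
    incl pos c e Φ (f ⊗ₜ[ℂ] x) = tPoly c Φ pos e f ⊗ₜ[ℂ] x := rfl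

theorem incl_mem_fil {n : ℕ} {q : MvPolynomial κ ℂ ⊗[ℂ] Cl Vd} (hq : q ∈ symLT κ Vd n) :
    incl pos c e Φ q ∈ fil Φ pos c e n := by
  suffices symLT κ Vd n ≤ (fil Φ pos c e n).comap (incl pos c e Φ) from this hq
  refine Submodule.map₂_le.2 fun f hf x _ => ?_
  change incl pos c e Φ (f ⊗ₜ[ℂ] x) ∈ fil Φ pos c e n
  rw [incl_tmul]
  have := mul_mem_heckeLT (pos := pos) (c := c) (e := e) (1 : weyl Φ) hf
  rw [map_one, one_mul] at this
  exact tmul_mem_fil this x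

end Filtration

section Symbols

variable [DecidableEq κ] {ξ : Vd} {e e' : Module.Basis κ ℂ (ℂ ⊗[ℝ] Vd)}
  [Finite R] [Φ.IsReduced]

theorem Setting.mul_rho_mem_fil (hS : Setting Φ pos c ξ e e') {n : ℕ}
    (y : MonoidAlgebra ℂ (spinWeyl Φ)) {x : HCl Φ pos c} (hx : x ∈ fil Φ pos c e n) :
    x * rho Φ pos c y ∈ fil Φ pos c e n := by
  induction y using MonoidAlgebra.induction_on with
  | of a =>
    suffices fil Φ pos c e n ≤ (fil Φ pos c e n).comap (LinearMap.mulRight ℂ (spinElt pos c a)) from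
      this hx
    refine Submodule.map₂_le.2 fun h hh y _ => ?_
    change (h ⊗ₜ[ℂ] y) * spinElt pos c a ∈ fil Φ pos c e n
    rw [spinElt_apply, Algebra.TensorProduct.tmul_mul_tmul]
    exact tmul_mem_fil (mul_tW_mem_heckeLT hS.inner_inv hS.defines hS.param_inv hh _) _
  | add y z hy hz => rw [map_add, mul_add]; exact Submodule.add_mem _ hy hz
  | smul t y hy => rw [map_smul, mul_smul_comm]; exact Submodule.smul_mem _ _ hy

theorem Setting.exists_mem_fil (hS : Setting Φ pos c ξ e e') (x : HCl Φ pos c) :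
    ∃ n, x ∈ fil Φ pos c e n := by
  induction x using TensorProduct.induction_on with
  | zero => exact ⟨0, zero_mem _⟩
  | tmul h y =>
    obtain ⟨n, hn⟩ := exists_mem_heckeLT hS.inner_inv hS.defines hS.param_inv e h
    exact ⟨n, tmul_mem_fil hn y⟩
  | add x y hx hy =>
    obtain ⟨m, hm⟩ := hx
    obtain ⟨n, hn⟩ := hy
    exact ⟨max m n, Submodule.add_mem _ (fil_mono (le_max_left _ _) hm)
      (fil_mono (le_max_right _ _) hn)⟩

variable [Fintype κ]

/-- On `S(V^∨) ⊗ C(V^∨)` the leading term of `d` is a multiple of the Koszul differential. -/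
theorem Setting.dMap_incl (hS : Setting Φ pos c ξ e e') {n : ℕ}
    {q : MvPolynomial κ ℂ ⊗[ℂ] Cl Vd} (hq : q ∈ symLT κ Vd n) :
    dMap (dirac Φ pos c e e') (incl pos c e Φ q) + (2 : ℂ) • incl pos c e Φ (koszul e q) ∈
      fil Φ pos c e n := by
  suffices symLT κ Vd n ≤ (fil Φ pos c e n).comap (dMap (dirac Φ pos c e e') ∘ₗ incl pos c e Φ +
      (2 : ℂ) • (incl pos c e Φ ∘ₗ koszul e)) from this hq
  refine Submodule.map₂_le.2 fun f hf x _ => ?_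
  change dMap (dirac Φ pos c e e') (incl pos c e Φ (f ⊗ₜ[ℂ] x)) +
    (2 : ℂ) • incl pos c e Φ (koszul e (f ⊗ₜ[ℂ] x)) ∈ fil Φ pos c e n
  have hx : ∀ y : Cl Vd, tPoly c Φ pos e f ⊗ₜ[ℂ] y ∈ fil Φ pos c e n := fun y =>
    incl_mem_fil (tmul_mem_symLT hf y)
  have hlead : leadingDirac Φ pos c e e' * (tPoly c Φ pos e f ⊗ₜ[ℂ] x) -
      (tPoly c Φ pos e f ⊗ₜ[ℂ] CliffordAlgebra.involute x) * leadingDirac Φ pos c e e' =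
      -((2 : ℂ) • incl pos c e Φ (koszul e (f ⊗ₜ[ℂ] x))) := by
    rw [leadingDirac, Finset.sum_mul, Finset.mul_sum, ← Finset.sum_sub_distrib, koszul_tmul,
      map_sum, Finset.smul_sum, ← Finset.sum_neg_distrib]
    refine Finset.sum_congr rfl fun i _ => ?_
    have h1 : tV Φ pos c (e i) = tPoly c Φ pos e (MvPolynomial.X i) := by
      rw [← linPoly_basis e, tPoly_linPoly]
    rw [Algebra.TensorProduct.tmul_mul_tmul, Algebra.TensorProduct.tmul_mul_tmul, h1, ← map_mul,
      ← map_mul, mul_comm f, ← TensorProduct.tmul_sub, ι_mul_sub_involute_mul,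
      repr_eq_form hS.dual, incl_tmul, TensorProduct.tmul_smul]
    module
  have heq : dMap (dirac Φ pos c e e') (incl pos c e Φ (f ⊗ₜ[ℂ] x)) +
      (2 : ℂ) • incl pos c e Φ (koszul e (f ⊗ₜ[ℂ] x)) =
      (tPoly c Φ pos e f ⊗ₜ[ℂ] CliffordAlgebra.involute x) *
        rho Φ pos c (reflElt pos c hS.inner_inv) -
      rho Φ pos c (reflElt pos c hS.inner_inv) * (tPoly c Φ pos e f ⊗ₜ[ℂ] x) := by
    rw [dMap_apply, incl_tmul, parity_tmul, hS.dirac_eq, sub_mul, mul_sub,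
      sub_eq_iff_eq_add.1 hlead]
    abel
  rw [heq]
  exact Submodule.sub_mem _ (hS.mul_rho_mem_fil _ (hx _)) (rho_mul_mem_fil _ (hx _))

variable [Φ.IsRootSystem]

/-- The filtered step of the argument: an element of the filtration whose image
under `d` has no higher degree is, up to lower degree, the sum of an element in the image of `d`
and an element of `ρ(ℂ[W̃])`. -/
theorem Setting.exists_primitive (hS : Setting Φ pos c ξ e e') {n : ℕ} {a : HCl Φ pos c}
    (ha : a ∈ fil Φ pos c e (n + 1))
    (hda : dMap (dirac Φ pos c e e') a ∈ fil Φ pos c e (n + 1)) :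
    ∃ b ∈ fil Φ pos c e n, ∃ y, a - dMap (dirac Φ pos c e e') b - rho Φ pos c y ∈
      fil Φ pos c e n := by
  classical
  have := Fintype.ofFinite R
  have := finite_weyl (Φ := Φ)
  have := Fintype.ofFinite (weyl Φ)
  obtain ⟨ψ, hψ⟩ := exists_pbw_coordinates (pos := pos) hS.inner_inv hS.defines e hS.param_inv
  have hlift : ∀ w : weyl Φ, ∃ b, proj Φ b = w := fun w =>
    let ⟨b, hb, _⟩ := exists_lift hS.inner_inv w
    ⟨b, hb⟩
  choose lift hlift using hlift
  set D := dirac Φ pos c e e' with hD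
  let I := incl pos c e Φ
  -- `Ψ` assembles a `W`-indexed family of tensors; by the PBW theorem its members are unique
  let Ψ : (weyl Φ → MvPolynomial κ ℂ ⊗[ℂ] Cl Vd) → HCl Φ pos c := fun q =>
    ∑ w, spinElt pos c (lift w) * I (q w)
  have hΨadd : ∀ q q', Ψ (q + q') = Ψ q + Ψ q' := by
    intro q q'
    simp only [Ψ, Pi.add_apply, map_add, mul_add, Finset.sum_add_distrib]
  have hΨsmul : ∀ (t : ℂ) q, Ψ (t • q) = t • Ψ q := by
    intro t q
    simp only [Ψ, Pi.smul_apply, map_smul, mul_smul_comm, Finset.smul_sum]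
  have hΨmem : ∀ m q, (∀ w, q w ∈ symLT κ Vd m) → Ψ q ∈ fil Φ pos c e m := fun m q hq =>
    Submodule.sum_mem _ fun w _ => spinElt_mul_mem_fil _ (incl_mem_fil (hq w))
  have hΨsingle : ∀ w q, Ψ (Pi.single w q) = spinElt pos c (lift w) * I q := by
    intro w q
    simp only [Ψ]
    rw [Finset.sum_eq_single w]
    · rw [Pi.single_eq_same]
    · intro u _ hu
      rw [Pi.single_eq_of_ne hu, map_zero, mul_zero]
    · exact fun h => absurd (Finset.mem_univ w) h
  have hspin : ∀ w f x, spinElt pos c (lift w) * I (f ⊗ₜ[ℂ] x) =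
      (tW Φ pos c w * tPoly c Φ pos e f) ⊗ₜ[ℂ]
        ((((lift w : spinWeyl Φ) : (Cl Vd)ˣ) : Cl Vd) * x) := by
    intro w f x
    rw [spinElt_apply, hlift]
    exact Algebra.TensorProduct.tmul_mul_tmul _ _ _ _
  have hΨsurj : ∀ m, ∀ x ∈ fil Φ pos c e m, ∃ q, (∀ w, q w ∈ symLT κ Vd m) ∧ x = Ψ q := by
    intro m x hx
    rw [fil, Submodule.map₂_eq_span_image2] at hx
    have hadd : ∀ x y, (∃ q, (∀ w, q w ∈ symLT κ Vd m) ∧ x = Ψ q) →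
        (∃ q, (∀ w, q w ∈ symLT κ Vd m) ∧ y = Ψ q) →
        ∃ q, (∀ w, q w ∈ symLT κ Vd m) ∧ x + y = Ψ q := by
      rintro _ _ ⟨q, hq, rfl⟩ ⟨q', hq', rfl⟩
      exact ⟨q + q', fun w => Submodule.add_mem _ (hq w) (hq' w), (hΨadd q q').symm⟩
    have hsmul : ∀ (t : ℂ) x, (∃ q, (∀ w, q w ∈ symLT κ Vd m) ∧ x = Ψ q) →
        ∃ q, (∀ w, q w ∈ symLT κ Vd m) ∧ t • x = Ψ q := by
      rintro t _ ⟨q, hq, rfl⟩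
      exact ⟨t • q, fun w => Submodule.smul_mem _ _ (hq w), (hΨsmul t q).symm⟩
    have hzero : ∃ q, (∀ w, q w ∈ symLT κ Vd m) ∧ (0 : HCl Φ pos c) = Ψ q :=
      ⟨0, fun w => zero_mem _, by simp [Ψ]⟩
    induction hx using Submodule.span_induction with
    | mem x hx =>
      obtain ⟨h, hh, x, -, rfl⟩ := hx
      change ∃ q, (∀ w, q w ∈ symLT κ Vd m) ∧ h ⊗ₜ[ℂ] x = Ψ q
      have hh' : h ∈ heckeLT Φ pos c e m := hh
      clear hh
      rw [heckeLT] at hh'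
      induction hh' using Submodule.span_induction with
      | mem h hh =>
        obtain ⟨w, f, hf, rfl⟩ := hh
        refine ⟨Pi.single w (f ⊗ₜ[ℂ] ((((lift w : spinWeyl Φ) : (Cl Vd)ˣ)⁻¹ : (Cl Vd)ˣ) * x)),
          fun u => ?_, ?_⟩
        · by_cases hu : u = w
          · subst hu
            rw [Pi.single_eq_same]
            exact tmul_mem_symLT hf _
          · rw [Pi.single_eq_of_ne hu]
            exact zero_mem _
        · rw [hΨsingle, hspin, Units.mul_inv_cancel_left]
      | zero => rw [TensorProduct.zero_tmul]; exact hzero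
      | add a b ha hb iha ihb =>
        rw [TensorProduct.add_tmul]
        exact hadd _ _ iha ihb
      | smul t a ha iha =>
        rw [← TensorProduct.smul_tmul']
        exact hsmul t _ iha
    | zero => exact hzero
    | add x y _ _ hx hy => exact hadd x y hx hy
    | smul t x _ hx => exact hsmul t x hx
  have hΨinj : ∀ q q', Ψ q = Ψ q' → q = q' := by
    let π : weyl Φ → HCl Φ pos c →ₗ[ℂ] MvPolynomial κ ℂ ⊗[ℂ] Cl Vd := fun w =>
      TensorProduct.map (LinearMap.proj w ∘ₗ ψ) (LinearMap.mulLeft ℂ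
        ((((lift w : spinWeyl Φ) : (Cl Vd)ˣ)⁻¹ : (Cl Vd)ˣ) : Cl Vd))
    have hπ : ∀ w u q, π w (spinElt pos c (lift u) * I q) = if u = w then q else 0 := by
      intro w u q
      induction q using TensorProduct.induction_on with
      | zero => simp
      | tmul f x =>
        rw [hspin]
        change ψ (tW Φ pos c u * tPoly c Φ pos e f) w ⊗ₜ[ℂ]
          (((((lift w : spinWeyl Φ) : (Cl Vd)ˣ)⁻¹ : (Cl Vd)ˣ) : Cl Vd) * _) = _
        rw [hψ]
        by_cases hu : u = w
        · subst hu
          rw [Pi.single_eq_same, if_pos rfl, Units.inv_mul_cancel_left]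
        · rw [Pi.single_eq_of_ne (Ne.symm hu), if_neg hu, TensorProduct.zero_tmul]
      | add x y hx hy =>
        rw [map_add, mul_add, map_add, hx, hy]
        split_ifs <;> simp
    intro q q' h
    funext w
    have h1 : ∀ q, π w (Ψ q) = q w := by
      intro q
      simp only [Ψ, map_sum, hπ, Finset.sum_ite_eq', Finset.mem_univ, if_true]
    rw [← h1 q, h, h1]
  have hdΨ : ∀ m q, (∀ w, q w ∈ symLT κ Vd m) →
      dMap D (Ψ q) + (2 : ℂ) • Ψ (fun w => (sgn Φ (lift w) : ℂ) • koszul e (q w)) ∈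
        fil Φ pos c e m := by
    intro m q hq
    simp only [Ψ]
    rw [map_sum, Finset.smul_sum, ← Finset.sum_add_distrib]
    refine Submodule.sum_mem _ fun w _ => ?_
    have h1 : dMap D (spinElt pos c (lift w) * I (q w)) +
        (2 : ℂ) • (spinElt pos c (lift w) * I ((sgn Φ (lift w) : ℂ) • koszul e (q w))) =
        (sgn Φ (lift w) : ℂ) • (spinElt pos c (lift w) *
          (dMap D (I (q w)) + (2 : ℂ) • I (koszul e (q w)))) := by
      rw [hD, hS.dMap_spinElt_mul, map_smul, mul_smul_comm, mul_add, smul_add, mul_smul_comm,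
        smul_comm (2 : ℂ)]
    rw [h1]
    exact Submodule.smul_mem _ _ (spinElt_mul_mem_fil _ (hS.dMap_incl (hq w)))
  obtain ⟨q, hq, rfl⟩ := hΨsurj _ a ha
  -- the leading term of `d a` vanishes, so that all components of the symbol are Koszul cycles
  have hcycle : ∀ w, koszul e (q w) ∈ symLT κ Vd (n + 1) := by
    have h1 := Submodule.sub_mem _ (hdΨ _ q hq) hda
    rw [add_sub_cancel_left, ← hΨsmul] at h1
    obtain ⟨q', hq', h2⟩ := hΨsurj _ _ h1
    have h3 := hΨinj _ _ h2
    intro w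
    have h4 := hq' w
    rw [← h3, Pi.smul_apply, Submodule.smul_mem_iff _ (two_ne_zero (α := ℂ)),
      Submodule.smul_mem_iff] at h4
    · exact h4
    · intro h0
      have := hS.sgn_mul_self (lift w)
      rw [h0, zero_mul] at this
      exact zero_ne_one this
  have hprim : ∀ w, ∃ b ∈ symLT κ Vd n, ∃ z : ℂ,
      q w - koszul e b - z • ((1 : MvPolynomial κ ℂ) ⊗ₜ[ℂ] (1 : Cl Vd)) ∈ symLT κ Vd n := by
    intro w
    obtain ⟨k, hk⟩ := exists_mem_koszulLT (hq w)
    exact exists_koszul_primitive e n k hk (hcycle w)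
  choose b hb z hz using hprim
  let b' : weyl Φ → MvPolynomial κ ℂ ⊗[ℂ] Cl Vd := fun w =>
    (-(1 / 2 : ℂ) * (sgn Φ (lift w) : ℂ)) • b w
  have hb' : ∀ w, b' w ∈ symLT κ Vd n := fun w => Submodule.smul_mem _ _ (hb w)
  refine ⟨Ψ b', hΨmem n b' hb', ∑ w, z w • MonoidAlgebra.of ℂ _ (lift w), ?_⟩
  have hrho : rho Φ pos c (∑ w, z w • MonoidAlgebra.of ℂ _ (lift w)) =
      Ψ (fun w => z w • ((1 : MvPolynomial κ ℂ) ⊗ₜ[ℂ] (1 : Cl Vd))) := by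
    rw [map_sum]
    refine Finset.sum_congr rfl fun w _ => ?_
    have h1 : I ((1 : MvPolynomial κ ℂ) ⊗ₜ[ℂ] (1 : Cl Vd)) = 1 := by
      change tPoly c Φ pos e 1 ⊗ₜ[ℂ] 1 = 1
      rw [map_one]
      rfl
    rw [map_smul, rho_of', map_smul, h1, mul_smul_comm, mul_one]
  have hkos : (fun w => (sgn Φ (lift w) : ℂ) • koszul e (b' w)) =
      (-(1 / 2 : ℂ)) • fun w => koszul e (b w) := by
    funext w
    rw [Pi.smul_apply, map_smul, smul_smul]
    congr 1
    linear_combination (-(1 / 2 : ℂ)) * hS.sgn_mul_self (lift w)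
  have h1 := hdΨ n b' hb'
  rw [hkos, hΨsmul, smul_smul] at h1
  have h2 : Ψ (fun w => q w - koszul e (b w) - z w • ((1 : MvPolynomial κ ℂ) ⊗ₜ[ℂ] (1 : Cl Vd))) =
      Ψ q - Ψ (fun w => koszul e (b w)) -
        Ψ (fun w => z w • ((1 : MvPolynomial κ ℂ) ⊗ₜ[ℂ] (1 : Cl Vd))) := by
    simp only [Ψ, map_sub, mul_sub, Finset.sum_sub_distrib]
  have h3 := Submodule.sub_mem _ (hΨmem n _ hz) h1
  rw [h2, ← hrho] at h3
  convert h3 using 1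
  module

end Symbols

end Symbol

/-! ### Averaging over the spin cover -/

section Average

section Averaging

variable {G B B' : Type*} [Group G] [Fintype G] [Ring B] [Algebra ℂ B] [Ring B'] [Algebra ℂ B']

/-- The projection of an algebra, acted on by a finite group by inner automorphisms, to the part
on which the group acts by the character `χ`. -/
def average (t : G →* B) (χ : G →* ℂ) : B →ₗ[ℂ] B :=
  (Fintype.card G : ℂ)⁻¹ • ∑ a, χ a • (LinearMap.mulLeft ℂ (t a) ∘ₗ LinearMap.mulRight ℂ (t a⁻¹))

theorem average_apply (t : G →* B) (χ : G →* ℂ) (x : B) :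
    average t χ x = (Fintype.card G : ℂ)⁻¹ • ∑ a, χ a • (t a * (x * t a⁻¹)) := by
  simp [average, LinearMap.sum_apply]

theorem mul_average (t : G →* B) {χ : G →* ℂ} (hχ : ∀ a, χ a * χ a = 1) (x : B) (b : G) :
    t b * average t χ x = χ b • (average t χ x * t b) := by
  have h : ∑ a, t b * χ a • (t a * (x * t a⁻¹)) =
      ∑ a, χ b • (χ a • (t a * (x * t a⁻¹)) * t b) :=
    Fintype.sum_equiv (Equiv.mulLeft b) _ _ fun a => by
      rw [Equiv.coe_mulLeft, mul_smul_comm, smul_mul_assoc, smul_smul, map_mul χ, ← mul_assoc (χ b),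
        hχ, one_mul, mul_assoc (t (b * a)), mul_assoc x, ← map_mul t (b * a)⁻¹, mul_inv_rev,
        inv_mul_cancel_right, ← mul_assoc, ← map_mul]
  rw [average_apply, mul_smul_comm, smul_mul_assoc, smul_comm (χ b), Finset.mul_sum, h,
    Finset.sum_mul, ← Finset.smul_sum]

theorem average_eq_self (t : G →* B) {χ : G →* ℂ} (hχ : ∀ a, χ a * χ a = 1) {x : B}
    (hx : ∀ a, t a * x = χ a • (x * t a)) : average t χ x = x := by
  have h : ∀ a, χ a • (t a * (x * t a⁻¹)) = x := by
    intro a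
    rw [← mul_assoc, hx, smul_mul_assoc, smul_smul, hχ, one_smul, mul_assoc, ← map_mul,
      mul_inv_cancel, map_one, mul_one]
  rw [average_apply, Finset.sum_congr rfl fun a _ => h a, Finset.sum_const, Finset.card_univ,
    ← Nat.cast_smul_eq_nsmul ℂ, smul_smul, inv_mul_cancel₀, one_smul]
  exact Nat.cast_ne_zero.2 Fintype.card_ne_zero

theorem map_average (F : B →ₐ[ℂ] B') (t : G →* B) (t' : G →* B') (ht : ∀ a, F (t a) = t' a)
    (χ : G →* ℂ) (y : B) : F (average t χ y) = average t' χ (F y) := by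
  simp only [average_apply, map_smul, map_sum, map_mul, ht]

end Averaging

variable {R V Vd κ : Type*} [AddCommGroup V] [Module ℝ V]
  [NormedAddCommGroup Vd] [InnerProductSpace ℝ Vd] {Φ : RootPairing R ℝ V Vd}
  {pos : Finset R} {c : R → ℝ}

variable (Φ) in
/-- The sign character of `W̃`. -/
def sgnHom : spinWeyl Φ →* ℂ where
  toFun a := (sgn Φ a : ℂ)
  map_one' := by simp [sgn]
  map_mul' a b := by rw [sgn_mul, Complex.ofReal_mul]

theorem sgnHom_apply (a : spinWeyl Φ) : sgnHom Φ a = (sgn Φ a : ℂ) := rfl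

theorem mem_trivPart {x : HCl Φ pos c} : x ∈ trivPart Φ pos c ↔
    ∀ a, spinElt pos c a * x = (1 : spinWeyl Φ →* ℂ) a • (x * spinElt pos c a) := by
  simp only [MonoidHom.one_apply, one_smul]
  exact Iff.rfl

theorem mem_sgnPart {x : HCl Φ pos c} : x ∈ sgnPart Φ pos c ↔
    ∀ a, spinElt pos c a * x = sgnHom Φ a • (x * spinElt pos c a) := Iff.rfl

section Main

variable [DecidableEq κ] {ξ : Vd} {e e' : Module.Basis κ ℂ (ℂ ⊗[ℝ] Vd)} [Finite R]

theorem sgnHom_reflLift [Φ.IsRootSystem] (hin : InvariantInner Φ) (β : R) :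
    sgnHom Φ (reflLift hin β) = -1 := by
  rw [sgnHom_apply, sgn, proj_reflLift]
  exact (congrArg Complex.ofReal (det_coreflection β)).trans (by simp)

theorem Setting.average_mem_fil [Φ.IsReduced] (hS : Setting Φ pos c ξ e e')
    [Fintype (spinWeyl Φ)] (χ : spinWeyl Φ →* ℂ) {n : ℕ} {x : HCl Φ pos c}
    (hx : x ∈ fil Φ pos c e n) :
    average (spinElt pos c) χ x ∈ fil Φ pos c e n := by
  rw [average_apply]
  exact Submodule.smul_mem _ _ (Submodule.sum_mem _ fun a _ => Submodule.smul_mem _ _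
    (spinElt_mul_mem_fil a (hS.mul_rho_mem_fil (MonoidAlgebra.of ℂ _ a⁻¹) hx)))

variable [Φ.IsRootSystem] [Φ.IsReduced] [Fintype κ]

theorem Setting.dMap_equivariant (hS : Setting Φ pos c ξ e e') {χ : spinWeyl Φ →* ℂ}
    {x : HCl Φ pos c} (hx : ∀ a, spinElt pos c a * x = χ a • (x * spinElt pos c a))
    (a : spinWeyl Φ) :
    spinElt pos c a * dMap (dirac Φ pos c e e') x =
      (χ * sgnHom Φ) a • (dMap (dirac Φ pos c e e') x * spinElt pos c a) := by
  have h := hS.dMap_spinElt_mul a x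
  rw [hx, map_smul, hS.dMap_mul_spinElt] at h
  rw [MonoidHom.mul_apply, sgnHom_apply, mul_comm, mul_smul, h, smul_smul, hS.sgn_mul_self,
    one_smul]

theorem Setting.dMap_average (hS : Setting Φ pos c ξ e e') [Fintype (spinWeyl Φ)]
    (χ : spinWeyl Φ →* ℂ) (x : HCl Φ pos c) :
    dMap (dirac Φ pos c e e') (average (spinElt pos c) (χ * sgnHom Φ) x) =
      average (spinElt pos c) χ (dMap (dirac Φ pos c e e') x) := by
  rw [average_apply, average_apply, map_smul, map_sum]
  congr 1
  refine Finset.sum_congr rfl fun a _ => ?_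
  rw [map_smul, hS.dMap_spinElt_mul, hS.dMap_mul_spinElt, smul_smul, MonoidHom.mul_apply,
    sgnHom_apply, mul_assoc, hS.sgn_mul_self, mul_one]

/-- An element `a` that transforms under `W̃` by a character with values `±1`, constant on the lifts
of the reflections (such as the trivial character and the sign), and for which `d a` has degree
zero, is the sum of the image under `d` of an equivariant element and an element of `ρ(ℂ[W̃])`. -/
theorem Setting.exists_eq_dMap_add_rho (hS : Setting Φ pos c ξ e e') {χ : spinWeyl Φ →* ℂ}
    (hχ : ∀ a, χ a * χ a = 1) {η : ℂ} (hη : η * η = 1)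
    (hχη : ∀ β, χ (reflLift hS.inner_inv β) = η) {a : HCl Φ pos c}
    (ha : ∀ w, spinElt pos c w * a = χ w • (a * spinElt pos c w))
    (hda : dMap (dirac Φ pos c e e') a ∈ fil Φ pos c e 1) :
    ∃ b, (∀ w, spinElt pos c w * b = (χ * sgnHom Φ) w • (b * spinElt pos c w)) ∧ ∃ y,
      a = dMap (dirac Φ pos c e e') b + rho Φ pos c y := by
  have := finite_spinWeyl (Φ := Φ) hS.dual
  have := Fintype.ofFinite (spinWeyl Φ)
  have hχ' : ∀ w, (χ * sgnHom Φ) w * (χ * sgnHom Φ) w = 1 := by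
    intro w
    rw [MonoidHom.mul_apply, mul_mul_mul_comm, hχ, one_mul]
    exact hS.sgn_mul_self w
  obtain ⟨n, hn⟩ := hS.exists_mem_fil a
  induction n generalizing a with
  | zero =>
    rw [fil_zero, Submodule.mem_bot] at hn
    exact ⟨0, by simp, 0, by simp [hn]⟩
  | succ n ih =>
    obtain ⟨b, -, y, hr⟩ := hS.exists_primitive hn (fil_mono (by omega) hda)
    set b₁ := average (spinElt pos c) (χ * sgnHom Φ) b with hb₁
    set y₁ := average (MonoidAlgebra.of ℂ (spinWeyl Φ)) χ y with hy₁
    have hb₁' : ∀ w, spinElt pos c w * b₁ = (χ * sgnHom Φ) w • (b₁ * spinElt pos c w) :=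
      mul_average _ hχ' b
    have heq : average (spinElt pos c) χ (a - dMap (dirac Φ pos c e e') b - rho Φ pos c y) =
        a - dMap (dirac Φ pos c e e') b₁ - rho Φ pos c y₁ := by
      rw [map_sub, map_sub, average_eq_self _ hχ ha, ← hS.dMap_average, hy₁,
        map_average (rho Φ pos c) _ (spinElt pos c) fun _ => rfl]
    have hdd : dMap (dirac Φ pos c e e') (dMap (dirac Φ pos c e e') b₁) = 0 := by
      refine hS.dMap_dMap_eq_zero (η := -η) (by rw [neg_mul_neg, hη]) fun β => ?_
      rw [hb₁', MonoidHom.mul_apply, hχη, sgnHom_reflLift, mul_neg_one]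
    obtain ⟨b₂, hb₂, y₂, h⟩ := ih (a := a - dMap (dirac Φ pos c e e') b₁ - rho Φ pos c y₁)
      (by rw [← heq]; exact mul_average _ hχ _)
      (by rw [map_sub, map_sub, hdd, hS.dMap_rho, sub_zero, sub_zero]; exact hda)
      (by rw [← heq]; exact hS.average_mem_fil χ hr)
    refine ⟨b₁ + b₂, fun w => ?_, y₁ + y₂, ?_⟩
    · rw [mul_add, add_mul, hb₁', hb₂, smul_add]
    · rw [map_add, map_add]
      rw [sub_sub, sub_eq_iff_eq_add] at h
      rw [h]
      abel

end Main

end Average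

end DiracHecke

end

open DiracHecke in
theorem theorem5p1 {R V Vd κ : Type*} [Finite R] [AddCommGroup V] [Module ℝ V]
    [NormedAddCommGroup Vd] [InnerProductSpace ℝ Vd]
    (Φ : RootPairing R ℝ V Vd) [Φ.IsRootSystem] [Φ.IsReduced]
    (hinner : ∀ (i : R) (x y : Vd),
      inner ℝ (Φ.coreflection i x) (Φ.coreflection i y) = inner ℝ x y)
    (pos : Finset R) (hpos : IsPositiveSystem Φ pos)
    (c : R → ℝ) (hc : ∀ i j, c (Φ.reflectionPerm i j) = c j)
    [Fintype κ] [DecidableEq κ] (e e' : Module.Basis κ ℂ (TensorProduct ℝ ℂ Vd))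
    (hdual : ∀ i j, form Vd (e i) (e' j) = if i = j then 1 else 0) :
    (LinearMap.ker (dTriv (dirac Φ pos c e e'))).map (trivPart Φ pos c).subtype =
        LinearMap.range (dSgn (dirac Φ pos c e e')) ⊔
          (groupInvariants Φ).map (rho Φ pos c).toLinearMap ∧
      Disjoint (LinearMap.range (dSgn (dirac Φ pos c e e')))
        ((groupInvariants Φ).map (rho Φ pos c).toLinearMap) := by
  obtain ⟨ξ, hξ⟩ := hpos.exists_defines
  have hS : Setting Φ pos c ξ e e' := ⟨hinner, hξ, hc, hdual⟩
  have := finite_spinWeyl (Φ := Φ) hdual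
  have := Fintype.ofFinite (spinWeyl Φ)
  have hsgn : ∀ a, sgnHom Φ a * sgnHom Φ a = 1 := hS.sgn_mul_self
  have hsgn' : sgnHom Φ * sgnHom Φ = 1 := MonoidHom.ext hsgn
  have hone : ∀ a, (1 : spinWeyl Φ →* ℂ) a * (1 : spinWeyl Φ →* ℂ) a = 1 := fun _ => one_mul 1
  constructor
  · refine le_antisymm ?_ (sup_le ?_ ?_)
    · rintro _ ⟨⟨a, ha⟩, hda, rfl⟩
      have hda' : dMap (dirac Φ pos c e e') a = 0 := hda
      rw [mem_trivPart] at ha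
      obtain ⟨b, hb, y, hab⟩ := hS.exists_eq_dMap_add_rho hone (η := 1) (one_mul 1)
        (fun _ => rfl) ha (by rw [hda']; exact zero_mem _)
      rw [one_mul] at hb
      -- averaging replaces `y` by a conjugation invariant with the same image
      set y' := average (MonoidAlgebra.of ℂ (spinWeyl Φ)) 1 y with hy'
      have hdb := hS.dMap_equivariant hb
      rw [hsgn'] at hdb
      have hrho : ∀ w, spinElt pos c w * rho Φ pos c y =
          (1 : spinWeyl Φ →* ℂ) w • (rho Φ pos c y * spinElt pos c w) := by
        intro w
        rw [eq_sub_of_add_eq' hab.symm, mul_sub, sub_mul, ha, hdb, smul_sub]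
      have hyy : rho Φ pos c y' = rho Φ pos c y := by
        rw [hy', map_average (rho Φ pos c) _ (spinElt pos c) fun _ => rfl,
          average_eq_self _ hone hrho]
      refine Submodule.mem_sup.2 ⟨_, ⟨⟨b, mem_sgnPart.2 hb⟩, rfl⟩, _, ⟨y', ?_, rfl⟩, ?_⟩
      · intro w
        rw [hy', mul_average _ hone, MonoidHom.one_apply, one_smul, mul_assoc, ← map_mul,
          mul_inv_cancel, map_one, mul_one]
      · change dMap (dirac Φ pos c e e') b + rho Φ pos c y' = a
        rw [hyy, hab]
    · rintro _ ⟨⟨b, hb⟩, rfl⟩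
      rw [mem_sgnPart] at hb
      have hdb := hS.dMap_equivariant hb
      rw [hsgn'] at hdb
      refine ⟨⟨dMap (dirac Φ pos c e e') b, mem_trivPart.2 hdb⟩, ?_, rfl⟩
      change dMap (dirac Φ pos c e e') (dMap (dirac Φ pos c e e') b) = 0
      refine hS.dMap_dMap_eq_zero (η := -1) (by norm_num) fun β => ?_
      rw [hb, sgnHom_reflLift]
    · rintro _ ⟨y, hy, rfl⟩
      refine ⟨⟨rho Φ pos c y, fun a => ?_⟩, hS.dMap_rho y, rfl⟩
      rw [← map_mul, ← map_mul]
      congr 1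
      conv_rhs => rw [← hy a]
      rw [mul_assoc, mul_assoc, ← map_mul, inv_mul_cancel, map_one, mul_one]
  · rw [Submodule.disjoint_def]
    rintro _ ⟨⟨b, hb⟩, rfl⟩ ⟨y, -, hy⟩
    rw [mem_sgnPart] at hb
    have hy' : rho Φ pos c y = dMap (dirac Φ pos c e e') b := hy
    obtain ⟨b', hb', y', hbb⟩ := hS.exists_eq_dMap_add_rho hsgn (η := -1) (by norm_num)
      (sgnHom_reflLift hinner) hb (by rw [← hy']; exact rho_mem_fil_one y)
    rw [hsgn'] at hb'
    change dMap (dirac Φ pos c e e') b = 0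
    rw [hbb, map_add, hS.dMap_rho, add_zero]
    refine hS.dMap_dMap_eq_zero (η := 1) (one_mul 1) fun β => ?_
    rw [hb', MonoidHom.one_apply]
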